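/- **Setting.** Let $1\le d\le 3$. For $k\in\mathbb N$ let $\Sigma^k=\Sigma^k(\mathbb R^d)=\{v\in L^2(\mathbb R^d;\mathbb C):\ \|v\|_{\Sigma^k}^2:=\sum_{|\alpha|+|\beta|\le k}\|x^\beta\partial^\alpha v\|_{L^2}^2<\infty\}$, let $\langle u,v\rangle=\int u\bar v\,dx$, and let $A=-\Delta+|x|^2$. Let $(e_n)_{n\in\mathbb N}$ be the normalized Hermite functions on $\mathbb R$, let $\Sigma_K$ ($K\ge 1$) be the span of the products $e_{m_1}(x_1)\cdots e_{m_d}(x_d)$ with $0\le m_i<K$, let $P_K$ be the orthogonal projection of $L^2$ onto $\Sigma_K$, and let $A_K=AP_K$. *Assumption 1.* $(B_K)_{K\ge1}$ is a family of self-adjoint bounded operators on $L^2(\mathbb R^d)$ with values in $\Sigma_K$, such that for every $k\in\mathbb N$ there is $C(k)>0$ with, for all $K\ge1$: $\|B_K\phi\|_{\Sigma^k}\le C(k)\|\phi\|_{\Sigma^{k+2}}$ for $\phi\in\Sigma^{k+2}$; $\|B_K\phi\|_{\Sigma^k}\le C(k)K\|\phi\|_{\Sigma^{k}}$ for $\phi\in\Sigma^{k}$;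 $\|[A^k,B_K]\phi\|_{L^2}\le C(k)\|\phi\|_{\Sigma^{2k}}$ for $\phi\in\Sigma^{2k}$; $|\mathrm{Re}\langle[A^k,B_K]\phi,B_K\phi\rangle|\le C(k)\|\phi\|_{\Sigma^k}^2$ for $\phi\in\Sigma^k$, where $\langle B_KA^k\phi,B_K\phi\rangle$ means $\langle\phi,A^kB_KB_K\phi\rangle$. Let $\theta\in C^\infty([0,\infty))$, $\theta\ge0$, $\theta=1$ on $[0,1]$, $\theta=0$ on $(2,\infty)$. For $k,L\in\mathbb N$, $L\ge1$, put $$g^k_L(u,v)=\theta\big(\|u\|_{\Sigma^k}^2/L\big)\,\theta\big(\|v\|_{\Sigma^k}^2/L\big)\,\tfrac12\big(|u|^2+|v|^2\big)\,\tfrac{u+v}{2}.$$ Let $W$ be a standard real Brownian motion on a probability space, $T>0$, $N\ge1$, $\delta t=T/N$, $t_n=n\,\delta t$, $\mathcal F_n=\sigma(W_s,\,s\le t_n)$, $\chi^{n+1}=\delta t^{-1/2}(W_{t_{n+1}}-W_{t_n})$. For $C_0>0$ let $$\tau=\min\big(\{1\le n\le N:\ |W_{t_n}-W_{t_{n-1}}|\ge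 C_0\}\cup\{N+1\}\big).$$ For $\chi\in\mathbb R$ define on $\Sigma_K$ the operators $R_\chi=\big(\mathrm{Id}+i\tfrac{\delta t}2A_K+i\tfrac{\sqrt{\delta t}}2\chi B_K\big)^{-1}$ and $Q_\chi=R_\chi\big(\mathrm{Id}-i\tfrac{\delta t}2A_K-i\tfrac{\sqrt{\delta t}}2\chi B_K\big)$. If $n+1<\tau$ put $T^{-1}_{n+1}=R_{\chi^{n+1}}$ and $S_{n+1}=Q_{\chi^{n+1}}$; otherwise put $T^{-1}_{n+1}=0$ and $S_{n+1}=\mathrm{Id}$. The scheme is $$\phi^{n+1}=S_{n+1}\phi^n-i\,\delta t\,T^{-1}_{n+1}P_K\,g^k_L(\phi^n,\phi^{n+1})\quad(0\le n<N),\qquad \phi^0=P_K\phi_0. \tag{1}$$ For $j\in\mathbb N$, call $C_0>0$ *admissible for $j$* if, with the norm $|u|_j=\langle A^ju,u\rangle^{1/2}$ (equivalent to $\|\cdot\|_{\Sigma^j}$), one has $|Q_\chi u|_j^2\le2|u|_j^2$ and $|R_\chi u|_j^2\le 2|u|_j^2$ for all $K\ge1$, $\delta t\in(0,1)$, $u\in\Sigma_K$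 and all $\chi$ with $\sqrt{\delta t}\,|\chi|<C_0$. **Proposition.** Let Assumption 1 hold and let $j\in\mathbb N$. Then an admissible $C_0$ for $j$ exists; fix any such $C_0$ in the definition of $\tau$. For all integers $L\ge1$ and all $K_0>0$ there is $\delta t_0=\delta t_0(j,L,K_0)>0$, and for every $T>0$ there is $C=C(j,L,K_0,T)>0$, such that the following holds for every integer $k$ with $d/2<k\le j$, every $\phi_0\in\Sigma^j(\mathbb R^d)$, every $N\ge1$ with $\delta t=T/N\le\delta t_0$, and every integer $K\ge1$ with $K\le K_0\,\delta t^{-1/4}$. There is an $(\mathcal F_n)$-adapted process $\phi=(\phi^n)_{0\le n\le N}$, with values in $\Sigma^j$ and $\mathbb E\sup_{n\le N}\|\phi^n\|_{\Sigma^j}^2<\infty$, which satisfies (1) almost surely; it is unique in this class up to almost sure equality; and $$\mathbb E\Big[\sup_{n\le N}\|\phi^n\|_{\Sigma^j}^2\Big]\le C(j,L,K_0,T)\,\|\phi_0\|_{\Sigma^j}^2 .$$ -/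

import Mathlib

open MeasureTheory ProbabilityTheory Set
open scoped ENNReal NNReal SchwartzMap LineDeriv Laplacian

noncomputable section

namespace GP

/-- The space `ℝ^d` with its Euclidean structure. -/
abbrev Space (d : ℕ) := EuclideanSpace ℝ (Fin d)

/-- The complex Hilbert space `L²(ℝ^d)`. -/
abbrev L2 (d : ℕ) := Lp ℂ 2 (volume : Measure (Space d))

variable {d : ℕ}

/-! ### The spaces `Σ^k` and the operator `A = -Δ + |x|²` -/

/-- An `L²` function seen as a tempered distribution. -/
def dist (u : L2 d) : 𝓢'(Space d, ℂ) := Lp.toTemperedDistribution u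

/-- The tempered distribution `X` is given by a function of `L²`. -/
def InL2 (X : 𝓢'(Space d, ℂ)) : Prop := ∃ v : L2 d, dist v = X

open Classical in
/-- The (unique) `L²` function which represents `X`; it is only used when `InL2 X` holds. -/
def toL2 (X : 𝓢'(Space d, ℂ)) : L2 d := if h : InL2 X then h.choose else 0

/-- The distribution `x^β ∂^α u`, for multi-indices `α` and `β`. -/
def weightedDeriv (α β : Fin d → ℕ) (u : L2 d) : 𝓢'(Space d, ℂ) :=
  TemperedDistribution.smulLeftCLM ℂ (fun x : Space d => ((∏ i, x i ^ β i : ℝ) : ℂ))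
    ((List.finRange d).foldr
      (fun i X => (fun Y : 𝓢'(Space d, ℂ) => ∂_{EuclideanSpace.single i (1 : ℝ)} Y)^[α i] X)
      (dist u))

/-- The pairs of multi-indices `(α, β)` with `|α| + |β| ≤ k`. -/
def indexPairs (d k : ℕ) : Finset ((Fin d → ℕ) × (Fin d → ℕ)) :=
  (Fintype.piFinset (fun _ : Fin d => Finset.range (k + 1)) ×ˢ
    Fintype.piFinset (fun _ : Fin d => Finset.range (k + 1))).filter
      (fun p => ∑ i, p.1 i + ∑ i, p.2 i ≤ k)

/-- `u ∈ Σ^k(ℝ^d)`. -/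
def MemSigma (k : ℕ) (u : L2 d) : Prop :=
  ∀ p ∈ indexPairs d k, InL2 (weightedDeriv p.1 p.2 u)

/-- The norm of `Σ^k(ℝ^d)`: `‖u‖² = ∑_{|α|+|β| ≤ k} ‖x^β ∂^α u‖²_{L²}`. -/
def sigmaNorm (k : ℕ) (u : L2 d) : ℝ :=
  Real.sqrt (∑ p ∈ indexPairs d k, ‖toL2 (weightedDeriv p.1 p.2 u)‖ ^ 2)

/-- The operator `A = -Δ + |x|²` on tempered distributions. -/
def harmonic (X : 𝓢'(Space d, ℂ)) : 𝓢'(Space d, ℂ) :=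
  -Δ X + TemperedDistribution.smulLeftCLM ℂ (fun x : Space d => ((‖x‖ ^ 2 : ℝ) : ℂ)) X

/-- `A^k u` for `u ∈ L²` such that `A^k u ∈ L²`, in particular for `u ∈ Σ^{2k}`. -/
def opA (k : ℕ) (u : L2 d) : L2 d := toL2 (harmonic^[k] (dist u))

/-- `⟨A^j u, u⟩`: the square of the Hilbert norm of `Σ^j` which is associated with `A`. -/
def energy (j : ℕ) (u : L2 d) : ℝ := (inner ℂ (opA j u) u).re

/-! ### Hermite functions and the spaces `Σ_K` -/

/-- The `n`-th normalized Hermite function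
`e_n(x) = (n! √π)^{-1/2} He_n(√2 x) exp(-x²/2)` on the real line, where `He_n` is the
probabilists' Hermite polynomial. -/
def hermiteFun (n : ℕ) (x : ℝ) : ℝ :=
  (Real.sqrt (n.factorial * Real.sqrt Real.pi))⁻¹ *
    Polynomial.aeval (Real.sqrt 2 * x) (Polynomial.hermite n) * Real.exp (-x ^ 2 / 2)

/-- The tensorized Hermite function `e_m(x) = ∏ e_{m_i}(x_i)`. -/
def hermiteTensor (m : Fin d → ℕ) (x : Space d) : ℂ := ((∏ i, hermiteFun (m i) (x i) : ℝ) : ℂ)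

theorem integrable_poly_gauss (p : Polynomial ℝ) :
    Integrable (fun x : ℝ => p.eval x * Real.exp (-x ^ 2)) := by
  induction p using Polynomial.induction_on' with
  | add p q hp hq =>
    simp only [Polynomial.eval_add, add_mul]
    exact Integrable.add hp hq
  | monomial n a =>
    have h := (integrable_rpow_mul_exp_neg_mul_sq (b := 1) one_pos (s := (n : ℝ))
      (by linarith [n.cast_nonneg (α := ℝ)])).const_mul a
    simpa [mul_assoc] using h

theorem continuous_hermiteFun (n : ℕ) : Continuous (hermiteFun n) := by
  unfold hermiteFun
  fun_prop

theorem integrable_hermiteFun_sq (n : ℕ) : Integrable (fun x : ℝ => hermiteFun n x ^ 2) := by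
  have h := (integrable_poly_gauss ((((Polynomial.hermite n).map (algebraMap ℤ ℝ)).comp
    (Polynomial.C (Real.sqrt 2) * Polynomial.X)) ^ 2)).const_mul
      ((Real.sqrt (n.factorial * Real.sqrt Real.pi))⁻¹ ^ 2)
  refine h.congr (Filter.Eventually.of_forall fun x => ?_)
  have he : Real.exp (-x ^ 2) = Real.exp (-x ^ 2 / 2) ^ 2 := by
    rw [← Real.exp_nat_mul]; congr 1; push_cast; ring
  simp only [hermiteFun, Polynomial.eval_pow, Polynomial.eval_comp, Polynomial.eval_mul,
    Polynomial.eval_C, Polynomial.eval_X, Polynomial.eval_map_algebraMap, he]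
  ring

theorem memLp_hermiteTensor (m : Fin d → ℕ) :
    MemLp (hermiteTensor m) 2 (volume : Measure (Space d)) := by
  have hc : Continuous (hermiteTensor m) := by
    unfold hermiteTensor
    have := fun n => continuous_hermiteFun n
    fun_prop
  rw [memLp_two_iff_integrable_sq_norm hc.aestronglyMeasurable]
  have h : Integrable (fun x : Fin d → ℝ => ∏ i, hermiteFun (m i) (x i) ^ 2) volume :=
    Integrable.fintype_prod fun i => integrable_hermiteFun_sq (m i)
  have h2 := (PiLp.volume_preserving_ofLp (Fin d)).integrable_comp_of_integrable h
  refine h2.congr (Filter.Eventually.of_forall fun x => ?_)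
  simp only [hermiteTensor, Function.comp_apply, Complex.norm_real, Real.norm_eq_abs, sq_abs,
    Finset.prod_pow]

/-- The tensorized Hermite function as an element of `L²`. -/
def hermiteL2 (m : Fin d → ℕ) : L2 d := (memLp_hermiteTensor m).toLp _

/-- `Σ_K(ℝ^d)`: the span of the tensor products of the first `K` Hermite functions. -/
def SigmaK (d K : ℕ) : Submodule ℂ (L2 d) :=
  Submodule.span ℂ (range fun m : Fin d → Fin K => hermiteL2 fun i => (m i : ℕ))

instance (K : ℕ) : FiniteDimensional ℂ (SigmaK d K) :=
  FiniteDimensional.span_of_finite ℂ (finite_range _)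

/-- `P_K`: the orthogonal projection of `L²` onto `Σ_K`. -/
def projK (K : ℕ) : L2 d →L[ℂ] L2 d := (SigmaK d K).starProjection

/-! ### The operators `B_K` -/

/-- The assumptions on the family `(B_K)_{K ≥ 1}` of bounded operators of `L²`. In `comm_pairing`,
for `φ ∈ Σ^k`, the pairing `⟨B_K A^k φ, B_K φ⟩` is understood by duality, i.e. as
`⟨φ, A^k B_K B_K φ⟩`; recall that `B_K` takes its values in `Σ_K`. -/
structure StabilityAssumption (B : ℕ → L2 d →L[ℂ] L2 d) : Prop where
  mem_SigmaK : ∀ K : ℕ, 1 ≤ K → ∀ φ : L2 d, B K φ ∈ SigmaK d K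
  selfAdjoint : ∀ K : ℕ, 1 ≤ K → IsSelfAdjoint (B K)
  bound_loss : ∀ k : ℕ, ∃ C : ℝ, 0 < C ∧ ∀ K : ℕ, 1 ≤ K → ∀ φ : L2 d, MemSigma (k + 2) φ →
    sigmaNorm k (B K φ) ≤ C * sigmaNorm (k + 2) φ
  bound_growth : ∀ k : ℕ, ∃ C : ℝ, 0 < C ∧ ∀ K : ℕ, 1 ≤ K → ∀ φ : L2 d, MemSigma k φ →
    sigmaNorm k (B K φ) ≤ C * K * sigmaNorm k φ
  comm_bound : ∀ k : ℕ, ∃ C : ℝ, 0 < C ∧ ∀ K : ℕ, 1 ≤ K → ∀ φ : L2 d, MemSigma (2 * k) φ →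
    ‖opA k (B K φ) - B K (opA k φ)‖ ≤ C * sigmaNorm (2 * k) φ
  comm_pairing : ∀ k : ℕ, ∃ C : ℝ, 0 < C ∧ ∀ K : ℕ, 1 ≤ K → ∀ φ : L2 d, MemSigma k φ →
    |(inner ℂ (opA k (B K φ)) (B K φ) - inner ℂ φ (opA k (B K (B K φ)))).re|
      ≤ C * sigmaNorm k φ ^ 2

/-! ### The linear Crank-Nicolson operators -/

/-- `(δt/2) A_K u + (√δt/2) χ B_K u`, where `A_K = A P_K`. -/
def halfStep (B : ℕ → L2 d →L[ℂ] L2 d) (δt : ℝ) (K : ℕ) (χ : ℝ) (u : L2 d) : L2 d :=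
  ((δt / 2 : ℝ) : ℂ) • opA 1 (projK K u) + ((Real.sqrt δt / 2 * χ : ℝ) : ℂ) • B K u

/-- `(Id + i (δt/2) A_K + i (√δt/2) χ B_K)⁻¹` on `Σ_K`. The operator to be inverted is a
bijection of `Σ_K` because `A_K` and `B_K` are symmetric. -/
def resolvent (B : ℕ → L2 d →L[ℂ] L2 d) (δt : ℝ) (K : ℕ) (χ : ℝ) (v : L2 d) : L2 d :=
  Function.invFunOn (fun u : L2 d => u + Complex.I • halfStep B δt K χ u) (SigmaK d K) v

/-- `(Id + i (δt/2) A_K + i (√δt/2) χ B_K)⁻¹ (Id - i (δt/2) A_K - i (√δt/2) χ B_K)` on `Σ_K`. -/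
def cayley (B : ℕ → L2 d →L[ℂ] L2 d) (δt : ℝ) (K : ℕ) (χ : ℝ) (u : L2 d) : L2 d :=
  resolvent B δt K χ (u - Complex.I • halfStep B δt K χ u)

/-- The threshold `C₀` on the Brownian increments is admissible for `Σ^j`: as long as the
increment `√δt χ` stays below `C₀`, the operators `S` and `T⁻¹` of the scheme are
bounded by `√2` on `Σ_K` for the norm `⟨A^j u, u⟩^{1/2}`, uniformly in `K` and `δt`. -/
def AdmissibleThreshold (B : ℕ → L2 d →L[ℂ] L2 d) (j : ℕ) (C₀ : ℝ) : Prop :=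
  0 < C₀ ∧ ∀ K : ℕ, 1 ≤ K → ∀ δt : ℝ, 0 < δt → δt < 1 → ∀ χ : ℝ, Real.sqrt δt * |χ| < C₀ →
    ∀ u ∈ SigmaK d K,
      energy j (cayley B δt K χ u) ≤ 2 * energy j u ∧
      energy j (resolvent B δt K χ u) ≤ 2 * energy j u

/-! ### The truncated nonlinearity -/

/-- A smooth cutoff on `ℝ⁺`. -/
structure IsCutoff (θ : ℝ → ℝ) : Prop where
  smooth : ContDiffOn ℝ ((⊤ : ℕ∞) : WithTop ℕ∞) θ (Ici 0)
  nonneg : ∀ x : ℝ, 0 ≤ x → 0 ≤ θ x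
  eq_one : ∀ x : ℝ, 0 ≤ x → x ≤ 1 → θ x = 1
  eq_zero : ∀ x : ℝ, 2 < x → θ x = 0

open Classical in
/-- The function `½ (|u|² + |v|²) (u + v)/2`, which is in `L²` if `u` and `v` are in `Σ^k` with
`k > d/2`. -/
def cubic (u v : L2 d) : L2 d :=
  if h : MemLp (fun x => (((‖u x‖ ^ 2 + ‖v x‖ ^ 2) / 2 : ℝ) : ℂ) * ((u x + v x) / 2)) 2
      (volume : Measure (Space d)) then h.toLp _ else 0

/-- The truncated nonlinearity `g^k_L(u, v)`, where `θ_L(x) = θ(x / L)`. -/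
def nonlin (θ : ℝ → ℝ) (k L : ℕ) (u v : L2 d) : L2 d :=
  ((θ (sigmaNorm k u ^ 2 / L) * θ (sigmaNorm k v ^ 2 / L) : ℝ) : ℂ) • cubic u v

/-! ### The scheme -/

section Scheme

variable {Ω : Type*} (W : ℝ≥0 → Ω → ℝ)

/-- The grid point `t_n = n δt`. -/
def grid (δt : ℝ) (n : ℕ) : ℝ≥0 := Real.toNNReal (n * δt)

/-- The σ-algebra `𝓕_n = σ(W_s, s ≤ t_n)`. -/
abbrev pastSigma (δt : ℝ) (n : ℕ) : MeasurableSpace Ω :=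
  ⨆ s : ℝ≥0, ⨆ _ : s ≤ grid δt n, MeasurableSpace.comap (W s) inferInstance

/-- The normalized increment of `W` between `t_n` and `t_{n+1}`; it is written `χ^{n+1}`. -/
def noise (δt : ℝ) (n : ℕ) (ω : Ω) : ℝ :=
  (Real.sqrt δt)⁻¹ * (W (grid δt (n + 1)) ω - W (grid δt n) ω)

/-- The stopping time
`τ = min ({n : 1 ≤ n ≤ N, |W_{t_n} - W_{t_{n-1}}| ≥ C₀} ∪ {N + 1})`. -/
def stopTime (δt : ℝ) (N : ℕ) (C₀ : ℝ) (ω : Ω) : ℕ :=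
  sInf ({n : ℕ | 1 ≤ n ∧ n ≤ N ∧ C₀ ≤ |W (grid δt n) ω - W (grid δt (n - 1)) ω|} ∪ {N + 1})

/-- The random operator `T⁻¹` of the step from `t_n` to `t_{n+1}`. -/
def opTinv (B : ℕ → L2 d →L[ℂ] L2 d) (δt : ℝ) (N K : ℕ) (C₀ : ℝ) (n : ℕ) (ω : Ω) (u : L2 d) :
    L2 d :=
  if n + 1 < stopTime W δt N C₀ ω then resolvent B δt K (noise W δt n ω) u else 0

/-- The random operator `S` of the step from `t_n` to `t_{n+1}`. -/
def opS (B : ℕ → L2 d →L[ℂ] L2 d) (δt : ℝ) (N K : ℕ) (C₀ : ℝ) (n : ℕ) (ω : Ω) (u : L2 d) :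
    L2 d :=
  if n + 1 < stopTime W δt N C₀ ω then cayley B δt K (noise W δt n ω) u else u

variable [MeasurableSpace Ω] (P : Measure Ω)

/-- `E (sup_{n ≤ N} ‖φ^n‖²_{Σ^j})`. -/
def expSup (j N : ℕ) (φ : ℕ → Ω → L2 d) : ℝ≥0∞ :=
  ∫⁻ ω, ⨆ n : Fin (N + 1), ENNReal.ofReal (sigmaNorm j (φ n ω) ^ 2) ∂P

/-- `(φ^n)_{n ≤ N}` is an adapted solution of the scheme, with time step `δt = T / N`, in
`L²_ω L^∞(0, T; Σ^j)`. -/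
structure IsSchemeSolution (B : ℕ → L2 d →L[ℂ] L2 d) (θ : ℝ → ℝ) (k j L K N : ℕ) (C₀ δt : ℝ)
    (φ₀ : L2 d) (φ : ℕ → Ω → L2 d) : Prop where
  adapted : ∀ n ≤ N, StronglyMeasurable[pastSigma W δt n] (φ n)
  mem : ∀ᵐ ω ∂P, ∀ n ≤ N, MemSigma j (φ n ω)
  moment : expSup P j N φ < ∞
  init : ∀ᵐ ω ∂P, φ 0 ω = projK K φ₀
  step : ∀ᵐ ω ∂P, ∀ n < N, φ (n + 1) ω =
    opS W B δt N K C₀ n ω (φ n ω) - (Complex.I * (δt : ℂ)) •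
      opTinv W B δt N K C₀ n ω (projK K (nonlin θ k L (φ n ω) (φ (n + 1) ω)))

end Scheme

end GP

end

/-! All estimates are made in the norms ‖A^{s/2} u‖ = ‖`Lam K s` u‖ on Σ_K, where A is diagonal in
the Hermite basis. The ladder operators x_i ± ∂_i show that they are equivalent to the norms of Σ^s,
uniformly in K (`exists_sigmaNorm_le`, `exists_norm_Lam_le`). Assumption 1 then becomes a set of
bounds on B_K and on D = [A^j, B_K] in a Hilbert scale.

Linear part. When a Crank-Nicolson step is tested against A^j, the operator A drops out and only the
form q(u) = Im⟨u, Du⟩ (`comForm`) survives. The bound of D from Σ^{2j} to L² gives |q(u)| ≤ C|u|_j²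
by a spectral radius argument (`norm_conj_symmetric_le`). Hence increments below a small threshold
are admissible.

Nonlinear part. The cutoffs bound the Σ^k norms of both arguments. A tame trilinear estimate
(Sobolev embedding, a Gagliardo-Nirenberg inequality, interpolation) puts only one of the three
factors in the Σ^j norm. So the truncated nonlinearity grows linearly in Σ^j
(`exists_norm_Lam_nonK_le`) and is globally Lipschitz in Σ^k (`exists_norm_Lam_nonK_sub_le`). The
resolvent is bounded on Σ^k by interpolation between L² and Σ^j, so for small δt each step is a
contraction in Σ^k. This gives existence and uniqueness, and adaptedness because the solution is a
limit of Picard iterates.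

Energy. Put e_n = |φ^n|_j², let w be the midpoint of a step and z half of its increment. By
`energy_step_identity`, e_{n+1} - e_n is √δt χ q(φ^n) plus a remainder. The remainder contains δt χ²
Re⟨Bw, Dw⟩, which the last bound of Assumption 1 controls without loss in K. It also contains √δt χ
Im⟨z, Dz⟩, where |z|_j is of order √δt K; this is δt^{3/2} K², which is O(δt) precisely when K =
O(δt^{-1/4}). In all, the remainder is at most C δt (1 + |χ|³) e_n (`exists_energy_step_le`).

Probability. The indicator of {n+1 < τ} is the product of an F_n-measurable indicator and of an even
truncation of the current increment, so the first order term stays centred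
(`SchemeRegime.energyBalance`). A pathwise Doob inequality and Gronwall's lemma bound E max e_n² by
a constant times e_0². As e_0 is deterministic, this gives E max e_n ≤ C e_0. -/

namespace GP

/-! ### Norms of operators in a scale of weighted spaces -/

section Scale

variable {E : Type*} [NormedRing E] [StarRing E] [CStarRing E]

/-- The norm of a self-adjoint element is controlled by the growth of its powers. -/
theorem norm_le_of_norm_pow_le {M : E} (hM : IsSelfAdjoint M) {c C : ℝ} (hC : 0 ≤ C)
    (h : ∀ n : ℕ, 1 ≤ n → ‖M ^ n‖ ≤ c * C ^ n) : ‖M‖ ≤ C := by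
  by_contra! hlt
  rcases hC.eq_or_lt with rfl | hC0
  · have h1 := h 1 le_rfl
    simp at h1
    simp [h1] at hlt
  have hr : 1 < ‖M‖ / C := (one_lt_div hC0).2 hlt
  obtain ⟨n, hn⟩ := pow_unbounded_of_one_lt c hr
  have h1 := h (2 ^ n) Nat.one_le_two_pow
  -- The C⋆-identity makes the norm multiplicative along powers of order 2^n, and the fixed
  -- prefactor `c` cannot compensate geometric growth.
  rw [hM.norm_pow_two_pow, ← div_le_iff₀ (by positivity), ← div_pow] at h1
  have h2 : (‖M‖ / C) ^ n ≤ (‖M‖ / C) ^ 2 ^ n :=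
    pow_le_pow_right₀ hr.le (Nat.lt_two_pow_self).le
  linarith

/-- A self-adjoint element which is similar to `Y` has a norm at most `‖Y‖`. -/
theorem norm_le_of_similar {a b P Y : E} (hba : b * a = P) (hPY : P * Y = Y)
    (hM : IsSelfAdjoint (a * Y * b)) : ‖a * Y * b‖ ≤ ‖Y‖ := by
  -- Conjugation commutes with powers because b * a acts as the identity to the left of Y. The
  -- powers of the conjugate then grow at most like ‖Y‖^n.
  have key : ∀ n : ℕ, (a * Y * b) ^ (n + 1) = a * Y ^ (n + 1) * b := by
    intro n
    induction n with
    | zero => simp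
    | succ n ih =>
      rw [pow_succ, ih, pow_succ Y (n + 1)]
      calc a * Y ^ (n + 1) * b * (a * Y * b) = a * Y ^ (n + 1) * (b * a * Y) * b := by
            simp only [mul_assoc]
        _ = _ := by rw [hba, hPY]; simp only [mul_assoc]
  refine norm_le_of_norm_pow_le (c := ‖a‖ * ‖b‖) hM (norm_nonneg _) fun n hn => ?_
  obtain ⟨m, rfl⟩ : ∃ m, n = m + 1 := ⟨n - 1, by omega⟩
  rw [key]
  calc ‖a * Y ^ (m + 1) * b‖ ≤ ‖a‖ * ‖Y ^ (m + 1)‖ * ‖b‖ :=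
        (norm_mul_le _ _).trans (by gcongr; exact norm_mul_le _ _)
    _ ≤ ‖a‖ * ‖Y‖ ^ (m + 1) * ‖b‖ := by gcongr; exact norm_pow_le' _ (by omega)
    _ = _ := by ring

variable {lam : ℤ → E}

/-- The symmetric conjugate is self-adjoint and similar, through `lam j`, to the one-sided product,
so its norm is its spectral radius. This converts a bound from Σ^{2j} to L² into a bound of a
quadratic form on Σ^j. -/
theorem norm_conj_symmetric_le (hsa : ∀ s, IsSelfAdjoint (lam s))
    (hmul : ∀ s t, lam s * lam t = lam (s + t)) {D : E} (hD : IsSelfAdjoint D) (h0 : lam 0 * D = D) (j : ℤ) :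
    ‖lam (-j) * D * lam (-j)‖ ≤ ‖D * lam (-(2 * j))‖ := by
  have h1 : lam (-j) * (D * lam (-(2 * j))) * lam j = lam (-j) * D * lam (-j) := by
    rw [mul_assoc, mul_assoc D, hmul, ← mul_assoc]; congr 2; ring
  rw [← h1]
  refine norm_le_of_similar (P := lam 0) (by rw [hmul]; simp) (by rw [← mul_assoc, h0]) ?_
  rw [h1, IsSelfAdjoint, star_mul, star_mul, (hsa _).star_eq, hD.star_eq, mul_assoc]

/-- Logarithmic convexity of k ↦ ‖N_k‖ with N_k = Λ_k R Λ_{-k}: the self-adjoint element N_k⋆ N_k is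
similar, through Λ_1, to N_{k-1}⋆ N_{k+1}. It replaces the three lines theorem for integer
exponents. -/
theorem norm_conj_sq_le (hsa : ∀ s, IsSelfAdjoint (lam s))
    (hmul : ∀ s t, lam s * lam t = lam (s + t)) {R : E} (k : ℤ) :
    ‖lam k * R * lam (-k)‖ ^ 2 ≤
      ‖lam (k - 1) * R * lam (-(k - 1))‖ * ‖lam (k + 1) * R * lam (-(k + 1))‖ := by
  set N : ℤ → E := fun k => lam k * R * lam (-k) with hN
  have hstar : ∀ k, star (N k) = lam (-k) * star R * lam k := by
    intro k
    simp only [hN, star_mul, (hsa _).star_eq, mul_assoc]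
  have h1 : ∀ k, star (N k) * N k = lam (-k) * star R * lam (2 * k) * R * lam (-k) := by
    intro k
    rw [hstar, two_mul, ← hmul]; simp only [hN, mul_assoc]
  have h2 : star (N (k - 1)) * N (k + 1) =
      lam (1 - k) * star R * lam (2 * k) * R * lam (-k - 1) := by
    rw [hstar, show 2 * k = (k - 1) + (k + 1) by ring, ← hmul]
    simp only [hN, mul_assoc, neg_sub, neg_add']
  have h3 : lam (-1) * (star (N (k - 1)) * N (k + 1)) * lam 1 = star (N k) * N k := by
    rw [h1, h2]
    have e1 : lam (-k) = lam (-1) * lam (1 - k) := by rw [hmul]; congr 1; ring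
    have e2 : lam (-k) = lam (-k - 1) * lam 1 := by rw [hmul]; congr 1; ring
    nth_rewrite 1 [e1]
    rw [e2]
    simp only [mul_assoc]
  have h4 := norm_le_of_similar (a := lam (-1)) (b := lam 1) (P := lam 0)
    (Y := star (N (k - 1)) * N (k + 1)) (by rw [hmul]; simp)
    (by rw [h2]; simp only [← mul_assoc]; rw [hmul]; simp)
    (by rw [h3]; exact IsSelfAdjoint.star_mul_self _)
  rw [h3, CStarRing.norm_star_mul_self, ← sq] at h4
  exact h4.trans ((norm_mul_le _ _).trans (by rw [norm_star]))

/-- Interpolation: an operator which is bounded at both ends of a Hilbert scale is bounded in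
between. -/
theorem norm_conj_le_of_endpoints (hsa : ∀ s, IsSelfAdjoint (lam s))
    (hmul : ∀ s t, lam s * lam t = lam (s + t)) {R : E}
    {C : ℝ} {j k : ℕ} (hkj : k ≤ j) (hz : ‖lam 0 * R * lam 0‖ ≤ C)
    (hj : ‖lam j * R * lam (-j)‖ ≤ C) : ‖lam k * R * lam (-k)‖ ≤ C := by
  set n : ℕ → ℝ := fun k => ‖lam k * R * lam (-k)‖ with hn
  have hconv : ∀ k : ℕ, n (k + 1) ^ 2 ≤ n k * n (k + 2) := by
    intro k
    have := norm_conj_sq_le hsa hmul (R := R) ((k : ℤ) + 1)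
    simpa [hn, add_assoc] using this
  have hn0 : ∀ k, 0 ≤ n k := fun k => norm_nonneg _
  obtain ⟨p, hp, hpmax⟩ := Finset.exists_max_image (Finset.range (j + 1)) n ⟨0, by simp⟩
  suffices H : n p ≤ C from (hpmax k (by simp; omega)).trans H
  clear hkj
  have hz' : n 0 ≤ C := by simpa [hn] using hz
  have hj' : n j ≤ C := hj
  by_contra! hlt
  -- A maximum larger than C would not be attained at j. By convexity it propagates from p down to
  -- 0, where the norm is at most C.
  have all : ∀ q, q ≤ p → n (p - q) = n p := by
    intro q hq
    induction q with
    | zero => simp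
    | succ q ih =>
      have hih := ih (by omega)
      have hqj : p - q ≠ j := by rintro h; rw [h] at hih; linarith
      have hpj : p ≤ j := by simpa [Nat.lt_succ_iff] using hp
      have h1 := hconv (p - (q + 1))
      have e1 : p - (q + 1) + 1 = p - q := by omega
      have e2 : p - (q + 1) + 2 = p - q + 1 := by omega
      rw [e1, e2, hih] at h1
      have h2 := hpmax (p - q + 1) (by simp; omega)
      have h3 := hpmax (p - (q + 1)) (by simp; omega)
      have hpos : 0 < n p := lt_of_le_of_lt ((hn0 0).trans hz') hlt
      refine le_antisymm h3 ?_
      have h4 : n p ^ 2 ≤ n (p - (q + 1)) * n p :=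
        h1.trans (mul_le_mul_of_nonneg_left h2 (hn0 _))
      rw [sq] at h4
      exact le_of_mul_le_mul_right h4 hpos
  have := all p le_rfl
  simp at this
  linarith

end Scale

/-! ### The resolvent of a bounded self-adjoint operator -/

section Resolvent

variable {V : Type*} [NormedAddCommGroup V] [InnerProductSpace ℂ V]

theorem inner_self_symm_im {V : Type*} [NormedAddCommGroup V] [InnerProductSpace ℂ V]
    [CompleteSpace V] {H : V →L[ℂ] V} (hH : IsSelfAdjoint H) (u : V) :
    (inner ℂ u (H u)).im = 0 := by
  have h : inner ℂ u (H u) = (starRingEnd ℂ) (inner ℂ u (H u)) := by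
    rw [inner_conj_symm]
    exact ((ContinuousLinearMap.isSelfAdjoint_iff_isSymmetric.1 hH) u u).symm
  exact Complex.conj_eq_iff_im.1 h.symm

variable [CompleteSpace V]

/-- The cross term is 2 Re(i⟨u, Hu⟩) and vanishes because ⟨u, Hu⟩ is real. Hence 1 + iH is bounded
below by 1, whatever the size of H. -/
theorem norm_sq_add_I_smul {H : V →L[ℂ] V} (hH : IsSelfAdjoint H) (u : V) :
    ‖u + Complex.I • H u‖ ^ 2 = ‖u‖ ^ 2 + ‖H u‖ ^ 2 := by
  rw [norm_add_sq (𝕜 := ℂ), inner_smul_right, norm_smul]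
  simp [inner_self_symm_im hH u]

theorem isUnit_one_add_I_smul {H : V →L[ℂ] V} (hH : IsSelfAdjoint H) :
    IsUnit (1 + Complex.I • H) := by
  have h : Complex.I ∉ spectrum ℂ H := by
    intro hmem
    have := hH.mem_spectrum_eq_re hmem
    simpa using congrArg Complex.im this
  rw [spectrum.notMem_iff] at h
  have e : (1 + Complex.I • H) =
      (algebraMap ℂ (V →L[ℂ] V) (-Complex.I)) * (algebraMap ℂ (V →L[ℂ] V) Complex.I - H) := by
    rw [mul_sub, ← map_mul, Algebra.algebraMap_eq_smul_one, Algebra.algebraMap_eq_smul_one]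
    simp
  rw [e]
  refine IsUnit.mul ?_ h
  exact (IsUnit.mk0 (-Complex.I) (by simp)).map (algebraMap ℂ (V →L[ℂ] V))

end Resolvent

end GP

namespace GP

variable {d : ℕ}

/-! ### Hermite functions as Schwartz functions -/

theorem derivative_hermite_succ (n : ℕ) :
    Polynomial.derivative (Polynomial.hermite (n + 1)) = (n + 1 : ℤ) • Polynomial.hermite n := by
  induction n with
  | zero => simp
  | succ n ih =>
    rw [Polynomial.hermite_succ (n + 1), Polynomial.derivative_sub, Polynomial.derivative_mul, ih,
      Polynomial.derivative_smul, Polynomial.derivative_X, one_mul, mul_smul_comm,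
      Polynomial.hermite_succ n]
    push_cast
    module

theorem derivative_hermite (n : ℕ) :
    Polynomial.derivative (Polynomial.hermite n) = (n : ℤ) • Polynomial.hermite (n - 1) := by
  cases n with
  | zero => simp
  | succ n => simpa using derivative_hermite_succ n

/-- The normalization constant of the Hermite functions. -/
noncomputable def hermiteConst (n : ℕ) : ℝ := (Real.sqrt (n.factorial * Real.sqrt Real.pi))⁻¹

theorem hermiteConst_succ (n : ℕ) :
    Real.sqrt (n + 1) * hermiteConst (n + 1) = hermiteConst n := by
  have h1 : (0 : ℝ) < Real.sqrt (n + 1) := by positivity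
  have h2 : (0 : ℝ) < Real.sqrt (n.factorial * Real.sqrt Real.pi) := by positivity
  rw [hermiteConst, hermiteConst, Nat.factorial_succ]
  push_cast
  rw [mul_assoc, Real.sqrt_mul (by positivity)]
  field_simp

theorem hermiteFun_raise (n : ℕ) (x : ℝ) :
    Real.sqrt (n + 1) * hermiteFun (n + 1) x = hermiteConst n *
      (Real.sqrt 2 * x * Polynomial.aeval (Real.sqrt 2 * x) (Polynomial.hermite n) -
        n * Polynomial.aeval (Real.sqrt 2 * x) (Polynomial.hermite (n - 1))) *
        Real.exp (-x ^ 2 / 2) := by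
  rw [← hermiteConst_succ, hermiteFun, Polynomial.hermite_succ, derivative_hermite]
  simp only [map_sub, map_mul, Polynomial.aeval_X, zsmul_eq_mul, Int.cast_natCast, map_natCast,
    hermiteConst]
  ring

/-- At n = 0 the truncated index n - 1 is harmless because the factor √n vanishes. The same
convention makes the later ladder formulas valid at the bottom level. -/
theorem hermiteFun_lower (n : ℕ) (x : ℝ) :
    Real.sqrt n * hermiteFun (n - 1) x = hermiteConst n *
        (n * Polynomial.aeval (Real.sqrt 2 * x) (Polynomial.hermite (n - 1))) *
        Real.exp (-x ^ 2 / 2) := by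
  cases n with
  | zero => simp
  | succ n =>
    have h := hermiteConst_succ n
    have h2 : Real.sqrt (n + 1) * Real.sqrt (n + 1) = (n + 1 : ℝ) :=
      Real.mul_self_sqrt (by positivity)
    simp only [Nat.add_sub_cancel, Nat.cast_add, Nat.cast_one, hermiteFun]
    change _ * (hermiteConst n * _ * _) = _
    rw [← h]
    linear_combination (hermiteConst (n + 1) *
      Polynomial.aeval (Real.sqrt 2 * x) (Polynomial.hermite n) * Real.exp (-x ^ 2 / 2)) * h2

theorem mul_hermiteFun (n : ℕ) (x : ℝ) :
    Real.sqrt 2 * (x * hermiteFun n x) =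
      Real.sqrt (n + 1) * hermiteFun (n + 1) x + Real.sqrt n * hermiteFun (n - 1) x := by
  rw [hermiteFun_raise, hermiteFun_lower, hermiteFun, hermiteConst]
  ring

theorem hasDerivAt_hermiteFun (n : ℕ) (x : ℝ) :
    HasDerivAt (hermiteFun n) ((Real.sqrt 2)⁻¹ *
      (Real.sqrt n * hermiteFun (n - 1) x - Real.sqrt (n + 1) * hermiteFun (n + 1) x)) x := by
  have h1 : HasDerivAt (fun y : ℝ => Real.sqrt 2 * y) (Real.sqrt 2) x := by
    simpa using (hasDerivAt_id x).const_mul (Real.sqrt 2)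
  have h2 := (Polynomial.hasDerivAt_aeval (Polynomial.hermite n) (Real.sqrt 2 * x)).comp x h1
  have h3 : HasDerivAt (fun y : ℝ => Real.exp (-y ^ 2 / 2)) (-x * Real.exp (-x ^ 2 / 2)) x := by
    have : HasDerivAt (fun y : ℝ => -y ^ 2 / 2) (-x) x := by
      convert! ((hasDerivAt_pow 2 x).neg.div_const 2) using 1
      simp; ring
    convert! this.exp using 1
    ring
  have h4 := (h2.const_mul (hermiteConst n)).mul h3
  convert! h4 using 1
  have h5 : Real.sqrt 2 * Real.sqrt 2 = 2 := Real.mul_self_sqrt (by norm_num)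
  have h6 : (Real.sqrt 2)⁻¹ * Real.sqrt 2 = 1 := inv_mul_cancel₀ (by positivity)
  rw [hermiteFun_raise, hermiteFun_lower, derivative_hermite]
  simp only [map_mul, map_natCast, zsmul_eq_mul, Int.cast_natCast, Function.comp]
  generalize Polynomial.aeval (Real.sqrt 2 * x) (Polynomial.hermite n) = a
  generalize Polynomial.aeval (Real.sqrt 2 * x) (Polynomial.hermite (n - 1)) = b
  generalize Real.exp (-x ^ 2 / 2) = c
  have h7 : (Real.sqrt 2)⁻¹ * 2 = Real.sqrt 2 := by rw [inv_mul_eq_div, div_eq_iff (by positivity), h5]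
  linear_combination (hermiteConst n * n * b * c) * h7 - (hermiteConst n * a * c * x) * h6

/-- The index obtained from `m` by raising its `i`-th entry. -/
def up (m : Fin d → ℕ) (i : Fin d) : Fin d → ℕ := Function.update m i (m i + 1)

/-- The index obtained from `m` by lowering its `i`-th entry. -/
def down (m : Fin d → ℕ) (i : Fin d) : Fin d → ℕ := Function.update m i (m i - 1)

theorem down_up (m : Fin d → ℕ) (i : Fin d) : down (up m i) i = m := by
  simp [down, up]

theorem up_down (m : Fin d → ℕ) (i : Fin d) (h : m i ≠ 0) : up (down m i) i = m := by
  simp [down, up, Nat.sub_add_cancel (Nat.one_le_iff_ne_zero.2 h)]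

theorem prod_hermiteFun_update (m : Fin d → ℕ) (i : Fin d) (n : ℕ) (x : Space d) :
    ∏ k, hermiteFun (Function.update m i n k) (x k) =
      hermiteFun n (x i) * ∏ k ∈ Finset.univ.erase i, hermiteFun (m k) (x k) := by
  rw [← Finset.mul_prod_erase _ _ (Finset.mem_univ i)]
  simp only [Function.update_self]
  congr 1
  refine Finset.prod_congr rfl fun k hk => ?_
  rw [Function.update_of_ne (Finset.ne_of_mem_erase hk)]

theorem hermiteTensor_update (m : Fin d → ℕ) (i : Fin d) (n : ℕ) (x : Space d) :
    hermiteTensor (Function.update m i n) x =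
      (hermiteFun n (x i) : ℂ) * (∏ k ∈ Finset.univ.erase i, hermiteFun (m k) (x k) : ℝ) := by
  rw [hermiteTensor, prod_hermiteFun_update]; push_cast; rfl

theorem hermiteTensor_eq (m : Fin d → ℕ) (i : Fin d) (x : Space d) :
    hermiteTensor m x =
      (hermiteFun (m i) (x i) : ℂ) * (∏ k ∈ Finset.univ.erase i, hermiteFun (m k) (x k) : ℝ) := by
  conv_lhs => rw [← Function.update_eq_self i m]
  rw [hermiteTensor_update]

/-- From t^p ≤ p! e^t with t = 1 + r; the number 3/2 is the maximum of 1 + r - r²/2, reached at r =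
1. -/
theorem one_add_pow_mul_exp_le (p : ℕ) (r : ℝ) (hr : 0 ≤ r) :
    (1 + r) ^ p * Real.exp (-(r ^ 2) / 2) ≤ p.factorial * Real.exp (3 / 2) := by
  have h1 : (1 + r) ^ p ≤ p.factorial * Real.exp (1 + r) := by
    have := Real.pow_div_factorial_le_exp (1 + r) (by linarith) p
    rwa [div_le_iff₀' (by positivity)] at this
  calc (1 + r) ^ p * Real.exp (-(r ^ 2) / 2)
      ≤ p.factorial * Real.exp (1 + r) * Real.exp (-(r ^ 2) / 2) := by gcongr
    _ = p.factorial * Real.exp (1 + r + -(r ^ 2) / 2) := by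
      rw [Real.exp_add (1 + r), mul_assoc]
    _ ≤ _ := by gcongr; nlinarith [sq_nonneg (r - 1)]

/-- All derivatives of exp equal exp, and -‖y‖²/2 has temperate growth. The bound for derivatives of
a composition therefore gives a power of 1 + ‖x‖ times the Gaussian, which absorbs it. -/
theorem gaussian_decay (k n : ℕ) : ∃ C : ℝ, ∀ x : Space d,
    ‖x‖ ^ k * ‖iteratedFDeriv ℝ n (fun y : Space d => Real.exp (-(‖y‖ ^ 2) / 2)) x‖ ≤ C := by
  have hf : Function.HasTemperateGrowth (fun y : Space d => -(‖y‖ ^ 2) / 2) := by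
    have h := (Function.HasTemperateGrowth.const (E := Space d) (-(1 / 2) : ℝ)).mul
      (Function.hasTemperateGrowth_norm_sq (Space d))
    refine (congrArg Function.HasTemperateGrowth ?_).mpr h
    funext y
    simp only [Pi.mul_apply]
    ring
  obtain ⟨k₁, C₁, hC₁, h₁⟩ := hf.norm_iteratedFDeriv_le_uniform n
  refine ⟨n.factorial * (1 + C₁) ^ n * ((k + k₁ * n).factorial * Real.exp (3 / 2)), fun x => ?_⟩
  have hg : ∀ i, i ≤ n → ‖iteratedFDeriv ℝ i Real.exp (-(‖x‖ ^ 2) / 2)‖ ≤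
      Real.exp (-(‖x‖ ^ 2) / 2) := by
    intro i _
    rw [norm_iteratedFDeriv_eq_norm_iteratedDeriv, iteratedDeriv_eq_iterate, Real.iter_deriv_exp,
      Real.norm_eq_abs, Real.abs_exp]
  have hf' : ∀ i, 1 ≤ i → i ≤ n → ‖iteratedFDeriv ℝ i (fun y : Space d => -(‖y‖ ^ 2) / 2) x‖ ≤
      ((1 + C₁) * (1 + ‖x‖) ^ k₁) ^ i := by
    intro i hi hi'
    calc _ ≤ C₁ * (1 + ‖x‖) ^ k₁ := h₁ i hi' x
      _ ≤ (1 + C₁) * (1 + ‖x‖) ^ k₁ := by gcongr; simp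
      _ ≤ _ := by
        apply le_self_pow₀ (one_le_mul_of_one_le_of_one_le (by simp [hC₁]) (by simp [one_le_pow₀]))
        omega
  have h := norm_iteratedFDeriv_comp_le (n := n) (N := ((⊤ : ℕ∞) : WithTop ℕ∞))
    Real.contDiff_exp hf.1 (mod_cast le_top) x hg hf'
  calc _ ≤ ‖x‖ ^ k * (n.factorial * Real.exp (-(‖x‖ ^ 2) / 2) *
        ((1 + C₁) * (1 + ‖x‖) ^ k₁) ^ n) := by gcongr; exact h
    _ ≤ (1 + ‖x‖) ^ k * (n.factorial * Real.exp (-(‖x‖ ^ 2) / 2) *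
        ((1 + C₁) * (1 + ‖x‖) ^ k₁) ^ n) := by gcongr; linarith
    _ = n.factorial * (1 + C₁) ^ n * ((1 + ‖x‖) ^ (k + k₁ * n) * Real.exp (-(‖x‖ ^ 2) / 2)) := by
      rw [mul_pow, ← pow_mul, pow_add]; ring
    _ ≤ _ :=
      mul_le_mul_of_nonneg_left (one_add_pow_mul_exp_le _ _ (norm_nonneg _)) (by positivity)

/-- The Gaussian `exp (-‖x‖² / 2)` as a Schwartz function. -/
noncomputable def gaussianS : 𝓢(Space d, ℂ) :=
  SchwartzMap.postcompCLM (𝕜 := ℝ) Complex.ofRealCLM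
    { toFun := fun y : Space d => Real.exp (-(‖y‖ ^ 2) / 2)
      smooth' := Real.contDiff_exp.comp ((contDiff_norm_sq ℝ).neg.div_const 2)
      decay' := gaussian_decay }

theorem gaussianS_apply (x : Space d) : gaussianS x = (Real.exp (-(‖x‖ ^ 2) / 2) : ℂ) := rfl

/-- The tensorized Hermite function as a Schwartz function. -/
noncomputable def hermiteS (m : Fin d → ℕ) : 𝓢(Space d, ℂ) :=
  SchwartzMap.smulLeftCLM ℂ (fun x : Space d => ((∏ i, (hermiteConst (m i) *
    Polynomial.aeval (Real.sqrt 2 * x i) (Polynomial.hermite (m i))) : ℝ) : ℂ)) gaussianS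

theorem hasTemperateGrowth_coord (i : Fin d) :
    Function.HasTemperateGrowth (fun x : Space d => x i) :=
  (EuclideanSpace.proj (𝕜 := ℝ) i : Space d →L[ℝ] ℝ).hasTemperateGrowth

theorem hasTemperateGrowth_aeval (p : Polynomial ℤ) {f : Space d → ℝ}
    (hf : f.HasTemperateGrowth) :
    Function.HasTemperateGrowth (fun x : Space d => Polynomial.aeval (f x) p) := by
  induction p using Polynomial.induction_on' with
  | add p q hp hq => simp only [map_add]; exact hp.add hq
  | monomial n a =>
    simp only [Polynomial.aeval_monomial]
    exact (Function.HasTemperateGrowth.const _).mul (hf.pow n)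

theorem hasTemperateGrowth_finset_prod {ι : Type*} (s : Finset ι) {f : ι → Space d → ℝ}
    (hf : ∀ i ∈ s, (f i).HasTemperateGrowth) :
    Function.HasTemperateGrowth (fun x : Space d => ∏ i ∈ s, f i x) := by
  classical
  induction s using Finset.induction_on with
  | empty => simp
  | insert a s ha ih =>
    simp only [Finset.prod_insert ha]
    exact (hf a (by simp)).mul (ih fun i hi => hf i (by simp [hi]))

theorem hasTemperateGrowth_ofReal_comp {f : Space d → ℝ} (hf : f.HasTemperateGrowth) :
    Function.HasTemperateGrowth (fun x : Space d => (f x : ℂ)) :=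
  Function.HasTemperateGrowth.comp Function.Complex.hasTemperateGrowth_ofReal hf

theorem hermiteS_apply (m : Fin d → ℕ) (x : Space d) : hermiteS m x = hermiteTensor m x := by
  have hg : Function.HasTemperateGrowth (fun x : Space d => ((∏ i, (hermiteConst (m i) *
      Polynomial.aeval (Real.sqrt 2 * x i) (Polynomial.hermite (m i))) : ℝ) : ℂ)) := by
    refine hasTemperateGrowth_ofReal_comp (hasTemperateGrowth_finset_prod _ fun i _ => ?_)
    refine (Function.HasTemperateGrowth.const _).mul (hasTemperateGrowth_aeval _ ?_)
    exact (Function.HasTemperateGrowth.const _).mul (hasTemperateGrowth_coord i)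
  rw [hermiteS, SchwartzMap.smulLeftCLM_apply_apply hg, gaussianS_apply, hermiteTensor]
  simp only [hermiteFun, ← hermiteConst.eq_1]
  rw [Finset.prod_mul_distrib (g := fun i => Real.exp (-x i ^ 2 / 2)), ← Real.exp_sum]
  rw [EuclideanSpace.norm_sq_eq, smul_eq_mul, Complex.ofReal_mul]
  congr 3
  rw [← Finset.sum_div, Finset.sum_neg_distrib]
  simp

theorem hermiteS_toLp (m : Fin d → ℕ) : (hermiteS m).toLp 2 = hermiteL2 m := by
  refine Lp.ext ?_
  filter_upwards [(hermiteS m).coeFn_toLp 2, (memLp_hermiteTensor m).coeFn_toLp] with x h1 h2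
  rw [h1, hermiteL2, h2, hermiteS_apply]

/-- Multiplication by the coordinate `x_i`. -/
noncomputable def mulX (i : Fin d) : 𝓢(Space d, ℂ) →L[ℂ] 𝓢(Space d, ℂ) :=
  SchwartzMap.smulLeftCLM ℂ (fun x : Space d => (x i : ℂ))

theorem mulX_apply (i : Fin d) (f : 𝓢(Space d, ℂ)) (x : Space d) : mulX i f x = x i * f x := by
  rw [mulX, SchwartzMap.smulLeftCLM_apply_apply
    (hasTemperateGrowth_ofReal_comp (hasTemperateGrowth_coord i)), smul_eq_mul]

/-- The partial derivative `∂_i`. -/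
noncomputable def derX (i : Fin d) : 𝓢(Space d, ℂ) →L[ℂ] 𝓢(Space d, ℂ) :=
  LineDeriv.lineDerivOpCLM ℂ 𝓢(Space d, ℂ) (EuclideanSpace.single i (1 : ℝ))

theorem derX_eq (i : Fin d) (f : 𝓢(Space d, ℂ)) :
    derX i f = ∂_{EuclideanSpace.single i (1 : ℝ)} f := rfl

theorem derX_apply (i : Fin d) (f : 𝓢(Space d, ℂ)) (x : Space d) :
    derX i f x = lineDeriv ℝ f x (EuclideanSpace.single i (1 : ℝ)) :=
  SchwartzMap.lineDerivOp_apply _ _ _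

theorem hasLineDerivAt (i : Fin d) (f : 𝓢(Space d, ℂ)) (x : Space d) :
    HasLineDerivAt ℝ f (derX i f x) x (EuclideanSpace.single i (1 : ℝ)) := by
  rw [derX_apply]
  exact (f.differentiableAt.lineDifferentiableAt).hasLineDerivAt

theorem mulX_hermiteS (i : Fin d) (m : Fin d → ℕ) :
    mulX i (hermiteS m) = ((Real.sqrt 2)⁻¹ : ℂ) • ((Real.sqrt (m i + 1) : ℂ) • hermiteS (up m i) +
      (Real.sqrt (m i) : ℂ) • hermiteS (down m i)) := by
  ext x
  simp only [mulX_apply, hermiteS_apply, _root_.smul_apply, _root_.add_apply, up, down,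
    hermiteTensor_update, hermiteTensor_eq m i, smul_eq_mul]
  have h := congrArg (fun t : ℝ => (t : ℂ)) (mul_hermiteFun (m i) (x i))
  have h2 : ((Real.sqrt 2 : ℝ) : ℂ) ≠ 0 := by simp
  push_cast at h
  generalize ((∏ k ∈ Finset.univ.erase i, hermiteFun (m k) (x k) : ℝ) : ℂ) = q at h ⊢
  have h3 : ((Real.sqrt 2 : ℝ) : ℂ)⁻¹ * (Real.sqrt 2 : ℝ) = 1 := inv_mul_cancel₀ h2
  linear_combination (((Real.sqrt 2 : ℝ) : ℂ)⁻¹ * q) * h -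
    (x i : ℂ) * hermiteFun (m i) (x i) * q * h3

theorem derX_hermiteS (i : Fin d) (m : Fin d → ℕ) :
    derX i (hermiteS m) = ((Real.sqrt 2)⁻¹ : ℂ) • ((Real.sqrt (m i) : ℂ) • hermiteS (down m i) -
      (Real.sqrt (m i + 1) : ℂ) • hermiteS (up m i)) := by
  ext x
  rw [derX_apply]
  refine HasLineDerivAt.lineDeriv ?_
  rw [HasLineDerivAt]
  have h1 : (fun t : ℝ => hermiteS m (x + t • EuclideanSpace.single i (1 : ℝ))) = fun t : ℝ =>
      (hermiteFun (m i) (x i + t) : ℂ) *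
        (∏ k ∈ Finset.univ.erase i, hermiteFun (m k) (x k) : ℝ) := by
    funext t
    rw [hermiteS_apply, hermiteTensor_eq m i]
    congr 2
    · simp
    · refine Finset.prod_congr rfl fun k hk => ?_
      simp [Finset.ne_of_mem_erase hk]
  rw [h1]
  have h2 : HasDerivAt (fun t : ℝ => hermiteFun (m i) (x i + t)) _ 0 :=
    HasDerivAt.comp_const_add (x i) 0 (by simpa using hasDerivAt_hermiteFun (m i) (x i))
  convert! (h2.ofReal_comp).mul_const _ using 1
  simp only [hermiteS_apply, _root_.smul_apply, _root_.sub_apply, up, down,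
    hermiteTensor_update, smul_eq_mul]
  push_cast
  ring

end GP

namespace GP

variable {d : ℕ}

/-! ### Ladder operators and orthonormality -/

/-- The operator `x_i - ∂_i`. -/
noncomputable def raiseX (i : Fin d) : 𝓢(Space d, ℂ) →L[ℂ] 𝓢(Space d, ℂ) := mulX i - derX i

/-- The operator `x_i + ∂_i`. -/
noncomputable def lowerX (i : Fin d) : 𝓢(Space d, ℂ) →L[ℂ] 𝓢(Space d, ℂ) := mulX i + derX i

theorem inv_sqrt_two_add :
    (((Real.sqrt 2 : ℝ) : ℂ))⁻¹ + (((Real.sqrt 2 : ℝ) : ℂ))⁻¹ = ((Real.sqrt 2 : ℝ) : ℂ) := by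
  have h5 : Real.sqrt 2 * Real.sqrt 2 = 2 := Real.mul_self_sqrt (by norm_num)
  have h7 : (Real.sqrt 2)⁻¹ + (Real.sqrt 2)⁻¹ = Real.sqrt 2 := by
    rw [← two_mul, mul_comm, inv_mul_eq_div, div_eq_iff (by positivity), h5]
  exact_mod_cast congrArg (fun t : ℝ => (t : ℂ)) h7

theorem raiseX_hermiteS (i : Fin d) (m : Fin d → ℕ) :
    raiseX i (hermiteS m) = ((Real.sqrt 2 * Real.sqrt (m i + 1) : ℝ) : ℂ) • hermiteS (up m i) := by
  rw [raiseX, _root_.sub_apply, mulX_hermiteS, derX_hermiteS]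
  push_cast
  have h := inv_sqrt_two_add
  generalize ((Real.sqrt 2 : ℝ) : ℂ)⁻¹ = q at h ⊢
  rw [← h]
  module

theorem lowerX_hermiteS (i : Fin d) (m : Fin d → ℕ) :
    lowerX i (hermiteS m) = ((Real.sqrt 2 * Real.sqrt (m i) : ℝ) : ℂ) • hermiteS (down m i) := by
  rw [lowerX, _root_.add_apply, mulX_hermiteS, derX_hermiteS]
  push_cast
  have h := inv_sqrt_two_add
  generalize ((Real.sqrt 2 : ℝ) : ℂ)⁻¹ = q at h ⊢
  rw [← h]
  module

theorem sqrt_two_mul_sqrt_sq (n : ℝ) (hn : 0 ≤ n) :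
    ((Real.sqrt 2 * Real.sqrt n : ℝ) : ℂ) * ((Real.sqrt 2 * Real.sqrt n : ℝ) : ℂ) =
      ((2 * n : ℝ) : ℂ) := by
  rw [← Complex.ofReal_mul]
  congr 1
  rw [mul_mul_mul_comm, Real.mul_self_sqrt (by norm_num), Real.mul_self_sqrt hn]

theorem raiseX_lowerX_hermiteS (i : Fin d) (m : Fin d → ℕ) :
    raiseX i (lowerX i (hermiteS m)) = ((2 * m i : ℝ) : ℂ) • hermiteS m := by
  rw [lowerX_hermiteS, map_smul, raiseX_hermiteS, smul_smul]
  rcases eq_or_ne (m i) 0 with h | h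
  · simp [h]
  · rw [up_down m i h]
    congr 1
    have h1 : ((down m i i : ℕ) : ℝ) + 1 = m i := by
      have : down m i i + 1 = m i := by simp [down]; omega
      exact_mod_cast this
    rw [h1, sqrt_two_mul_sqrt_sq _ (by positivity)]

theorem lowerX_raiseX_hermiteS (i : Fin d) (m : Fin d → ℕ) :
    lowerX i (raiseX i (hermiteS m)) = ((2 * (m i + 1) : ℝ) : ℂ) • hermiteS m := by
  rw [raiseX_hermiteS, map_smul, lowerX_hermiteS, smul_smul, down_up]
  have h1 : ((up m i i : ℕ) : ℝ) = m i + 1 := by simp [up]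
  rw [h1, sqrt_two_mul_sqrt_sq _ (by positivity)]

theorem integral_mulX_mul (i : Fin d) (f g : 𝓢(Space d, ℂ)) :
    ∫ x, mulX i f x * g x = ∫ x, f x * mulX i g x := by
  refine integral_congr_ae (Filter.Eventually.of_forall fun x => ?_)
  simp only [mulX_apply]; ring

theorem integral_derX_mul (i : Fin d) (f g : 𝓢(Space d, ℂ)) :
    ∫ x, derX i f x * g x = - ∫ x, f x * derX i g x := by
  have := SchwartzMap.integral_mul_lineDerivOp_right_eq_neg_left f g (μ := volume)
    (EuclideanSpace.single i (1 : ℝ))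
  simp only [derX_eq, this, neg_neg]

theorem integrable_mul (f g : 𝓢(Space d, ℂ)) : Integrable (fun x => f x * g x) :=
  (SchwartzMap.pairing (ContinuousLinearMap.mul ℂ ℂ) f g).integrable

theorem integral_raiseX_mul (i : Fin d) (f g : 𝓢(Space d, ℂ)) :
    ∫ x, raiseX i f x * g x = ∫ x, f x * lowerX i g x := by
  simp only [raiseX, lowerX, _root_.sub_apply, _root_.add_apply, sub_mul, mul_add]
  rw [integral_sub (integrable_mul _ _) (integrable_mul _ _),
    integral_add (integrable_mul _ _) (integrable_mul _ _), integral_mulX_mul, integral_derX_mul,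
    sub_neg_eq_add]

/-- The operator raise ∘ lower in the coordinate i is symmetric with eigenvalue 2 m_i, and m and n
differ in some coordinate. No conjugate is needed since Hermite functions are real. -/
theorem integral_hermiteS_ne {m n : Fin d → ℕ} (h : m ≠ n) :
    ∫ x, hermiteS m x * hermiteS n x = 0 := by
  obtain ⟨i, hi⟩ := Function.ne_iff.1 h
  have h1 : ∀ m n : Fin d → ℕ, ((2 * m i : ℝ) : ℂ) * ∫ x, hermiteS m x * hermiteS n x =
      ∫ x, lowerX i (hermiteS m) x * lowerX i (hermiteS n) x := by
    intro m n
    rw [← integral_raiseX_mul, raiseX_lowerX_hermiteS, ← integral_const_mul]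
    simp only [_root_.smul_apply, smul_eq_mul, mul_assoc]
  have h2 := h1 m n
  have h3 := h1 n m
  simp only [mul_comm (hermiteS n _), mul_comm (lowerX i (hermiteS n) _)] at h3
  rw [← h2] at h3
  have h4 : (((2 * n i : ℝ) : ℂ) - ((2 * m i : ℝ) : ℂ)) *
      ∫ x, hermiteS m x * hermiteS n x = 0 := by
    rw [sub_mul, h3, sub_self]
  rcases mul_eq_zero.1 h4 with h5 | h5
  · exfalso
    rw [sub_eq_zero, Complex.ofReal_inj] at h5
    exact hi (by exact_mod_cast (mul_left_cancel₀ two_ne_zero h5).symm)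
  · exact h5

theorem integral_hermiteS_zero :
    ∫ x, hermiteS (0 : Fin d → ℕ) x * hermiteS 0 x = 1 := by
  have h1 : ∀ x : Space d, hermiteS (0 : Fin d → ℕ) x * hermiteS 0 x =
      ((∏ i, ((Real.sqrt Real.pi)⁻¹ * Real.exp (-1 * (x i) ^ 2)) : ℝ) : ℂ) := by
    intro x
    simp only [hermiteS_apply, hermiteTensor, ← Complex.ofReal_mul, ← Finset.prod_mul_distrib]
    congr 1
    refine Finset.prod_congr rfl fun i _ => ?_
    have h2 : Real.exp (-1 * x i ^ 2) = Real.exp (-x i ^ 2 / 2) * Real.exp (-x i ^ 2 / 2) := by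
      rw [← Real.exp_add]; congr 1; ring
    rw [h2]
    simp only [hermiteFun, Pi.zero_apply, Nat.factorial_zero, Nat.cast_one, one_mul,
      Polynomial.hermite_zero, map_one, mul_one]
    have h3 : (Real.sqrt (Real.sqrt Real.pi))⁻¹ * (Real.sqrt (Real.sqrt Real.pi))⁻¹ =
        (Real.sqrt Real.pi)⁻¹ := by
      rw [← mul_inv, Real.mul_self_sqrt (Real.sqrt_nonneg _)]
    rw [← h3]; ring
  simp only [h1]
  rw [integral_complex_ofReal]
  have h4 := (PiLp.volume_preserving_ofLp (Fin d)).integral_comp'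
    (f := (MeasurableEquiv.toLp 2 (Fin d → ℝ)).symm) (g := fun y : Fin d → ℝ =>
      ∏ i, ((Real.sqrt Real.pi)⁻¹ * Real.exp (-1 * (y i) ^ 2)))
  have h5 : ∫ x : Space d, ∏ i, ((Real.sqrt Real.pi)⁻¹ * Real.exp (-1 * (x i) ^ 2)) =
      ∫ y : Fin d → ℝ, ∏ i, ((Real.sqrt Real.pi)⁻¹ * Real.exp (-1 * (y i) ^ 2)) := h4
  rw [h5, integral_fintype_prod_volume_eq_prod
    (f := fun _ (y : ℝ) => (Real.sqrt Real.pi)⁻¹ * Real.exp (-1 * y ^ 2))]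
  have h6 : ∫ y : ℝ, (Real.sqrt Real.pi)⁻¹ * Real.exp (-1 * y ^ 2) = 1 := by
    rw [integral_const_mul, integral_gaussian, div_one]
    exact inv_mul_cancel₀ (by positivity)
  simp only [h6, Finset.prod_const_one, Complex.ofReal_one]

/-- Since `raiseX` and `lowerX` are adjoint, the norm of a raised function is computed from lower ∘
raise, whose eigenvalue 2(m_i + 1) cancels the normalization of the raising. -/
theorem integral_hermiteS_up (m : Fin d → ℕ) (i : Fin d) :
    ∫ x, hermiteS (up m i) x * hermiteS (up m i) x = ∫ x, hermiteS m x * hermiteS m x := by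
  have h1 := integral_raiseX_mul i (hermiteS m) (raiseX i (hermiteS m))
  rw [lowerX_raiseX_hermiteS, raiseX_hermiteS] at h1
  simp only [_root_.smul_apply, smul_eq_mul, mul_mul_mul_comm _ _ (Complex.ofReal _) _,
    mul_left_comm (hermiteS m _) (Complex.ofReal _) _] at h1
  rw [integral_const_mul, integral_const_mul, sqrt_two_mul_sqrt_sq _ (by positivity)] at h1
  refine mul_left_cancel₀ ?_ h1
  rw [Complex.ofReal_ne_zero]
  positivity

theorem integral_hermiteS_self (m : Fin d → ℕ) :
    ∫ x, hermiteS m x * hermiteS m x = 1 := by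
  induction hn : ∑ i, m i generalizing m with
  | zero =>
    have : m = 0 := by
      funext i
      simpa using Finset.sum_eq_zero_iff.1 hn i (Finset.mem_univ i)
    rw [this, integral_hermiteS_zero]
  | succ n ih =>
    obtain ⟨i, hi⟩ : ∃ i, m i ≠ 0 := by
      by_contra! h
      simp [h] at hn
    rw [← up_down m i hi, integral_hermiteS_up]
    refine ih _ ?_
    have h1 := Finset.add_sum_erase Finset.univ m (Finset.mem_univ i)
    have h2 := Finset.add_sum_erase Finset.univ (down m i) (Finset.mem_univ i)
    have h3 : ∑ k ∈ Finset.univ.erase i, down m i k = ∑ k ∈ Finset.univ.erase i, m k :=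
      Finset.sum_congr rfl fun k hk => by simp [down, Finset.ne_of_mem_erase hk]
    have h4 : down m i i = m i - 1 := by simp [down]
    omega

/-- The `m`-th Hermite coefficient. -/
noncomputable def coef (u : L2 d) (m : Fin d → ℕ) : ℂ := inner ℂ (hermiteL2 m) u

theorem dist_apply (u : L2 d) (f : 𝓢(Space d, ℂ)) : dist u f = ∫ x, f x * u x := by
  rw [dist, Lp.toTemperedDistribution_apply]; rfl

theorem conj_hermiteS (m : Fin d → ℕ) (x : Space d) :
    (starRingEnd ℂ) (hermiteS m x) = hermiteS m x := by
  rw [hermiteS_apply, hermiteTensor, Complex.conj_ofReal]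

theorem coef_eq_dist (u : L2 d) (m : Fin d → ℕ) : coef u m = dist u (hermiteS m) := by
  rw [coef, dist_apply, L2.inner_def]
  refine integral_congr_ae ?_
  filter_upwards [(memLp_hermiteTensor m).coeFn_toLp] with x h2
  rw [hermiteL2, h2, ← hermiteS_apply, RCLike.inner_apply, conj_hermiteS, mul_comm]

theorem dist_toLp (f : 𝓢(Space d, ℂ)) :
    dist (f.toLp 2) = SchwartzMap.toTemperedDistributionCLM (Space d) ℂ volume f :=
  Lp.toTemperedDistribution_toLp_eq f

theorem coef_toLp (f : 𝓢(Space d, ℂ)) (m : Fin d → ℕ) :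
    coef (f.toLp 2) m = ∫ x, hermiteS m x * f x := by
  rw [coef_eq_dist, dist_toLp]
  exact SchwartzMap.toTemperedDistributionCLM_apply_apply volume f _

theorem coef_hermiteL2 (m n : Fin d → ℕ) : coef (hermiteL2 n) m = if m = n then 1 else 0 := by
  rw [← hermiteS_toLp, coef_toLp]
  split_ifs with h
  · rw [h, integral_hermiteS_self]
  · exact integral_hermiteS_ne h

theorem orthonormal_hermiteL2 : Orthonormal ℂ (hermiteL2 (d := d)) := by
  rw [orthonormal_iff_ite]
  intro m n
  exact coef_hermiteL2 m n

theorem dist_injective : Function.Injective (dist (d := d)) := by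
  have h := Lp.ker_toTemperedDistributionCLM_eq_bot (F := ℂ) (p := 2)
    (μ := (volume : Measure (Space d)))
  exact LinearMap.ker_eq_bot.1 h

theorem toL2_dist (u : L2 d) : toL2 (dist u) = u := by
  have h : InL2 (dist u) := ⟨u, rfl⟩
  rw [toL2, dif_pos h]
  exact dist_injective h.choose_spec

theorem dist_toL2 {X : 𝓢'(Space d, ℂ)} (h : InL2 X) : dist (toL2 X) = X := by
  rw [toL2, dif_pos h]
  exact h.choose_spec

theorem dist_smul (c : ℂ) (u : L2 d) : dist (c • u) = c • dist u :=
  map_smul (Lp.toTemperedDistributionCLM ℂ (volume : Measure (Space d)) 2) c u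

end GP

namespace GP

variable {d : ℕ}

/-! ### The powers of `A` on `Σ_K` -/

/-- The multi-indices of the Hermite functions which span `Σ_K`. -/
def box (d K : ℕ) : Finset (Fin d → ℕ) := Fintype.piFinset fun _ => Finset.range K

/-- The eigenvalue of `A` for the `m`-th Hermite function. -/
def lam (m : Fin d → ℕ) : ℝ := ∑ i, (2 * (m i : ℝ) + 1)

/-- `Λ_s = A^{s/2} P_K`. -/
noncomputable def Lam (K : ℕ) (s : ℤ) : L2 d →L[ℂ] L2 d :=
  ∑ m ∈ box d K, ((Real.sqrt (lam m) ^ s : ℝ) : ℂ) •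
    (innerSL ℂ (hermiteL2 m)).smulRight (hermiteL2 m)

/-- Here d ≥ 1 matters, as the sum would be empty for d = 0. The bound makes negative powers of A
legitimate and the norms nondecreasing in s. -/
theorem one_le_lam [NeZero d] (m : Fin d → ℕ) : 1 ≤ lam m := by
  have h : 2 * (m 0 : ℝ) + 1 ≤ lam m :=
    Finset.single_le_sum (f := fun i => 2 * (m i : ℝ) + 1) (fun i _ => by positivity)
      (Finset.mem_univ 0)
  have : (0 : ℝ) ≤ m 0 := Nat.cast_nonneg _
  linarith

theorem sqrt_lam_pos [NeZero d] (m : Fin d → ℕ) : 0 < Real.sqrt (lam m) :=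
  Real.sqrt_pos.2 (by linarith [one_le_lam m])

theorem mem_box {K : ℕ} {m : Fin d → ℕ} : m ∈ box d K ↔ ∀ i, m i < K := by
  simp [box]

theorem SigmaK_eq (K : ℕ) :
    SigmaK d K = Submodule.span ℂ (hermiteL2 '' (box d K : Set (Fin d → ℕ))) := by
  rw [SigmaK]
  congr 1
  ext u
  constructor
  · rintro ⟨m, rfl⟩
    exact ⟨fun i => m i, by simp [mem_box], rfl⟩
  · rintro ⟨m, hm, rfl⟩
    exact ⟨fun i => ⟨m i, mem_box.1 hm i⟩, rfl⟩

theorem hermiteL2_mem_SigmaK {K : ℕ} {m : Fin d → ℕ} (hm : m ∈ box d K) :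
    hermiteL2 m ∈ SigmaK d K := by
  rw [SigmaK_eq]
  exact Submodule.subset_span ⟨m, hm, rfl⟩

theorem coef_sub (u v : L2 d) (m : Fin d → ℕ) : coef (u - v) m = coef u m - coef v m :=
  inner_sub_right _ _ _

theorem coef_smul (c : ℂ) (u : L2 d) (m : Fin d → ℕ) : coef (c • u) m = c * coef u m :=
  inner_smul_right _ _ _

theorem coef_sum {ι : Type*} (s : Finset ι) (u : ι → L2 d) (m : Fin d → ℕ) :
    coef (∑ i ∈ s, u i) m = ∑ i ∈ s, coef (u i) m :=
  inner_sum _ _ _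

theorem Lam_apply (K : ℕ) (s : ℤ) (u : L2 d) :
    Lam K s u = ∑ m ∈ box d K, ((Real.sqrt (lam m) ^ s : ℝ) * coef u m : ℂ) • hermiteL2 m := by
  simp only [Lam, _root_.sum_apply, _root_.smul_apply,
    ContinuousLinearMap.smulRight_apply, innerSL_apply_apply, smul_smul, coef]

theorem coef_sum_smul (s : Finset (Fin d → ℕ)) (c : (Fin d → ℕ) → ℂ) (m : Fin d → ℕ) :
    coef (∑ n ∈ s, c n • hermiteL2 n) m = if m ∈ s then c m else 0 := by
  rw [coef_sum]
  simp [coef_smul, coef_hermiteL2]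

theorem coef_Lam (K : ℕ) (s : ℤ) (u : L2 d) (m : Fin d → ℕ) :
    coef (Lam K s u) m =
      if m ∈ box d K then ((Real.sqrt (lam m) ^ s : ℝ) : ℂ) * coef u m else 0 := by
  rw [Lam_apply, coef_sum_smul]

theorem Lam_mem (K : ℕ) (s : ℤ) (u : L2 d) : Lam K s u ∈ SigmaK d K := by
  rw [Lam_apply]
  exact Submodule.sum_mem _ fun m hm => Submodule.smul_mem _ _ (hermiteL2_mem_SigmaK hm)

theorem Lam_zero_of_mem {K : ℕ} {u : L2 d} (hu : u ∈ SigmaK d K) : Lam K 0 u = u := by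
  rw [SigmaK_eq] at hu
  induction hu using Submodule.span_induction with
  | mem x hx =>
    obtain ⟨m, hm, rfl⟩ := hx
    rw [Lam_apply]
    simp only [zpow_zero, Complex.ofReal_one, one_mul, coef_hermiteL2, ite_smul, one_smul,
      zero_smul, Finset.sum_ite_eq', if_pos (Finset.mem_coe.1 hm)]
  | zero => simp
  | add x y _ _ hx hy => rw [map_add, hx, hy]
  | smul c x _ hx => rw [map_smul, hx]

theorem eq_sum_of_mem {K : ℕ} {u : L2 d} (hu : u ∈ SigmaK d K) :
    u = ∑ m ∈ box d K, coef u m • hermiteL2 m := by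
  conv_lhs => rw [← Lam_zero_of_mem hu, Lam_apply]
  simp

theorem coef_eq_zero_of_mem {K : ℕ} {u : L2 d} (hu : u ∈ SigmaK d K) {m : Fin d → ℕ}
    (hm : m ∉ box d K) : coef u m = 0 := by
  rw [← Lam_zero_of_mem hu, coef_Lam, if_neg hm]

theorem Lam_eq_of_coef {K : ℕ} {s : ℤ} {u v : L2 d} (h : ∀ m ∈ box d K, coef u m = coef v m) :
    Lam K s u = Lam K s v := by
  rw [Lam_apply, Lam_apply]
  exact Finset.sum_congr rfl fun m hm => by rw [h m hm]

theorem Lam_mul [NeZero d] (K : ℕ) (s t : ℤ) :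
    (Lam K s : L2 d →L[ℂ] L2 d) * Lam K t = Lam K (s + t) := by
  ext1 u
  change Lam K s (Lam K t u) = _
  rw [Lam_apply, Lam_apply K (s + t)]
  refine Finset.sum_congr rfl fun m hm => ?_
  rw [coef_Lam, if_pos hm, ← mul_assoc, ← Complex.ofReal_mul, ← zpow_add₀ (sqrt_lam_pos m).ne']

theorem Lam_Lam [NeZero d] (K : ℕ) (s t : ℤ) (u : L2 d) :
    Lam K s (Lam K t u) = Lam K (s + t) u := by
  rw [← Lam_mul]; rfl

theorem Lam_inner (K : ℕ) (s : ℤ) (u v : L2 d) :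
    inner ℂ u (Lam K s v) = ∑ m ∈ box d K,
      ((Real.sqrt (lam m) ^ s : ℝ) : ℂ) * ((starRingEnd ℂ) (coef u m) * coef v m) := by
  rw [Lam_apply, inner_sum]
  refine Finset.sum_congr rfl fun m _ => ?_
  rw [inner_smul_right, coef, coef, inner_conj_symm]
  ring

theorem isSelfAdjoint_Lam (K : ℕ) (s : ℤ) : IsSelfAdjoint (Lam K s : L2 d →L[ℂ] L2 d) := by
  rw [ContinuousLinearMap.isSelfAdjoint_iff_isSymmetric]
  intro u v
  change inner ℂ (Lam K s u) v = inner ℂ u (Lam K s v)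
  rw [← inner_conj_symm, Lam_inner, Lam_inner, map_sum]
  refine Finset.sum_congr rfl fun m _ => ?_
  simp only [map_mul, Complex.conj_ofReal, Complex.conj_conj]
  ring

theorem Lam_symm (K : ℕ) (s : ℤ) (u v : L2 d) :
    inner ℂ (Lam K s u) v = inner ℂ u (Lam K s v) :=
  (ContinuousLinearMap.isSelfAdjoint_iff_isSymmetric.1 (isSelfAdjoint_Lam K s)) u v

theorem norm_sq_Lam [NeZero d] (K : ℕ) (s : ℤ) (u : L2 d) :
    ‖Lam K s u‖ ^ 2 = ∑ m ∈ box d K, lam m ^ s * ‖coef u m‖ ^ 2 := by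
  have h : inner ℂ (Lam K s u) (Lam K s u) = ((‖Lam K s u‖ ^ 2 : ℝ) : ℂ) := by
    rw [inner_self_eq_norm_sq_to_K]; simp
  rw [Lam_symm, Lam_Lam, Lam_inner] at h
  have h2 : ∀ m ∈ box d K, ((Real.sqrt (lam m) ^ (s + s) : ℝ) : ℂ) *
      ((starRingEnd ℂ) (coef u m) * coef u m) = ((lam m ^ s * ‖coef u m‖ ^ 2 : ℝ) : ℂ) := by
    intro m _
    rw [mul_comm ((starRingEnd ℂ) _), Complex.mul_conj, Complex.normSq_eq_norm_sq,
      ← Complex.ofReal_mul, zpow_add₀ (sqrt_lam_pos m).ne', ← mul_zpow,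
      Real.mul_self_sqrt (by linarith [one_le_lam m])]
  rw [Finset.sum_congr rfl h2, ← Complex.ofReal_sum] at h
  exact (Complex.ofReal_injective h).symm

theorem projK_eq (K : ℕ) : (projK K : L2 d →L[ℂ] L2 d) = Lam K 0 := by
  ext1 u
  rw [projK]
  refine Submodule.eq_starProjection_of_mem_of_inner_eq_zero (Lam_mem K 0 u) fun w hw => ?_
  rw [← Lam_zero_of_mem hw, ← Lam_symm, map_sub]
  rw [Lam_zero_of_mem (Lam_mem K 0 u), sub_self, inner_zero_left]

theorem coef_projK (K : ℕ) (u : L2 d) {m : Fin d → ℕ} (hm : m ∈ box d K) :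
    coef (projK K u) m = coef u m := by
  rw [projK_eq, coef_Lam, if_pos hm]; simp

theorem Lam_projK (K : ℕ) (s : ℤ) (u : L2 d) : Lam K s (projK K u) = Lam K s u :=
  Lam_eq_of_coef fun _ hm => coef_projK K u hm

theorem projK_mem (K : ℕ) (u : L2 d) : projK K u ∈ SigmaK d K := by
  rw [projK_eq]; exact Lam_mem K 0 u

theorem SigmaK_mono {K K' : ℕ} (h : K ≤ K') : SigmaK d K ≤ SigmaK d K' := by
  rw [SigmaK_eq, SigmaK_eq]
  refine Submodule.span_mono (image_mono fun m hm => ?_)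
  exact mem_box.2 fun i => (mem_box.1 hm i).trans_le h

/-! ### The harmonic oscillator on Hermite functions -/

theorem smulLeftCLM_toTemperedDistribution {g : Space d → ℂ} (hg : g.HasTemperateGrowth)
    (f : 𝓢(Space d, ℂ)) :
    TemperedDistribution.smulLeftCLM ℂ g
      (SchwartzMap.toTemperedDistributionCLM (Space d) ℂ volume f) =
    SchwartzMap.toTemperedDistributionCLM (Space d) ℂ volume (SchwartzMap.smulLeftCLM ℂ g f) := by
  ext h
  rw [TemperedDistribution.smulLeftCLM_apply_apply]
  refine (SchwartzMap.toTemperedDistributionCLM_apply_apply volume f _).trans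
    (Eq.trans ?_ (SchwartzMap.toTemperedDistributionCLM_apply_apply volume _ _).symm)
  refine integral_congr_ae (Filter.Eventually.of_forall fun x => ?_)
  simp only [SchwartzMap.smulLeftCLM_apply_apply hg, smul_eq_mul]
  ring

theorem two_smul_mulX_sub_derX (i : Fin d) (f : 𝓢(Space d, ℂ)) :
    (2 : ℂ) • (mulX i (mulX i f) - derX i (derX i f)) =
      raiseX i (lowerX i f) + lowerX i (raiseX i f) := by
  simp only [raiseX, lowerX, _root_.sub_apply, _root_.add_apply, map_add, map_sub]
  module

theorem mulX_sub_derX_hermiteS (i : Fin d) (m : Fin d → ℕ) :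
    mulX i (mulX i (hermiteS m)) - derX i (derX i (hermiteS m)) =
      ((2 * (m i : ℝ) + 1 : ℝ) : ℂ) • hermiteS m := by
  have h := two_smul_mulX_sub_derX i (hermiteS m)
  rw [raiseX_lowerX_hermiteS, lowerX_raiseX_hermiteS, ← add_smul] at h
  have h2 : ((2 * (m i : ℝ) : ℝ) : ℂ) + ((2 * ((m i : ℝ) + 1) : ℝ) : ℂ) =
      2 * ((2 * (m i : ℝ) + 1 : ℝ) : ℂ) := by push_cast; ring
  rw [h2, mul_smul] at h
  exact smul_right_injective _ (two_ne_zero (α := ℂ)) h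

theorem smulLeftCLM_norm_sq (f : 𝓢(Space d, ℂ)) :
    SchwartzMap.smulLeftCLM ℂ (fun x : Space d => ((‖x‖ ^ 2 : ℝ) : ℂ)) f =
      ∑ i, mulX i (mulX i f) := by
  ext x
  rw [SchwartzMap.smulLeftCLM_apply_apply
    (hasTemperateGrowth_ofReal_comp (Function.hasTemperateGrowth_norm_sq _)), _root_.sum_apply]
  simp only [mulX_apply, EuclideanSpace.norm_sq_eq, Real.norm_eq_abs, sq_abs, smul_eq_mul]
  push_cast
  rw [Finset.sum_mul]
  exact Finset.sum_congr rfl fun i _ => by ring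

theorem laplacian_eq_sum_derX (f : 𝓢(Space d, ℂ)) : Δ f = ∑ i, derX i (derX i f) := by
  rw [SchwartzMap.laplacian_eq_sum (EuclideanSpace.basisFun (Fin d) ℝ)]
  simp [derX_eq]

/-- On Schwartz functions the distributional operator acts classically. In each coordinate x_i² -
∂_i² is half of raise ∘ lower + lower ∘ raise, whose eigenvalues are known. -/
theorem harmonic_dist_hermiteL2 (m : Fin d → ℕ) :
    harmonic (dist (hermiteL2 m)) = (lam m : ℂ) • dist (hermiteL2 m) := by
  rw [← hermiteS_toLp, dist_toLp, harmonic, TemperedDistribution.laplacian_toTemperedDistributionCLM_eq,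
    smulLeftCLM_toTemperedDistribution
      (hasTemperateGrowth_ofReal_comp (Function.hasTemperateGrowth_norm_sq _)),
    smulLeftCLM_norm_sq, laplacian_eq_sum_derX, ← map_neg, ← map_add, ← map_smul]
  congr 1
  rw [neg_add_eq_sub, ← Finset.sum_sub_distrib]
  simp only [mulX_sub_derX_hermiteS, lam]
  rw [← Finset.sum_smul]
  push_cast
  rfl

/-- `A` as a linear map on distributions. -/
noncomputable def harmonicLM : 𝓢'(Space d, ℂ) →ₗ[ℂ] 𝓢'(Space d, ℂ) where
  toFun := harmonic
  map_add' X Y := by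
    simp only [harmonic, ← TemperedDistribution.laplacianCLM_apply, map_add]
    abel
  map_smul' c X := by
    simp only [harmonic, ← TemperedDistribution.laplacianCLM_apply, map_smul, RingHom.id_apply]
    module

theorem harmonic_iterate (k : ℕ) (X : 𝓢'(Space d, ℂ)) :
    harmonic^[k] X = (harmonicLM ^ k) X := by
  rw [Module.End.pow_apply]; rfl

theorem dist_sum {ι : Type*} (s : Finset ι) (u : ι → L2 d) :
    dist (∑ i ∈ s, u i) = ∑ i ∈ s, dist (u i) :=
  map_sum (Lp.toTemperedDistributionCLM ℂ (volume : Measure (Space d)) 2) u s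

/-- This links `opA`, which picks an L² representative of a distribution, with the spectral
calculus. Afterwards Assumption 1 is only used through `Lam`. -/
theorem opA_of_mem [NeZero d] {K : ℕ} {u : L2 d} (hu : u ∈ SigmaK d K) (k : ℕ) :
    opA k u = Lam K (2 * k) u := by
  rw [opA, harmonic_iterate]
  suffices h : (harmonicLM ^ k) (dist u) = dist (Lam K (2 * k) u) by rw [h, toL2_dist]
  conv_lhs => rw [eq_sum_of_mem hu]
  rw [Lam_apply, dist_sum, dist_sum, map_sum]
  refine Finset.sum_congr rfl fun m _ => ?_
  rw [dist_smul, dist_smul, map_smul]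
  have h : ∀ k : ℕ, (harmonicLM ^ k) (dist (hermiteL2 m)) = ((lam m : ℂ) ^ k) • dist (hermiteL2 m) := by
    intro k
    induction k with
    | zero => simp
    | succ k ih =>
      rw [pow_succ', Module.End.mul_apply, ih, map_smul]
      change _ • harmonic _ = _
      rw [harmonic_dist_hermiteL2, smul_smul, pow_succ]
  rw [h, smul_smul]
  congr 1
  rw [zpow_mul, zpow_ofNat, Real.sq_sqrt (by linarith [one_le_lam m]), zpow_natCast]
  push_cast
  ring

theorem energy_of_mem [NeZero d] {K : ℕ} {u : L2 d} (hu : u ∈ SigmaK d K) (j : ℕ) :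
    energy j u = ‖Lam K j u‖ ^ 2 := by
  rw [energy, opA_of_mem hu, two_mul, ← Lam_Lam, Lam_symm, inner_self_eq_norm_sq_to_K]
  norm_cast

end GP

namespace GP

variable {d : ℕ}

/-! ### Weighted derivatives of Hermite expansions -/

/-- The class of a Schwartz function in `L²`. -/
noncomputable def toL : 𝓢(Space d, ℂ) →L[ℂ] L2 d :=
  SchwartzMap.toLpCLM ℂ ℂ 2 (volume : Measure (Space d))

theorem coef_toL (f : 𝓢(Space d, ℂ)) (m : Fin d → ℕ) :
    coef (toL f) m = ∫ x, hermiteS m x * f x := coef_toLp f m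

theorem toL_hermiteS (m : Fin d → ℕ) : toL (hermiteS m) = hermiteL2 m := hermiteS_toLp m

/-- `∑ λ_m^s |⟨e_m, f⟩|²` for a Schwartz function `f`. -/
noncomputable def coefSum (s : ℕ) (f : 𝓢(Space d, ℂ)) : ℝ≥0∞ :=
  ∑' m : Fin d → ℕ, ENNReal.ofReal (lam m ^ s * ‖coef (toL f) m‖ ^ 2)

/-- The operator `T` loses at most `r` powers of `A^{1/2}`. -/
def OrderLE (r : ℕ) (T : 𝓢(Space d, ℂ) → 𝓢(Space d, ℂ)) : Prop :=
  ∀ s : ℕ, ∃ C : ℝ≥0, ∀ f, coefSum s (T f) ≤ C * coefSum (s + r) f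

theorem OrderLE.comp {r r' : ℕ} {T T' : 𝓢(Space d, ℂ) → 𝓢(Space d, ℂ)} (h : OrderLE r T)
    (h' : OrderLE r' T') : OrderLE (r + r') (T ∘ T') := by
  intro s
  obtain ⟨C, hC⟩ := h s
  obtain ⟨C', hC'⟩ := h' (s + r)
  refine ⟨C * C', fun f => (hC _).trans ?_⟩
  calc (C : ℝ≥0∞) * coefSum (s + r) (T' f) ≤ C * (C' * coefSum (s + r + r') f) := by
        gcongr; exact hC' f
    _ = _ := by push_cast; rw [mul_assoc, add_assoc]

theorem orderLE_id : OrderLE 0 (id : 𝓢(Space d, ℂ) → 𝓢(Space d, ℂ)) :=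
  fun s => ⟨1, fun f => by simp⟩

theorem OrderLE.iterate {T : 𝓢(Space d, ℂ) → 𝓢(Space d, ℂ)} (h : OrderLE 1 T) (n : ℕ) :
    OrderLE n T^[n] := by
  induction n with
  | zero => exact orderLE_id
  | succ n ih => rw [Function.iterate_succ]; exact ih.comp h

theorem OrderLE.foldr {T : Fin d → 𝓢(Space d, ℂ) → 𝓢(Space d, ℂ)} (h : ∀ i, OrderLE 1 (T i))
    (α : Fin d → ℕ) (l : List (Fin d)) :
    OrderLE (l.map α).sum (fun f => l.foldr (fun i g => (T i)^[α i] g) f) := by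
  induction l with
  | nil => exact orderLE_id
  | cons i l ih =>
    rw [List.map_cons, List.sum_cons]
    exact ((h i).iterate (α i)).comp ih

theorem coef_mulX (i : Fin d) (f : 𝓢(Space d, ℂ)) (m : Fin d → ℕ) :
    coef (toL (mulX i f)) m = ((Real.sqrt 2)⁻¹ : ℂ) *
      ((Real.sqrt (m i + 1) : ℂ) * coef (toL f) (up m i) +
        (Real.sqrt (m i) : ℂ) * coef (toL f) (down m i)) := by
  simp only [coef_toL]
  rw [← integral_mulX_mul, mulX_hermiteS]
  simp only [_root_.smul_apply, _root_.add_apply, smul_eq_mul, mul_assoc, add_mul]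
  rw [integral_const_mul, integral_add ((integrable_mul _ _).const_mul _)
    ((integrable_mul _ _).const_mul _), integral_const_mul, integral_const_mul]

theorem coef_derX (i : Fin d) (f : 𝓢(Space d, ℂ)) (m : Fin d → ℕ) :
    coef (toL (derX i f)) m = ((Real.sqrt 2)⁻¹ : ℂ) *
      ((Real.sqrt (m i + 1) : ℂ) * coef (toL f) (up m i) -
        (Real.sqrt (m i) : ℂ) * coef (toL f) (down m i)) := by
  simp only [coef_toL]
  rw [← neg_neg (∫ x, hermiteS m x * derX i f x), ← integral_derX_mul, derX_hermiteS]
  simp only [_root_.smul_apply, _root_.sub_apply, smul_eq_mul, mul_assoc, sub_mul]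
  rw [integral_const_mul, integral_sub ((integrable_mul _ _).const_mul _)
    ((integrable_mul _ _).const_mul _), integral_const_mul, integral_const_mul]
  ring

/-- The unimodular ε treats both signs at once: +1 for multiplication by x_i and -1 for ∂_i. -/
theorem norm_sq_ladder_le (m : ℕ) (a b : ℂ) (ε : ℂ) (hε : ‖ε‖ = 1) :
    ‖((Real.sqrt 2)⁻¹ : ℂ) * ((Real.sqrt (m + 1) : ℂ) * a + ε * ((Real.sqrt m : ℂ) * b))‖ ^ 2 ≤
      (m + 1) * ‖a‖ ^ 2 + m * ‖b‖ ^ 2 := by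
  have h1 : ‖((Real.sqrt (m + 1) : ℂ) * a + ε * ((Real.sqrt m : ℂ) * b))‖ ≤
      Real.sqrt (m + 1) * ‖a‖ + Real.sqrt m * ‖b‖ := by
    refine (norm_add_le _ _).trans_eq ?_
    rw [norm_mul, norm_mul, norm_mul, hε, one_mul, Complex.norm_real, Complex.norm_real,
      Real.norm_of_nonneg (Real.sqrt_nonneg _), Real.norm_of_nonneg (Real.sqrt_nonneg _)]
  have h2 : ‖((Real.sqrt 2)⁻¹ : ℂ)‖ ^ 2 = 1 / 2 := by
    rw [norm_inv, Complex.norm_real, Real.norm_of_nonneg (Real.sqrt_nonneg _), inv_pow,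
      Real.sq_sqrt (by norm_num)]
    norm_num
  have h3 := Real.sq_sqrt (show (0 : ℝ) ≤ m + 1 by positivity)
  have h4 := Real.sq_sqrt (show (0 : ℝ) ≤ m by positivity)
  rw [norm_mul, mul_pow, h2]
  have h5 := pow_le_pow_left₀ (norm_nonneg _) h1 2
  have h6 := sq_nonneg (Real.sqrt (m + 1) * ‖a‖ - Real.sqrt m * ‖b‖)
  have h7 : (Real.sqrt (m + 1) * ‖a‖) ^ 2 = (m + 1) * ‖a‖ ^ 2 := by rw [mul_pow, h3]
  have h8 : (Real.sqrt m * ‖b‖) ^ 2 = m * ‖b‖ ^ 2 := by rw [mul_pow, h4]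
  nlinarith

theorem up_injective (i : Fin d) : Function.Injective (fun m : Fin d → ℕ => up m i) :=
  Function.LeftInverse.injective (g := fun m => down m i) fun m => down_up m i

theorem lam_up (m : Fin d → ℕ) (i : Fin d) : lam (up m i) = lam m + 2 := by
  have h1 := Finset.add_sum_erase Finset.univ (fun k => 2 * (m k : ℝ) + 1) (Finset.mem_univ i)
  have h2 := Finset.add_sum_erase Finset.univ (fun k => 2 * (up m i k : ℝ) + 1) (Finset.mem_univ i)
  have h3 : ∑ k ∈ Finset.univ.erase i, (2 * (up m i k : ℝ) + 1) =
      ∑ k ∈ Finset.univ.erase i, (2 * (m k : ℝ) + 1) :=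
    Finset.sum_congr rfl fun k hk => by simp [up, Finset.ne_of_mem_erase hk]
  have h4 : ((up m i i : ℕ) : ℝ) = m i + 1 := by simp [up]
  simp only [lam] at *
  rw [h3, h4] at h2
  linarith

theorem le_lam (m : Fin d → ℕ) (i : Fin d) : 2 * (m i : ℝ) + 1 ≤ lam m :=
  Finset.single_le_sum (f := fun i => 2 * (m i : ℝ) + 1) (fun i _ => by positivity)
    (Finset.mem_univ i)

/-- Each coefficient of T f only involves its two neighbours in the direction i, with weights at
most λ. The shifts of the index are injective, so the weighted sums can be reindexed. -/
theorem orderLE_of_ladder [NeZero d] (i : Fin d) {T : 𝓢(Space d, ℂ) → 𝓢(Space d, ℂ)}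
    (hT : ∀ f m, ‖coef (toL (T f)) m‖ ^ 2 ≤
      (m i + 1) * ‖coef (toL f) (up m i)‖ ^ 2 + m i * ‖coef (toL f) (down m i)‖ ^ 2) :
    OrderLE 1 T := by
  intro s
  -- The upper neighbour costs 1 because λ increases. The lower one costs 3^s because λ_m = λ_{down
  -- m} + 2 ≤ 3 λ_{down m}.
  refine ⟨1 + 3 ^ s, fun f => ?_⟩
  set c : (Fin d → ℕ) → ℝ := fun m => ‖coef (toL f) m‖ ^ 2 with hc
  have hc0 : ∀ m, 0 ≤ c m := fun m => by positivity
  set G : (Fin d → ℕ) → ℝ≥0∞ := fun m => ENNReal.ofReal (lam m ^ (s + 1) * c m) with hG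
  have hl : ∀ m : Fin d → ℕ, 0 ≤ lam m := fun m => by linarith [one_le_lam m]
  have h1 : ∀ m, ENNReal.ofReal (lam m ^ s * ‖coef (toL (T f)) m‖ ^ 2) ≤
      G (up m i) + 3 ^ s * (if m i ≠ 0 then G (down m i) else 0) := by
    intro m
    have hA : lam m ^ s * ((m i + 1) * c (up m i)) ≤ lam (up m i) ^ (s + 1) * c (up m i) := by
      rw [← mul_assoc, pow_succ]
      have := le_lam m i
      gcongr
      · exact pow_nonneg (hl _) _
      · exact hl _
      · rw [lam_up]; linarith
      · rw [lam_up]; linarith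
    have hB : ENNReal.ofReal (lam m ^ s * (m i * c (down m i))) ≤
        3 ^ s * (if m i ≠ 0 then G (down m i) else 0) := by
      rcases eq_or_ne (m i) 0 with h | h
      · simp [h]
      · rw [if_pos h, hG]
        have h3 : (3 : ℝ≥0∞) ^ s = ENNReal.ofReal (3 ^ s) := by
          rw [ENNReal.ofReal_pow (by norm_num)]; norm_num
        rw [h3, ← ENNReal.ofReal_mul (by positivity)]
        refine ENNReal.ofReal_le_ofReal ?_
        have e1 := lam_up (down m i) i
        rw [up_down m i h] at e1
        have e2 := le_lam (down m i) i
        have e3 : ((down m i i : ℕ) : ℝ) + 1 = m i := by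
          have : down m i i + 1 = m i := by simp [down]; omega
          exact_mod_cast this
        have e4 : (1 : ℝ) ≤ m i := by exact_mod_cast Nat.one_le_iff_ne_zero.2 h
        have e5 := one_le_lam (down m i)
        have e6 : lam m ^ s ≤ (3 * lam (down m i)) ^ s := by
          gcongr
          · exact hl _
          · linarith
        have e7 := hl (down m i)
        calc lam m ^ s * (m i * c (down m i))
            ≤ (3 * lam (down m i)) ^ s * (lam (down m i) * c (down m i)) := by
              gcongr
              linarith
          _ = _ := by rw [mul_pow, pow_succ]; ring
    calc _ ≤ ENNReal.ofReal (lam m ^ s * ((m i + 1) * c (up m i)) +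
          lam m ^ s * (m i * c (down m i))) := by
          refine ENNReal.ofReal_le_ofReal ?_
          rw [← mul_add]
          exact mul_le_mul_of_nonneg_left (hT f m) (pow_nonneg (hl m) s)
      _ ≤ _ := ENNReal.ofReal_add_le.trans (add_le_add (ENNReal.ofReal_le_ofReal hA) hB)
  have h2 : ∑' m : Fin d → ℕ, (if m i ≠ 0 then G (down m i) else 0) = ∑' m, G m := by
    have := (up_injective i).tsum_eq (f := fun m => if m i ≠ 0 then G (down m i) else 0) (by
      intro m hm
      have : m i ≠ 0 := by
        rintro h
        simp [h] at hm
      exact ⟨down m i, up_down m i this⟩)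
    rw [← this]
    refine tsum_congr fun m => ?_
    rw [if_pos (by simp [up]), down_up]
  calc coefSum s (T f) ≤ ∑' m, (G (up m i) + 3 ^ s * (if m i ≠ 0 then G (down m i) else 0)) :=
        ENNReal.tsum_le_tsum h1
    _ = ∑' m, G (up m i) + 3 ^ s * ∑' m, G m := by
        rw [ENNReal.tsum_add, ENNReal.tsum_mul_left, h2]
    _ ≤ ∑' m, G m + 3 ^ s * ∑' m, G m := by
        exact add_le_add_left (ENNReal.tsum_comp_le_tsum_of_injective (up_injective i) G) _
    _ = _ := by push_cast; rw [add_mul, one_mul]; rfl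

theorem orderLE_mulX [NeZero d] (i : Fin d) : OrderLE 1 (mulX (d := d) i) := by
  refine orderLE_of_ladder i fun f m => ?_
  rw [coef_mulX]
  simpa using norm_sq_ladder_le (m i) (coef (toL f) (up m i)) (coef (toL f) (down m i)) 1
    (by simp)

theorem orderLE_derX [NeZero d] (i : Fin d) : OrderLE 1 (derX (d := d) i) := by
  refine orderLE_of_ladder i fun f m => ?_
  rw [coef_derX]
  simpa [sub_eq_add_neg] using
    norm_sq_ladder_le (m i) (coef (toL f) (up m i)) (coef (toL f) (down m i)) (-1) (by simp)

/-- The span of all the Hermite functions. -/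
noncomputable def hermiteSpan (d : ℕ) : Submodule ℂ 𝓢(Space d, ℂ) :=
  Submodule.span ℂ (range hermiteS)

theorem hermiteS_mem (m : Fin d → ℕ) : hermiteS m ∈ hermiteSpan d :=
  Submodule.subset_span ⟨m, rfl⟩

theorem hermiteSpan_map_mem (T : 𝓢(Space d, ℂ) →L[ℂ] 𝓢(Space d, ℂ))
    (hT : ∀ m, T (hermiteS m) ∈ hermiteSpan d) {f : 𝓢(Space d, ℂ)} (hf : f ∈ hermiteSpan d) :
    T f ∈ hermiteSpan d := by
  induction hf using Submodule.span_induction with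
  | mem x hx => obtain ⟨m, rfl⟩ := hx; exact hT m
  | zero => rw [map_zero]; exact Submodule.zero_mem _
  | add x y _ _ hx hy => rw [map_add]; exact Submodule.add_mem _ hx hy
  | smul c x _ hx => rw [map_smul]; exact Submodule.smul_mem _ _ hx

theorem mulX_mem (i : Fin d) {f : 𝓢(Space d, ℂ)} (hf : f ∈ hermiteSpan d) :
    mulX i f ∈ hermiteSpan d := by
  refine hermiteSpan_map_mem _ (fun m => ?_) hf
  rw [mulX_hermiteS]
  exact Submodule.smul_mem _ _ (Submodule.add_mem _ (Submodule.smul_mem _ _ (hermiteS_mem _))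
    (Submodule.smul_mem _ _ (hermiteS_mem _)))

theorem derX_mem (i : Fin d) {f : 𝓢(Space d, ℂ)} (hf : f ∈ hermiteSpan d) :
    derX i f ∈ hermiteSpan d := by
  refine hermiteSpan_map_mem _ (fun m => ?_) hf
  rw [derX_hermiteS]
  exact Submodule.smul_mem _ _ (Submodule.sub_mem _ (Submodule.smul_mem _ _ (hermiteS_mem _))
    (Submodule.smul_mem _ _ (hermiteS_mem _)))

theorem exists_mem_SigmaK {f : 𝓢(Space d, ℂ)} (hf : f ∈ hermiteSpan d) :
    ∃ K, toL f ∈ SigmaK d K := by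
  induction hf using Submodule.span_induction with
  | mem x hx =>
    obtain ⟨m, rfl⟩ := hx
    refine ⟨∑ i, m i + 1, ?_⟩
    rw [toL_hermiteS]
    refine hermiteL2_mem_SigmaK (mem_box.2 fun i => ?_)
    have := Finset.single_le_sum (f := m) (fun i _ => Nat.zero_le _) (Finset.mem_univ i)
    omega
  | zero =>
    refine ⟨0, ?_⟩
    rw [map_zero]
    exact Submodule.zero_mem _
  | add x y _ _ hx hy =>
    obtain ⟨K, hK⟩ := hx
    obtain ⟨K', hK'⟩ := hy
    refine ⟨max K K', ?_⟩
    rw [map_add]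
    exact Submodule.add_mem _ (SigmaK_mono (le_max_left _ _) hK)
      (SigmaK_mono (le_max_right _ _) hK')
  | smul c x _ hx =>
    obtain ⟨K, hK⟩ := hx
    refine ⟨K, ?_⟩
    rw [map_smul]
    exact Submodule.smul_mem _ _ hK

/-- The Schwartz function which represents `u ∈ Σ_K`. -/
noncomputable def schw (K : ℕ) (u : L2 d) : 𝓢(Space d, ℂ) := ∑ m ∈ box d K, coef u m • hermiteS m

theorem schw_mem (K : ℕ) (u : L2 d) : schw K u ∈ hermiteSpan d :=
  Submodule.sum_mem _ fun m _ => Submodule.smul_mem _ _ (hermiteS_mem m)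

theorem toL_schw {K : ℕ} {u : L2 d} (hu : u ∈ SigmaK d K) : toL (schw K u) = u := by
  conv_rhs => rw [eq_sum_of_mem hu]
  rw [schw, map_sum]
  exact Finset.sum_congr rfl fun m _ => by rw [map_smul, toL_hermiteS]

theorem coefSum_eq [NeZero d] {K : ℕ} {f : 𝓢(Space d, ℂ)} (hf : toL f ∈ SigmaK d K)
    (s : ℕ) : coefSum s f = ENNReal.ofReal (‖Lam K s (toL f)‖ ^ 2) := by
  rw [coefSum, tsum_eq_sum (s := box d K), norm_sq_Lam, ENNReal.ofReal_sum_of_nonneg]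
  · simp only [zpow_natCast]
  · intro m _
    have := one_le_lam m
    positivity
  · intro m hm
    simp [coef_eq_zero_of_mem hf hm]

/-- For finite Hermite expansions Parseval's identity is elementary. Together with Bessel's
inequality it is all that is used; completeness of the Hermite system plays no role. -/
theorem coefSum_zero [NeZero d] {f : 𝓢(Space d, ℂ)} (hf : f ∈ hermiteSpan d) :
    coefSum 0 f = ENNReal.ofReal (‖toL f‖ ^ 2) := by
  obtain ⟨K, hK⟩ := exists_mem_SigmaK hf
  rw [coefSum_eq hK]
  simp [Lam_zero_of_mem hK]

theorem coefSum_mono [NeZero d] {s t : ℕ} (h : s ≤ t) (f : 𝓢(Space d, ℂ)) :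
    coefSum s f ≤ coefSum t f := by
  refine ENNReal.tsum_le_tsum fun m => ENNReal.ofReal_le_ofReal ?_
  gcongr
  exact one_le_lam m

/-- An operator of order `r` which preserves Hermite expansions is bounded from `Σ^{s+r}`
to `L²`. -/
theorem OrderLE.exists_norm_le [NeZero d] {r : ℕ} {T : 𝓢(Space d, ℂ) → 𝓢(Space d, ℂ)}
    (hT : OrderLE r T) (hmem : ∀ f ∈ hermiteSpan d, T f ∈ hermiteSpan d) :
    ∃ C : ℝ, 0 < C ∧ ∀ (K : ℕ) (f : 𝓢(Space d, ℂ)), f ∈ hermiteSpan d →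
      toL f ∈ SigmaK d K → ∀ s : ℕ, r ≤ s →
      ‖toL (T f)‖ ≤ C * ‖Lam K s (toL f)‖ := by
  obtain ⟨C, hC⟩ := hT 0
  refine ⟨Real.sqrt C + 1, by positivity, fun K f hf hK s hs => ?_⟩
  have h1 := (hC f).trans (mul_le_mul_right (coefSum_mono (t := s) (by omega) f) _)
  rw [coefSum_zero (hmem f hf), coefSum_eq hK, ← ENNReal.ofReal_coe_nnreal,
    ← ENNReal.ofReal_mul (by positivity), ENNReal.ofReal_le_ofReal_iff (by positivity)] at h1
  refine le_of_sq_le_sq ?_ (by positivity) |>.trans (?_ : Real.sqrt C * ‖Lam K s (toL f)‖ ≤ _)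
  · rw [mul_pow, Real.sq_sqrt (by positivity)]; exact h1
  · gcongr; linarith

end GP

namespace GP

variable {d : ℕ}

/-! ### The norm of `Σ^j` on `Σ_K` -/

/-- `x^β ∂^α f` for a Schwartz function `f`. -/
noncomputable def weightedDerivS (α β : Fin d → ℕ) (f : 𝓢(Space d, ℂ)) : 𝓢(Space d, ℂ) :=
  (List.finRange d).foldr (fun i g => (mulX i)^[β i] g)
    ((List.finRange d).foldr (fun i g => (derX i)^[α i] g) f)

/-- A Schwartz function seen as a tempered distribution. -/
noncomputable def distS (f : 𝓢(Space d, ℂ)) : 𝓢'(Space d, ℂ) :=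
  SchwartzMap.toTemperedDistributionCLM (Space d) ℂ volume f

theorem dist_toL (f : 𝓢(Space d, ℂ)) : dist (toL f) = distS f := dist_toLp f

theorem foldr_derX_distS (α : Fin d → ℕ) (l : List (Fin d)) (f : 𝓢(Space d, ℂ)) :
    l.foldr (fun i X => (fun Y : 𝓢'(Space d, ℂ) => ∂_{EuclideanSpace.single i (1 : ℝ)} Y)^[α i] X)
      (distS f) = distS (l.foldr (fun i g => (derX i)^[α i] g) f) := by
  have hit : ∀ (i : Fin d) (n : ℕ) (g : 𝓢(Space d, ℂ)),
      (fun Y : 𝓢'(Space d, ℂ) => ∂_{EuclideanSpace.single i (1 : ℝ)} Y)^[n] (distS g) =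
        distS ((derX i)^[n] g) := by
    intro i n g
    induction n generalizing g with
    | zero => rfl
    | succ n ih =>
      rw [Function.iterate_succ_apply, Function.iterate_succ_apply, ← ih]
      congr 1
      exact TemperedDistribution.lineDerivOp_toTemperedDistributionCLM_eq g _
  induction l with
  | nil => rfl
  | cons i l ih => rw [List.foldr_cons, List.foldr_cons, ih, hit]

theorem iterate_mulX_apply (i : Fin d) (n : ℕ) (f : 𝓢(Space d, ℂ)) (x : Space d) :
    (mulX i)^[n] f x = (x i : ℂ) ^ n * f x := by
  induction n with
  | zero => simp
  | succ n ih => rw [Function.iterate_succ_apply', mulX_apply, ih, pow_succ]; ring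

theorem foldr_mulX_apply (β : Fin d → ℕ) (l : List (Fin d)) (f : 𝓢(Space d, ℂ)) (x : Space d) :
    l.foldr (fun i g => (mulX i)^[β i] g) f x = (l.map fun i => (x i : ℂ) ^ β i).prod * f x := by
  induction l with
  | nil => simp
  | cons i l ih =>
    rw [List.foldr_cons, iterate_mulX_apply, ih, List.map_cons, List.prod_cons, mul_assoc]

theorem hasTemperateGrowth_monomial (β : Fin d → ℕ) :
    Function.HasTemperateGrowth (fun x : Space d => ((∏ i, x i ^ β i : ℝ) : ℂ)) :=
  hasTemperateGrowth_ofReal_comp (hasTemperateGrowth_finset_prod _ fun i _ =>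
    (hasTemperateGrowth_coord i).pow _)

theorem weightedDeriv_toL (α β : Fin d → ℕ) (f : 𝓢(Space d, ℂ)) :
    weightedDeriv α β (toL f) = dist (toL (weightedDerivS α β f)) := by
  rw [weightedDeriv, dist_toL, foldr_derX_distS, dist_toL]
  refine (smulLeftCLM_toTemperedDistribution (hasTemperateGrowth_monomial β) _).trans ?_
  rw [distS]
  congr 1
  ext x
  rw [SchwartzMap.smulLeftCLM_apply_apply (hasTemperateGrowth_monomial β), weightedDerivS,
    foldr_mulX_apply, smul_eq_mul]
  congr 1
  push_cast
  rw [Fin.prod_univ_def]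

theorem foldr_mem (T : Fin d → 𝓢(Space d, ℂ) → 𝓢(Space d, ℂ))
    (hT : ∀ i, ∀ f ∈ hermiteSpan d, T i f ∈ hermiteSpan d) (α : Fin d → ℕ) (l : List (Fin d))
    {f : 𝓢(Space d, ℂ)} (hf : f ∈ hermiteSpan d) :
    l.foldr (fun i g => (T i)^[α i] g) f ∈ hermiteSpan d := by
  have hit : ∀ (i : Fin d) (n : ℕ), ∀ g ∈ hermiteSpan d, (T i)^[n] g ∈ hermiteSpan d := by
    intro i n
    induction n with
    | zero => exact fun g hg => hg
    | succ n ih =>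
      intro g hg
      rw [Function.iterate_succ_apply]
      exact ih _ (hT i g hg)
  induction l with
  | nil => exact hf
  | cons i l ih => exact hit i _ _ ih

theorem weightedDerivS_mem (α β : Fin d → ℕ) {f : 𝓢(Space d, ℂ)} (hf : f ∈ hermiteSpan d) :
    weightedDerivS α β f ∈ hermiteSpan d :=
  foldr_mem (fun i => mulX i) (fun i _ => mulX_mem i) _ _
    (foldr_mem (fun i => derX i) (fun i _ => derX_mem i) _ _ hf)

theorem orderLE_weightedDerivS [NeZero d] (α β : Fin d → ℕ) :
    OrderLE (∑ i, α i + ∑ i, β i) (weightedDerivS α β) := by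
  have h1 := OrderLE.foldr (T := fun i => mulX i) orderLE_mulX β (List.finRange d)
  have h2 := OrderLE.foldr (T := fun i => derX i) orderLE_derX α (List.finRange d)
  rw [← Fin.sum_univ_def] at h1 h2
  rw [add_comm]
  exact h1.comp h2

theorem mem_indexPairs {k : ℕ} {p : (Fin d → ℕ) × (Fin d → ℕ)} :
    p ∈ indexPairs d k ↔ ∑ i, p.1 i + ∑ i, p.2 i ≤ k := by
  simp only [indexPairs, Finset.mem_filter, Finset.mem_product, Fintype.mem_piFinset,
    Finset.mem_range, and_iff_right_iff_imp]
  intro h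
  constructor
  · intro i
    have := Finset.single_le_sum (f := p.1) (fun i _ => Nat.zero_le _) (Finset.mem_univ i)
    omega
  · intro i
    have := Finset.single_le_sum (f := p.2) (fun i _ => Nat.zero_le _) (Finset.mem_univ i)
    omega

theorem memSigma_toL (j : ℕ) (f : 𝓢(Space d, ℂ)) : MemSigma j (toL f) :=
  fun p _ => ⟨_, (weightedDeriv_toL p.1 p.2 f).symm⟩

theorem memSigma_of_mem {K : ℕ} {u : L2 d} (hu : u ∈ SigmaK d K) (j : ℕ) : MemSigma j u := by
  rw [← toL_schw hu]; exact memSigma_toL j _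

theorem sigmaNorm_toL (j : ℕ) (f : 𝓢(Space d, ℂ)) :
    sigmaNorm j (toL f) = Real.sqrt (∑ p ∈ indexPairs d j, ‖toL (weightedDerivS p.1 p.2 f)‖ ^ 2) := by
  simp only [sigmaNorm, weightedDeriv_toL, toL2_dist]

/-- On `Σ_K` the norm of `Σ^j` is controlled by the norm associated with `A^{j/2}`. -/
theorem exists_sigmaNorm_le [NeZero d] (j : ℕ) : ∃ C : ℝ, 0 < C ∧ ∀ (K : ℕ) (u : L2 d),
    u ∈ SigmaK d K → sigmaNorm j u ≤ C * ‖Lam K j u‖ := by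
  choose c hc0 hc using fun p : (Fin d → ℕ) × (Fin d → ℕ) =>
    (orderLE_weightedDerivS p.1 p.2).exists_norm_le fun f hf => weightedDerivS_mem p.1 p.2 hf
  refine ⟨Real.sqrt (∑ p ∈ indexPairs d j, c p ^ 2) + 1, by positivity, fun K u hu => ?_⟩
  have e := toL_schw hu
  rw [← e, sigmaNorm_toL]
  have hK : toL (schw K u) ∈ SigmaK d K := by rw [e]; exact hu
  calc _ ≤ Real.sqrt (∑ p ∈ indexPairs d j, (c p ^ 2 * ‖Lam K j (toL (schw K u))‖ ^ 2)) := by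
        refine Real.sqrt_le_sqrt (Finset.sum_le_sum fun p hp => ?_)
        rw [← mul_pow]
        exact pow_le_pow_left₀ (norm_nonneg _)
          (hc p K _ (schw_mem K u) hK j (mem_indexPairs.1 hp)) 2
    _ = Real.sqrt (∑ p ∈ indexPairs d j, c p ^ 2) * ‖Lam K j (toL (schw K u))‖ := by
        rw [← Finset.sum_mul, Real.sqrt_mul (by positivity), Real.sqrt_sq (norm_nonneg _)]
    _ ≤ _ := by gcongr; linarith

/-! ### Bounds on Hermite coefficients -/

/-- `-∂_i` as an endomorphism. -/
noncomputable def negD (i : Fin d) : Module.End ℂ 𝓢(Space d, ℂ) := -(derX i).toLinearMap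

/-- Multiplication by `x_i` as an endomorphism. -/
noncomputable def endX (i : Fin d) : Module.End ℂ 𝓢(Space d, ℂ) := (mulX i).toLinearMap

theorem derX_mulX (i : Fin d) (f : 𝓢(Space d, ℂ)) :
    derX i (mulX i f) = f + mulX i (derX i f) := by
  ext x
  rw [derX_apply]
  refine HasLineDerivAt.lineDeriv ?_
  have h1 := hasLineDerivAt i f x
  rw [HasLineDerivAt] at h1 ⊢
  have h2 : (fun t : ℝ => mulX i f (x + t • EuclideanSpace.single i (1 : ℝ))) = fun t : ℝ =>
      ((x i + t : ℝ) : ℂ) * f (x + t • EuclideanSpace.single i (1 : ℝ)) := by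
    funext t
    rw [mulX_apply]
    simp
  rw [h2]
  have h3 : HasDerivAt (fun t : ℝ => ((x i + t : ℝ) : ℂ)) 1 0 := by
    have : HasDerivAt (fun t : ℝ => x i + t) 1 0 := by simpa using (hasDerivAt_id (0:ℝ)).const_add (x i)
    simpa using this.ofReal_comp
  convert! h3.mul h1 using 1
  simp [mulX_apply]

theorem endX_mul_negD (i : Fin d) : endX i * negD i = negD i * endX i + 1 := by
  ext1 f
  change mulX i (-derX i f) = -derX i (mulX i f) + f
  rw [derX_mulX, map_neg]
  abel

/-- Normal ordering in the Weyl algebra. -/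
theorem add_pow_mem_span {R : Type*} [Ring R] [Algebra ℂ R] {X N : R} (h : X * N = N * X + 1)
    (j : ℕ) :
    (X + N) ^ j ∈ Submodule.span ℂ {T : R | ∃ a b : ℕ, a + b ≤ j ∧ T = N ^ b * X ^ a} := by
  have hcomm : ∀ b : ℕ, X * N ^ (b + 1) = N ^ (b + 1) * X + (b + 1 : ℂ) • N ^ b := by
    intro b
    induction b with
    | zero => simp [h]
    | succ b ih =>
      rw [pow_succ N (b + 1), ← mul_assoc, ih, add_mul, mul_assoc, h, smul_mul_assoc, ← pow_succ,
        mul_add, mul_one, ← mul_assoc, add_assoc]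
      congr 1
      push_cast
      rw [add_smul ((b : ℂ) + 1) 1, one_smul, add_comm]
  induction j with
  | zero => exact Submodule.subset_span ⟨0, 0, by simp, by simp⟩
  | succ j ih =>
    rw [pow_succ']
    refine Submodule.span_induction (p := fun T _ => (X + N) * T ∈ Submodule.span ℂ
      {T : R | ∃ a b : ℕ, a + b ≤ j + 1 ∧ T = N ^ b * X ^ a}) ?_ ?_ ?_ ?_ ih
    · rintro _ ⟨a, b, hab, rfl⟩
      rw [add_mul, ← mul_assoc, ← mul_assoc, ← pow_succ' N]
      refine Submodule.add_mem _ ?_ (Submodule.subset_span ⟨a, b + 1, by omega, rfl⟩)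
      cases b with
      | zero =>
        refine Submodule.subset_span ⟨a + 1, 0, by omega, ?_⟩
        simp [pow_succ']
      | succ b =>
        rw [hcomm, add_mul, mul_assoc, ← pow_succ', smul_mul_assoc]
        refine Submodule.add_mem _ (Submodule.subset_span ⟨a + 1, b + 1, by omega, rfl⟩) ?_
        exact Submodule.smul_mem _ _ (Submodule.subset_span ⟨a, b, by omega, rfl⟩)
    · simp
    · intro x y _ _ hx hy
      rw [mul_add]; exact Submodule.add_mem _ hx hy
    · intro c x _ hx
      rw [mul_smul_comm]; exact Submodule.smul_mem _ _ hx

/-- The distribution `X` has weighted derivatives `x_i^a ∂_i^b X`, `a + b ≤ j`, of `L²` norm at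
most `M`, tested on Hermite functions. -/
def WeakBound (j : ℕ) (M : ℝ) (X : 𝓢'(Space d, ℂ)) : Prop :=
  ∀ (i : Fin d) (a b : ℕ), a + b ≤ j → ∃ v : L2 d, ‖v‖ ≤ M ∧
    ∀ m, coef v m = X ((negD i ^ b * endX i ^ a) (hermiteS m))

theorem sum_coef_sq_le (v : L2 d) (s : Finset (Fin d → ℕ)) :
    ∑ m ∈ s, ‖coef v m‖ ^ 2 ≤ ‖v‖ ^ 2 :=
  orthonormal_hermiteL2.sum_inner_products_le v

/-- After normal ordering, (x_i - ∂_i)^j is a combination of monomials (-∂_i)^b x_i^a with a + b ≤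
j. Tested on Hermite functions, each one yields the coefficients of an L² function of norm at most
M, and Bessel's inequality applies. -/
theorem exists_sum_raise_le (j : ℕ) (i : Fin d) : ∃ C : ℝ, 0 ≤ C ∧
    ∀ (X : 𝓢'(Space d, ℂ)) (M : ℝ), 0 ≤ M → WeakBound j M X → ∀ s : Finset (Fin d → ℕ),
      ∑ m ∈ s, ‖X (((endX i + negD i) ^ j) (hermiteS m))‖ ^ 2 ≤ C * M ^ 2 := by
  refine Submodule.span_induction (p := fun T _ => ∃ C : ℝ, 0 ≤ C ∧
    ∀ (X : 𝓢'(Space d, ℂ)) (M : ℝ), 0 ≤ M → WeakBound j M X → ∀ s : Finset (Fin d → ℕ),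
      ∑ m ∈ s, ‖X (T (hermiteS m))‖ ^ 2 ≤ C * M ^ 2) ?_ ?_ ?_ ?_
      (add_pow_mem_span (endX_mul_negD i) j)
  · rintro _ ⟨a, b, hab, rfl⟩
    refine ⟨1, zero_le_one, fun X M hM hX s => ?_⟩
    obtain ⟨v, hv, hv'⟩ := hX i a b hab
    simp only [← hv']
    rw [one_mul]
    exact (sum_coef_sq_le v s).trans (pow_le_pow_left₀ (norm_nonneg _) hv 2)
  · refine ⟨0, le_rfl, fun X M hM hX s => ?_⟩
    simp
  · rintro T T' _ _ ⟨C, hC, h⟩ ⟨C', hC', h'⟩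
    refine ⟨2 * (C + C'), by positivity, fun X M hM hX s => ?_⟩
    calc _ ≤ ∑ m ∈ s, 2 * (‖X (T (hermiteS m))‖ ^ 2 + ‖X (T' (hermiteS m))‖ ^ 2) := by
          refine Finset.sum_le_sum fun m _ => ?_
          rw [LinearMap.add_apply, map_add]
          have h1 := norm_add_le (X (T (hermiteS m))) (X (T' (hermiteS m)))
          have h2 := sq_nonneg (‖X (T (hermiteS m))‖ - ‖X (T' (hermiteS m))‖)
          nlinarith [norm_nonneg (X (T (hermiteS m)) + X (T' (hermiteS m)))]
      _ ≤ _ := by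
          rw [← Finset.mul_sum, Finset.sum_add_distrib]
          nlinarith [h X M hM hX s, h' X M hM hX s]
  · rintro c T _ ⟨C, hC, h⟩
    refine ⟨‖c‖ ^ 2 * C, by positivity, fun X M hM hX s => ?_⟩
    calc _ = ∑ m ∈ s, ‖c‖ ^ 2 * ‖X (T (hermiteS m))‖ ^ 2 := by
          refine Finset.sum_congr rfl fun m _ => ?_
          rw [LinearMap.smul_apply, map_smul, norm_smul, mul_pow]
      _ ≤ _ := by
          rw [← Finset.mul_sum, mul_assoc]
          exact mul_le_mul_of_nonneg_left (h X M hM hX s) (by positivity)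

end GP

/-! ### Control of the spectral norm by the weighted derivatives, through powers of the raising
operators. -/

namespace GP

variable {d : ℕ}

theorem exists_raise_pow (i : Fin d) (j : ℕ) (m : Fin d → ℕ) :
    ∃ c : ℝ, ((m i + j).descFactorial j : ℝ) ≤ c ^ 2 ∧
      ((endX i + negD i) ^ j) (hermiteS m) = (c : ℂ) • hermiteS (Function.update m i (m i + j)) := by
  induction j with
  | zero => exact ⟨1, by simp, by simp⟩
  | succ j ih =>
    obtain ⟨c, hc, h⟩ := ih
    have hr : ∀ f : 𝓢(Space d, ℂ), (endX i + negD i) f = raiseX i f := by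
      intro f
      rw [raiseX, sub_eq_add_neg]; rfl
    refine ⟨c * (Real.sqrt 2 * Real.sqrt (m i + j + 1)), ?_, ?_⟩
    · rw [← add_assoc, Nat.succ_descFactorial_succ]
      push_cast
      rw [mul_pow, mul_pow, Real.sq_sqrt (by norm_num), Real.sq_sqrt (by positivity)]
      have h1 : (0 : ℝ) ≤ (m i + j).descFactorial j := by positivity
      have h2 : (0 : ℝ) ≤ (m i : ℝ) + j + 1 := by positivity
      nlinarith
    · rw [pow_succ', Module.End.mul_apply, h, map_smul, hr, raiseX_hermiteS, smul_smul]
      simp only [up, Function.update_self, Function.update_idem]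
      push_cast
      rfl

/-- If n ≥ 2j, each of the j factors of the descending factorial is at least n + 1 - j ≥ (2n + 1)/4.
If n < 2j, the left side is bounded by a constant. -/
theorem pow_le_descFactorial (n j : ℕ) :
    (2 * (n : ℝ) + 1) ^ j ≤ (4 * j + 1) ^ j + 4 ^ j * n.descFactorial j := by
  rcases lt_or_ge n (2 * j) with h | h
  · have h1 : (n : ℝ) ≤ 2 * j := by exact_mod_cast h.le
    calc (2 * (n : ℝ) + 1) ^ j ≤ (4 * j + 1) ^ j := by gcongr ?_ ^ j; linarith
      _ ≤ _ := by linarith [show (0 : ℝ) ≤ 4 ^ j * n.descFactorial j by positivity]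
  · have h1 : ((n + 1 - j : ℕ) : ℝ) ^ j ≤ n.descFactorial j := by
      exact_mod_cast Nat.pow_sub_le_descFactorial n j
    have h2 : (2 * (n : ℝ) + 1) ≤ 4 * ((n + 1 - j : ℕ) : ℝ) := by
      have : 2 * n + 1 ≤ 4 * (n + 1 - j) := by omega
      exact_mod_cast this
    calc (2 * (n : ℝ) + 1) ^ j ≤ (4 * ((n + 1 - j : ℕ) : ℝ)) ^ j := by gcongr
      _ = 4 ^ j * ((n + 1 - j : ℕ) : ℝ) ^ j := by rw [mul_pow]
      _ ≤ 4 ^ j * n.descFactorial j := by gcongr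
      _ ≤ _ := by linarith [show (0 : ℝ) ≤ (4 * (j : ℝ) + 1) ^ j by positivity]

/-- The eigenvalue is at most d times the contribution of its largest coordinate. So pure powers in
one coordinate suffice, and only the unmixed derivatives x_i^a ∂_i^b are needed in `WeakBound`. -/
theorem lam_pow_le [NeZero d] (m : Fin d → ℕ) (j : ℕ) :
    lam m ^ j ≤ d ^ j * ((4 * j + 1) ^ j + 4 ^ j * ∑ i, ((m i).descFactorial j : ℝ)) := by
  obtain ⟨i, -, hi⟩ := Finset.exists_max_image Finset.univ m ⟨0, Finset.mem_univ 0⟩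
  have h1 : lam m ≤ d * (2 * (m i : ℝ) + 1) := by
    calc lam m ≤ ∑ _k : Fin d, (2 * (m i : ℝ) + 1) := by
          refine Finset.sum_le_sum fun k _ => ?_
          have : (m k : ℝ) ≤ m i := by exact_mod_cast hi k (Finset.mem_univ k)
          linarith
      _ = _ := by simp; ring
  have h2 : ((m i).descFactorial j : ℝ) ≤ ∑ i, ((m i).descFactorial j : ℝ) :=
    Finset.single_le_sum (f := fun i => ((m i).descFactorial j : ℝ)) (fun _ _ => by positivity)
      (Finset.mem_univ i)
  have h3 := one_le_lam m
  calc lam m ^ j ≤ (d * (2 * (m i : ℝ) + 1)) ^ j := by gcongr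
    _ = d ^ j * (2 * (m i : ℝ) + 1) ^ j := by rw [mul_pow]
    _ ≤ d ^ j * ((4 * j + 1) ^ j + 4 ^ j * (m i).descFactorial j) := by
        gcongr; exact pow_le_descFactorial _ _
    _ ≤ _ := by gcongr

/-- The indices with m_i < j have weight zero. Any other m is reached by raising m - j e_i exactly j
times, with a squared factor at least the weight. -/
theorem sum_descFactorial_le (j : ℕ) (i : Fin d) (X : 𝓢'(Space d, ℂ)) {B : ℝ}
    (h : ∀ s : Finset (Fin d → ℕ),
      ∑ m ∈ s, ‖X (((endX i + negD i) ^ j) (hermiteS m))‖ ^ 2 ≤ B) (s : Finset (Fin d → ℕ)) :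
    ∑ m ∈ s, ((m i).descFactorial j : ℝ) * ‖X (hermiteS m)‖ ^ 2 ≤ B := by
  classical
  set g : (Fin d → ℕ) → (Fin d → ℕ) := fun m => Function.update m i (m i - j) with hg
  set t := s.filter fun m => j ≤ m i with ht
  have h1 : ∑ m ∈ s, ((m i).descFactorial j : ℝ) * ‖X (hermiteS m)‖ ^ 2 =
      ∑ m ∈ t, ((m i).descFactorial j : ℝ) * ‖X (hermiteS m)‖ ^ 2 := by
    rw [ht, Finset.sum_filter]
    refine Finset.sum_congr rfl fun m _ => ?_
    split_ifs with hm
    · rfl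
    · rw [Nat.descFactorial_eq_zero_iff_lt.2 (by omega)]; simp
  have hback : ∀ m ∈ t, Function.update (g m) i (g m i + j) = m := by
    intro m hm
    have : j ≤ m i := (Finset.mem_filter.1 hm).2
    simp [hg, Nat.sub_add_cancel this]
  have hinj : Set.InjOn g t := by
    intro m hm m' hm' he
    rw [← hback m hm, ← hback m' hm', he]
  rw [h1]
  refine le_trans ?_ (h (t.image g))
  rw [Finset.sum_image hinj]
  refine Finset.sum_le_sum fun m hm => ?_
  obtain ⟨c, hc, hc'⟩ := exists_raise_pow i j (g m)
  rw [hc', hback m hm, map_smul, norm_smul, mul_pow, Complex.norm_real, Real.norm_eq_abs, sq_abs]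
  gcongr
  have : g m i + j = m i := by
    have : j ≤ m i := (Finset.mem_filter.1 hm).2
    simp [hg, Nat.sub_add_cancel this]
  rwa [this] at hc

/-- The norm of `Σ^j` of a Hermite truncation is controlled by the weighted derivatives. -/
theorem exists_norm_Lam_le [NeZero d] (j : ℕ) : ∃ C : ℝ, 0 < C ∧ ∀ (K : ℕ) (u : L2 d) (M : ℝ),
    0 ≤ M → WeakBound j M (dist u) → ‖Lam K j u‖ ≤ C * M := by
  choose c hc0 hc using fun i : Fin d => exists_sum_raise_le j i
  set B : ℝ := d ^ j * ((4 * j + 1) ^ j + 4 ^ j * ∑ i, c i) with hB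
  have hB0 : 0 ≤ B := by
    have := Finset.sum_nonneg fun i (_ : i ∈ Finset.univ) => hc0 i
    positivity
  refine ⟨Real.sqrt B + 1, by positivity, fun K u M hM hu => ?_⟩
  have h0 : ∑ m ∈ box d K, ‖coef u m‖ ^ 2 ≤ M ^ 2 := by
    obtain ⟨v, hv, hv'⟩ := hu 0 0 0 (by simp)
    have : ∀ m, coef u m = coef v m := by
      intro m
      rw [hv', coef_eq_dist]; simp
    simp only [this]
    exact (sum_coef_sq_le v _).trans (pow_le_pow_left₀ (norm_nonneg _) hv 2)
  have h1 : ‖Lam K j u‖ ^ 2 ≤ B * M ^ 2 := by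
    rw [norm_sq_Lam]
    calc ∑ m ∈ box d K, lam m ^ (j : ℤ) * ‖coef u m‖ ^ 2
        ≤ ∑ m ∈ box d K, d ^ j * ((4 * j + 1) ^ j * ‖coef u m‖ ^ 2 + 4 ^ j *
            ∑ i, ((m i).descFactorial j : ℝ) * ‖coef u m‖ ^ 2) := by
          refine Finset.sum_le_sum fun m _ => ?_
          rw [zpow_natCast, ← Finset.sum_mul, ← mul_assoc (4 ^ j : ℝ), ← add_mul, ← mul_assoc]
          gcongr
          exact lam_pow_le m j
      _ = d ^ j * ((4 * j + 1) ^ j * ∑ m ∈ box d K, ‖coef u m‖ ^ 2 + 4 ^ j *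
            ∑ i, ∑ m ∈ box d K, ((m i).descFactorial j : ℝ) * ‖coef u m‖ ^ 2) := by
          rw [← Finset.mul_sum, Finset.sum_add_distrib, ← Finset.mul_sum, ← Finset.mul_sum,
            Finset.sum_comm]
      _ ≤ d ^ j * ((4 * j + 1) ^ j * M ^ 2 + 4 ^ j * ∑ i, c i * M ^ 2) := by
          gcongr with i
          simp only [coef_eq_dist]
          exact sum_descFactorial_le j i _ (hc i (dist u) M hM hu) _
      _ = B * M ^ 2 := by rw [hB, ← Finset.sum_mul]; ring
  calc ‖Lam K j u‖ ≤ Real.sqrt B * M := by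
        refine le_of_sq_le_sq ?_ (by positivity)
        rwa [mul_pow, Real.sq_sqrt hB0]
    _ ≤ _ := by gcongr; linarith

theorem negD_pow_apply_dist (i : Fin d) (b : ℕ) (X : 𝓢'(Space d, ℂ)) (f : 𝓢(Space d, ℂ)) :
    ((fun Y : 𝓢'(Space d, ℂ) => ∂_{EuclideanSpace.single i (1 : ℝ)} Y)^[b] X) f =
      X ((negD i ^ b) f) := by
  induction b generalizing f with
  | zero => rfl
  | succ b ih =>
    rw [Function.iterate_succ_apply', TemperedDistribution.lineDerivOp_apply_apply, ih, pow_succ,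
      Module.End.mul_apply]
    rfl

theorem foldr_single {β : Type*} (T : Fin d → β → β) (i : Fin d) (b : ℕ) (X : β)
    (l : List (Fin d)) (hl : l.Nodup) :
    l.foldr (fun k Y => (T k)^[(Pi.single i b : Fin d → ℕ) k] Y) X =
      if i ∈ l then (T i)^[b] X else X := by
  induction l with
  | nil => simp
  | cons k l ih =>
    rw [List.nodup_cons] at hl
    rw [List.foldr_cons, ih hl.2]
    rcases eq_or_ne i k with rfl | h
    · simp [hl.1]
    · simp [h]

theorem endX_pow_apply (i : Fin d) (a : ℕ) (f : 𝓢(Space d, ℂ)) :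
    (endX i ^ a) f = (mulX i)^[a] f := by
  rw [Module.End.pow_apply]; rfl

theorem norm_toL2_le_sigmaNorm {j : ℕ} {α β : Fin d → ℕ} (h : (α, β) ∈ indexPairs d j)
    (φ : L2 d) : ‖toL2 (weightedDeriv α β φ)‖ ≤ sigmaNorm j φ := by
  have h1 := Finset.single_le_sum (s := indexPairs d j)
    (f := fun p => ‖toL2 (weightedDeriv p.1 p.2 φ)‖ ^ 2) (fun p _ => sq_nonneg _) h
  rw [sigmaNorm]
  exact Real.le_sqrt_of_sq_le h1

theorem single_mem_indexPairs {j a b : ℕ} (i : Fin d) (hab : a + b ≤ j) :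
    ((Pi.single i b, Pi.single i a) : (Fin d → ℕ) × (Fin d → ℕ)) ∈ indexPairs d j := by
  rw [mem_indexPairs]
  simp only [Finset.sum_pi_single', Finset.mem_univ, if_true]
  omega

theorem smulLeftCLM_single (i : Fin d) (a : ℕ) (f : 𝓢(Space d, ℂ)) :
    SchwartzMap.smulLeftCLM ℂ
      (fun x : Space d => ((∏ k, x k ^ (Pi.single i a : Fin d → ℕ) k : ℝ) : ℂ)) f =
      (mulX i)^[a] f := by
  ext x
  rw [SchwartzMap.smulLeftCLM_apply_apply (hasTemperateGrowth_monomial _), iterate_mulX_apply,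
    smul_eq_mul, Finset.prod_eq_single i (fun k _ hk => by rw [Pi.single_eq_of_ne hk, pow_zero])
      (by simp), Pi.single_eq_same, Complex.ofReal_pow]

theorem weightedDeriv_single_apply (i : Fin d) (a b : ℕ) (φ : L2 d) (f : 𝓢(Space d, ℂ)) :
    weightedDeriv (Pi.single i b) (Pi.single i a) φ f =
      dist φ ((negD i ^ b * endX i ^ a) f) := by
  have e := foldr_single (fun k => fun Y : 𝓢'(Space d, ℂ) => ∂_{EuclideanSpace.single k (1 : ℝ)} Y)
    i b (dist φ) (List.finRange d) (List.nodup_finRange d)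
  rw [if_pos (List.mem_finRange i)] at e
  rw [weightedDeriv, TemperedDistribution.smulLeftCLM_apply_apply, e, negD_pow_apply_dist,
    smulLeftCLM_single, Module.End.mul_apply, endX_pow_apply]

/-- Testing by duality on Hermite functions covers every element of Σ^j, in particular the initial
datum, and not only Schwartz functions. -/
theorem weakBound_of_memSigma {j : ℕ} {φ : L2 d} (h : MemSigma j φ) :
    WeakBound j (sigmaNorm j φ) (dist φ) := by
  intro i a b hab
  have hmem := single_mem_indexPairs i hab
  refine ⟨toL2 (weightedDeriv (Pi.single i b) (Pi.single i a) φ),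
    norm_toL2_le_sigmaNorm hmem φ, fun m => ?_⟩
  rw [coef_eq_dist, dist_toL2 (h _ hmem), weightedDeriv_single_apply]

theorem integral_endX_pow (i : Fin d) (a : ℕ) (f g : 𝓢(Space d, ℂ)) :
    ∫ x, f x * (mulX i)^[a] g x = ∫ x, (endX i ^ a) f x * g x := by
  induction a generalizing f with
  | zero => simp
  | succ a ih =>
    rw [Function.iterate_succ_apply', pow_succ, Module.End.mul_apply, ← ih, ← integral_mulX_mul]
    rfl

theorem integral_negD_pow (i : Fin d) (b : ℕ) (f g : 𝓢(Space d, ℂ)) :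
    ∫ x, f x * (derX i)^[b] g x = ∫ x, (negD i ^ b) f x * g x := by
  induction b generalizing f with
  | zero => simp
  | succ b ih =>
    rw [Function.iterate_succ_apply', pow_succ, Module.End.mul_apply, ← ih]
    have h := integral_derX_mul i f ((derX i)^[b] g)
    have h2 : ∀ x, negD i f x * ((derX i)^[b] g) x = - (derX i f x * ((derX i)^[b] g) x) := by
      intro x
      rw [← neg_mul]; rfl
    simp only [h2]
    rw [integral_neg, h, neg_neg]

theorem weakBound_toL {j : ℕ} {M : ℝ} {f : 𝓢(Space d, ℂ)}
    (h : ∀ (i : Fin d) (a b : ℕ), a + b ≤ j → ‖toL ((mulX i)^[a] ((derX i)^[b] f))‖ ≤ M) :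
    WeakBound j M (dist (toL f)) := by
  intro i a b hab
  refine ⟨_, h i a b hab, fun m => ?_⟩
  rw [coef_toL, integral_endX_pow, integral_negD_pow, ← Module.End.mul_apply, dist_toL, distS]
  exact (SchwartzMap.toTemperedDistributionCLM_apply_apply volume f _).symm

end GP

namespace GP

variable {d : ℕ}

/-! ### Sobolev embedding on Schwartz functions -/

theorem norm_sq_toL (f : 𝓢(Space d, ℂ)) : ‖toL f‖ ^ 2 = ∫ x, ‖f x‖ ^ 2 := by
  have h := SchwartzMap.inner_toL2_toL2_eq f f (volume : Measure (Space d))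
  have h2 : (inner ℂ (toL f) (toL f) : ℂ) = ((‖toL f‖ ^ 2 : ℝ) : ℂ) := by
    rw [inner_self_eq_norm_sq_to_K]; push_cast; rfl
  have h3 : (inner ℂ (toL f) (toL f) : ℂ) = ((∫ x, ‖f x‖ ^ 2 : ℝ) : ℂ) := by
    refine h.trans ?_
    rw [← integral_complex_ofReal]
    refine integral_congr_ae (Filter.Eventually.of_forall fun x => ?_)
    simp only [inner_self_eq_norm_sq_to_K]
    push_cast; rfl
  rw [h2] at h3
  exact_mod_cast h3

theorem integrable_norm_sq (f : 𝓢(Space d, ℂ)) : Integrable (fun x => ‖f x‖ ^ 2) :=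
  (memLp_two_iff_integrable_sq_norm f.continuous.aestronglyMeasurable).1 (f.memLp 2)

/-- Pointwise domination of Fourier transforms gives a uniform bound, as soon as the weight has
exponent larger than half of the dimension. -/
theorem exists_norm_apply_le_of_fourier {p : ℝ} (hp : (d : ℝ) < 2 * p) : ∃ C : ℝ, 0 < C ∧
    ∀ f g : 𝓢(Space d, ℂ),
      (∀ ξ, (1 + ‖ξ‖ ^ 2) ^ p * ‖FourierTransform.fourier f ξ‖ ^ 2
        ≤ ‖FourierTransform.fourier g ξ‖ ^ 2) →
      ∀ x, ‖f x‖ ≤ C * ‖toL g‖ := by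
  have hI : Integrable (fun ξ : Space d => (1 + ‖ξ‖ ^ 2) ^ (-p)) := by
    have := integrable_rpow_neg_one_add_norm_sq (E := Space d) (μ := volume) (r := 2 * p)
      (by simpa using hp)
    refine this.congr (Filter.Eventually.of_forall fun x => ?_)
    simp only []
    congr 1; ring
  set J : ℝ := ∫ ξ : Space d, (1 + ‖ξ‖ ^ 2) ^ (-p) with hJ
  have hJ0 : 0 ≤ J := integral_nonneg fun ξ => by positivity
  refine ⟨(J + 1) / 2, by positivity, fun f g hfg x => ?_⟩
  have hg : ∫ ξ, ‖FourierTransform.fourier g ξ‖ ^ 2 = ‖toL g‖ ^ 2 := by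
    rw [SchwartzMap.integral_norm_sq_fourier, norm_sq_toL]
  set F := FourierTransform.fourier f with hF
  set G := FourierTransform.fourier g with hG
  have h1 : ‖f x‖ ≤ ∫ ξ, ‖F ξ‖ := by
    have : f = FourierTransform.fourierInv F := by
      rw [hF, FourierTransform.fourierInv_fourier_eq]
    rw [this, SchwartzMap.fourierInv_coe, Real.fourierInv_eq]
    refine (norm_integral_le_integral_norm _).trans (le_of_eq ?_)
    refine integral_congr_ae (Filter.Eventually.of_forall fun ξ => ?_)
    simp [Circle.norm_smul]
  -- This is the Cauchy-Schwarz inequality ∫|F| ≤ ‖w^{-1/2}‖ ‖w^{1/2} F‖ in the form of Young's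
  -- inequality with a free parameter t, chosen below as the norm of g.
  have key : ∀ t : ℝ, 0 < t → ‖f x‖ ≤ (t * J + ‖toL g‖ ^ 2 / t) / 2 := by
    intro t ht
    have h2 : ∀ ξ, ‖F ξ‖ ≤ (t * (1 + ‖ξ‖ ^ 2) ^ (-p) + ‖G ξ‖ ^ 2 / t) / 2 := by
      intro ξ
      have hw : (0 : ℝ) < 1 + ‖ξ‖ ^ 2 := by positivity
      have hwp : (0 : ℝ) < (1 + ‖ξ‖ ^ 2) ^ p := Real.rpow_pos_of_pos hw p
      have h3 := hfg ξ
      have h4 : (1 + ‖ξ‖ ^ 2) ^ p * ‖F ξ‖ ^ 2 / t ≤ ‖G ξ‖ ^ 2 / t := by gcongr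
      rw [Real.rpow_neg hw.le]
      set w := (1 + ‖ξ‖ ^ 2) ^ p with hwdef
      have h5 : 2 * ‖F ξ‖ ≤ t * w⁻¹ + w * ‖F ξ‖ ^ 2 / t := by
        have : t * w⁻¹ + w * ‖F ξ‖ ^ 2 / t - 2 * ‖F ξ‖ = (t - w * ‖F ξ‖) ^ 2 / (w * t) := by
          field_simp; ring
        have h6 : 0 ≤ (t - w * ‖F ξ‖) ^ 2 / (w * t) := by positivity
        linarith
      linarith
    have hi : Integrable fun ξ => (t * (1 + ‖ξ‖ ^ 2) ^ (-p) + ‖G ξ‖ ^ 2 / t) / 2 :=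
      ((hI.const_mul t).add ((integrable_norm_sq G).div_const t)).div_const 2
    calc ‖f x‖ ≤ ∫ ξ, ‖F ξ‖ := h1
      _ ≤ ∫ ξ, (t * (1 + ‖ξ‖ ^ 2) ^ (-p) + ‖G ξ‖ ^ 2 / t) / 2 :=
          integral_mono F.integrable.norm hi h2
      _ = _ := by
          rw [integral_div, integral_add (hI.const_mul t) ((integrable_norm_sq G).div_const t),
            integral_const_mul, integral_div, hg]
  rcases (norm_nonneg (toL g)).eq_or_lt with h0 | h0
  · rw [← h0, mul_zero]
    rw [← h0] at key
    by_contra! hc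
    -- When the norm of g is zero the bound reads ‖f x‖ ≤ tJ/2 for all t > 0, and this t contradicts
    -- ‖f x‖ > 0.
    have := key (‖f x‖ / (J + 1)) (by positivity)
    have h7 : ‖f x‖ / (J + 1) * J ≤ ‖f x‖ := by
      rw [div_mul_eq_mul_div, div_le_iff₀ (by positivity)]; nlinarith
    norm_num at this
    linarith
  · have := key ‖toL g‖ h0
    rw [sq, mul_div_assoc, div_self h0.ne', mul_one] at this
    linarith

theorem fourier_derX (i : Fin d) (f : 𝓢(Space d, ℂ)) (ξ : Space d) :
    FourierTransform.fourier (derX i f) ξ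
      = (2 * Real.pi * Complex.I * (ξ i : ℂ)) * FourierTransform.fourier f ξ := by
  rw [derX_eq, SchwartzMap.fourier_lineDerivOp_eq]
  have h : (fun x : Space d => inner ℝ x (EuclideanSpace.single i (1 : ℝ))).HasTemperateGrowth := by
    fun_prop
  rw [_root_.smul_apply, SchwartzMap.smulLeftCLM_apply_apply h]
  simp [EuclideanSpace.inner_single_right]
  ring

theorem one_le_two_pi_sq : (1 : ℝ) ≤ (2 * Real.pi) ^ 2 := by
  nlinarith [Real.pi_gt_three]

/-- The operator `1 - Δ`, or `1 + ∂` in dimension one, which controls the uniform norm. -/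
noncomputable def sobolevOp (d : ℕ) (f : 𝓢(Space d, ℂ)) : 𝓢(Space d, ℂ) :=
  if d = 1 then f + ∑ i, derX i f else f - ∑ i, derX i (derX i f)

/-- The number of derivatives of `sobolevOp`. -/
def sobolevOrder (d : ℕ) : ℕ := if d = 1 then 1 else 2

/-- The symbol 1 + 2πiξ has squared modulus at least 1 + ξ² (p = 1), and 1 + 4π²|ξ|² is at least 1 +
|ξ|² (p = 2). For d ≤ 3 this reaches 2p > d with the least integer order above d/2. -/
theorem fourier_sobolevOp (hd : d ≤ 3) : ∃ p : ℝ, (d : ℝ) < 2 * p ∧ ∀ (f : 𝓢(Space d, ℂ)) ξ,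
    (1 + ‖ξ‖ ^ 2) ^ p * ‖FourierTransform.fourier f ξ‖ ^ 2
        ≤ ‖FourierTransform.fourier (sobolevOp d f) ξ‖ ^ 2 := by
  have hadd : ∀ (f g : 𝓢(Space d, ℂ)) ξ, FourierTransform.fourier (f + g) ξ
      = FourierTransform.fourier f ξ + FourierTransform.fourier g ξ := fun f g ξ => by
    rw [FourierTransform.fourier_add, _root_.add_apply]
  have hsum : ∀ (F : Fin d → 𝓢(Space d, ℂ)) ξ, FourierTransform.fourier (∑ i, F i) ξ
      = ∑ i, FourierTransform.fourier (F i) ξ := fun F ξ => by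
    have := map_sum (FourierTransform.fourierCLM ℂ 𝓢(Space d, ℂ)) F Finset.univ
    simp only [FourierTransform.fourierCLM_apply] at this
    rw [this, _root_.sum_apply]
  have hneg : ∀ (f : 𝓢(Space d, ℂ)) ξ, FourierTransform.fourier (-f) ξ
      = - FourierTransform.fourier f ξ := fun f ξ => by
    have := map_neg (FourierTransform.fourierCLM ℂ 𝓢(Space d, ℂ)) f
    simp only [FourierTransform.fourierCLM_apply] at this
    rw [this, _root_.neg_apply]
  by_cases h1 : d = 1
  · subst h1
    refine ⟨1, by norm_num, fun f ξ => ?_⟩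
    rw [sobolevOp, if_pos rfl, hadd, hsum]
    simp only [Fin.sum_univ_one, fourier_derX, Fin.isValue]
    have h2 : ‖ξ‖ ^ 2 = ξ 0 ^ 2 := by rw [EuclideanSpace.norm_sq_eq]; simp
    rw [← one_add_mul, norm_mul, mul_pow, Real.rpow_one]
    gcongr
    have h3 : ‖(1 + 2 * Real.pi * Complex.I * (ξ 0 : ℂ) : ℂ)‖ ^ 2 = 1 + (2 * Real.pi * ξ 0) ^ 2 := by
      rw [← Complex.normSq_eq_norm_sq, Complex.normSq_apply]; simp; ring
    rw [h3, h2]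
    nlinarith [one_le_two_pi_sq, sq_nonneg (ξ 0)]
  · refine ⟨2, ?_, fun f ξ => ?_⟩
    · have : (d : ℝ) ≤ 3 := by exact_mod_cast hd
      linarith
    rw [sobolevOp, if_neg h1, sub_eq_add_neg, hadd, hneg, hsum]
    simp only [fourier_derX]
    have h3 : FourierTransform.fourier f ξ + -∑ i, 2 * Real.pi * Complex.I * (ξ i : ℂ) *
        (2 * Real.pi * Complex.I * (ξ i : ℂ) * FourierTransform.fourier f ξ)
        = ((1 + (2 * Real.pi) ^ 2 * ‖ξ‖ ^ 2 : ℝ) : ℂ) * FourierTransform.fourier f ξ := by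
      rw [EuclideanSpace.norm_sq_eq]
      push_cast
      rw [add_mul, one_mul, Finset.mul_sum, Finset.sum_mul, ← Finset.sum_neg_distrib]
      congr 1
      refine Finset.sum_congr rfl fun i _ => ?_
      have : ((‖ξ i‖ : ℝ) : ℂ) ^ 2 = (ξ i : ℂ) ^ 2 := by
        rw [← Complex.ofReal_pow, Real.norm_eq_abs, sq_abs]; push_cast; rfl
      rw [this]
      linear_combination (-4 * Real.pi ^ 2 * (ξ i : ℂ) ^ 2 * FourierTransform.fourier f ξ)
        * Complex.I_sq
    rw [h3, norm_mul, mul_pow, Complex.norm_real, Real.norm_eq_abs, sq_abs]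
    gcongr
    rw [show (2 : ℝ) = ((2 : ℕ) : ℝ) by norm_num, Real.rpow_natCast]
    gcongr
    have := one_le_two_pi_sq
    push_cast at *
    nlinarith [sq_nonneg ‖ξ‖]

theorem sobolevOrder_le_two (d : ℕ) : sobolevOrder d = 1 ∨ sobolevOrder d = 2 := by
  unfold sobolevOrder; split_ifs <;> simp

/-- The Sobolev embedding for derivatives of finite linear combinations of Hermite functions. -/
theorem exists_norm_iterate_derX_apply_le [NeZero d] (hd : d ≤ 3) (i : Fin d) (b : ℕ) :
    ∃ C : ℝ, 0 < C ∧ ∀ (K : ℕ) (f : 𝓢(Space d, ℂ)), f ∈ hermiteSpan d → toL f ∈ SigmaK d K →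
      ∀ x, ‖(derX i)^[b] f x‖ ≤ C * ‖Lam K ((b + sobolevOrder d : ℕ) : ℤ) (toL f)‖ := by
  obtain ⟨p, hp, hF⟩ := fourier_sobolevOp hd
  obtain ⟨C₁, hC₁, h₁⟩ := exists_norm_apply_le_of_fourier hp
  have hit : ∀ f ∈ hermiteSpan d, (derX i)^[b] f ∈ hermiteSpan d := by
    intro f hf
    induction b with
    | zero => exact hf
    | succ b ih => rw [Function.iterate_succ_apply']; exact derX_mem i ih
  have hb := OrderLE.iterate (orderLE_derX i) b
  obtain ⟨C₀, hC₀, h₀⟩ := hb.exists_norm_le hit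
  have hk1 : 1 ≤ sobolevOrder d := by rcases sobolevOrder_le_two d with h | h <;> omega
  have hsum : ∃ C : ℝ, 0 < C ∧ ∀ (K : ℕ) (f : 𝓢(Space d, ℂ)), f ∈ hermiteSpan d →
      toL f ∈ SigmaK d K → ‖toL (sobolevOp d ((derX i)^[b] f))‖ ≤
        C * ‖Lam K ((b + sobolevOrder d : ℕ) : ℤ) (toL f)‖ := by
    by_cases h1 : d = 1
    · have hk : sobolevOrder d = 1 := by simp [sobolevOrder, h1]
      have hl : ∀ l : Fin d, ∃ C : ℝ, 0 < C ∧ ∀ (K : ℕ) (f : 𝓢(Space d, ℂ)), f ∈ hermiteSpan d →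
          toL f ∈ SigmaK d K → ∀ s, b + 1 ≤ s → ‖toL ((derX l ∘ (derX i)^[b]) f)‖
            ≤ C * ‖Lam K s (toL f)‖ := fun l => by
        have := ((orderLE_derX l).comp hb).exists_norm_le (fun f hf => derX_mem l (hit f hf))
        rwa [add_comm 1 b] at this
      choose C hC h using hl
      refine ⟨C₀ + ∑ l, C l, add_pos_of_pos_of_nonneg hC₀
        (Finset.sum_nonneg fun l _ => (hC l).le), fun K f hf hfK => ?_⟩
      rw [sobolevOp, if_pos h1, map_add, map_sum, hk, add_mul, Finset.sum_mul]
      refine (norm_add_le _ _).trans (add_le_add (h₀ K f hf hfK _ (by simp)) ?_)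
      exact (norm_sum_le _ _).trans (Finset.sum_le_sum fun l _ => h l K f hf hfK _ (by simp))
    · have hk : sobolevOrder d = 2 := by simp [sobolevOrder, h1]
      have hl : ∀ l : Fin d, ∃ C : ℝ, 0 < C ∧ ∀ (K : ℕ) (f : 𝓢(Space d, ℂ)), f ∈ hermiteSpan d →
          toL f ∈ SigmaK d K → ∀ s, b + 2 ≤ s → ‖toL ((derX l ∘ derX l ∘ (derX i)^[b]) f)‖
            ≤ C * ‖Lam K s (toL f)‖ := fun l => by
        have := ((orderLE_derX l).comp ((orderLE_derX l).comp hb)).exists_norm_le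
          (fun f hf => derX_mem l (derX_mem l (hit f hf)))
        rwa [show 1 + (1 + b) = b + 2 by ring] at this
      choose C hC h using hl
      refine ⟨C₀ + ∑ l, C l, add_pos_of_pos_of_nonneg hC₀
        (Finset.sum_nonneg fun l _ => (hC l).le), fun K f hf hfK => ?_⟩
      rw [sobolevOp, if_neg h1, map_sub, map_sum, hk, add_mul, Finset.sum_mul]
      refine (norm_sub_le _ _).trans (add_le_add (h₀ K f hf hfK _ (by simp)) ?_)
      exact (norm_sum_le _ _).trans (Finset.sum_le_sum fun l _ => h l K f hf hfK _ (by simp))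
  obtain ⟨C₂, hC₂, h₂⟩ := hsum
  refine ⟨C₁ * C₂, by positivity, fun K f hf hfK x => ?_⟩
  calc ‖(derX i)^[b] f x‖ ≤ C₁ * ‖toL (sobolevOp d ((derX i)^[b] f))‖ := h₁ _ _ (hF _) x
    _ ≤ C₁ * (C₂ * ‖Lam K ((b + sobolevOrder d : ℕ) : ℤ) (toL f)‖) := by
        gcongr; exact h₂ K f hf hfK
    _ = _ := by ring

end GP

namespace GP

variable {d : ℕ}

/-! ### Products of Schwartz functions -/

/-- The pointwise product of two Schwartz functions. -/
noncomputable def prodS (f g : 𝓢(Space d, ℂ)) : 𝓢(Space d, ℂ) :=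
  SchwartzMap.pairing (ContinuousLinearMap.mul ℂ ℂ) f g

@[simp] theorem prodS_apply (f g : 𝓢(Space d, ℂ)) (x : Space d) : prodS f g x = f x * g x := rfl

/-- The complex conjugate of a Schwartz function. -/
noncomputable def conjS (f : 𝓢(Space d, ℂ)) : 𝓢(Space d, ℂ) :=
  SchwartzMap.postcompCLM (𝕜 := ℝ) (Complex.conjCLE : ℂ →L[ℝ] ℂ) f

@[simp] theorem conjS_apply (f : 𝓢(Space d, ℂ)) (x : Space d) : conjS f x = star (f x) := rfl

theorem derX_eq_of_hasDerivAt {i : Fin d} {f : 𝓢(Space d, ℂ)} {x : Space d} {c : ℂ}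
    (h : HasDerivAt (fun t : ℝ => f (x + t • EuclideanSpace.single i (1 : ℝ))) c 0) :
    derX i f x = c :=
  HasDerivAt.unique (hasLineDerivAt i f x) h

theorem derX_prodS (i : Fin d) (f g : 𝓢(Space d, ℂ)) :
    derX i (prodS f g) = prodS (derX i f) g + prodS f (derX i g) := by
  ext x
  have := HasDerivAt.mul (hasLineDerivAt i f x) (hasLineDerivAt i g x)
  rw [derX_eq_of_hasDerivAt (f := prodS f g) this]
  simp

theorem derX_conjS (i : Fin d) (f : 𝓢(Space d, ℂ)) : derX i (conjS f) = conjS (derX i f) := by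
  ext x
  exact derX_eq_of_hasDerivAt (f := conjS f) (HasDerivAt.star (hasLineDerivAt i f x))

theorem iterate_derX_conjS (i : Fin d) (n : ℕ) (f : 𝓢(Space d, ℂ)) :
    (derX i)^[n] (conjS f) = conjS ((derX i)^[n] f) := by
  induction n with
  | zero => rfl
  | succ n ih => rw [Function.iterate_succ_apply', Function.iterate_succ_apply', ih, derX_conjS]

theorem norm_toL_le_of_le {f g : 𝓢(Space d, ℂ)} {c : ℝ} (hc : 0 ≤ c)
    (h : ∀ x, ‖f x‖ ≤ c * ‖g x‖) : ‖toL f‖ ≤ c * ‖toL g‖ := by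
  refine le_of_sq_le_sq ?_ (by positivity)
  rw [mul_pow, norm_sq_toL, norm_sq_toL, ← integral_const_mul]
  refine integral_mono (integrable_norm_sq f) ((integrable_norm_sq g).const_mul _) fun x => ?_
  simp only []
  rw [← mul_pow]
  gcongr
  exact h x

theorem norm_toL_eq_of_norm_eq {f g : 𝓢(Space d, ℂ)} (h : ∀ x, ‖f x‖ = ‖g x‖) :
    ‖toL f‖ = ‖toL g‖ := by
  have h1 := norm_toL_le_of_le (f := f) (g := g) zero_le_one fun x => by rw [h, one_mul]
  have h2 := norm_toL_le_of_le (f := g) (g := f) zero_le_one fun x => by rw [h, one_mul]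
  linarith

theorem integrable_norm_mul (f g : 𝓢(Space d, ℂ)) : Integrable (fun x => ‖f x‖ * ‖g x‖) := by
  refine (integrable_mul f g).norm.congr (Filter.Eventually.of_forall fun x => ?_)
  simp

theorem integral_norm_mul_le (f g : 𝓢(Space d, ℂ)) :
    ∫ x, ‖f x‖ * ‖g x‖ ≤ ‖toL f‖ * ‖toL g‖ := by
  have h := integral_mul_norm_le_Lp_mul_Lq (μ := (volume : Measure (Space d))) (f := f) (g := g)
    Real.HolderConjugate.two_two (by simpa using f.memLp 2) (by simpa using g.memLp 2)
  refine h.trans (le_of_eq ?_)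
  congr 1
  · rw [← Real.sqrt_eq_rpow, ← Real.sqrt_sq (norm_nonneg (toL f)), norm_sq_toL]; simp
  · rw [← Real.sqrt_eq_rpow, ← Real.sqrt_sq (norm_nonneg (toL g)), norm_sq_toL]; simp

/-- Integrate ∫|∂f|⁴ = ∫ ∂f · (conj(∂f) |∂f|²) by parts. The derivative of the cubic factor gives
three terms of modulus |∂f|² |∂²f|, whence the 3; then use Cauchy-Schwarz and divide by the norm of
|∂f|². -/
theorem norm_toL_sq_derX_le (i : Fin d) (f : 𝓢(Space d, ℂ)) {M : ℝ} (hM : ∀ x, ‖f x‖ ≤ M) :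
    ‖toL (prodS (derX i f) (conjS (derX i f)))‖ ≤ 3 * M * ‖toL (derX i (derX i f))‖ := by
  have hM0 : 0 ≤ M := (norm_nonneg _).trans (hM 0)
  set F := derX i f with hF
  set Q := prodS F (conjS F) with hQ
  set G := prodS (conjS F) (prodS F (conjS F)) with hG
  have hQx : ∀ x, ‖Q x‖ = ‖F x‖ ^ 2 := fun x => by simp [hQ, sq]
  have h1 : ‖toL Q‖ ^ 2 = ‖∫ x, F x * G x‖ := by
    have : ∀ x, F x * G x = ((‖Q x‖ ^ 2 : ℝ) : ℂ) := by
      intro x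
      have h0 : F x * star (F x) = ((‖F x‖ ^ 2 : ℝ) : ℂ) := by
        have := Complex.mul_conj (F x)
        rw [Complex.normSq_eq_norm_sq] at this
        exact this
      rw [hQx, hG, prodS_apply, prodS_apply, conjS_apply, ← mul_assoc, h0]
      push_cast; ring
    simp_rw [this]
    rw [integral_complex_ofReal, ← norm_sq_toL, Complex.norm_real, Real.norm_eq_abs,
      abs_of_nonneg (by positivity)]
  have h2 : ∀ x, ‖f x * derX i G x‖ ≤ 3 * M * (‖Q x‖ * ‖derX i F x‖) := by
    intro x
    rw [hG, derX_prodS, derX_prodS, derX_conjS]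
    simp only [_root_.add_apply, prodS_apply, conjS_apply]
    rw [norm_mul, hQx]
    calc _ ≤ M * (‖F x‖ ^ 2 * ‖derX i F x‖ + (‖F x‖ ^ 2 * ‖derX i F x‖ +
          ‖F x‖ ^ 2 * ‖derX i F x‖)) := by
          gcongr
          · exact hM x
          · refine (norm_add_le _ _).trans (add_le_add (le_of_eq ?_) ?_)
            · simp; ring
            · rw [norm_mul, norm_star]
              refine (mul_le_mul_of_nonneg_left (norm_add_le _ _) (norm_nonneg _)).trans
                (le_of_eq ?_)
              simp; ring
      _ = _ := by ring
  have h3 : ‖toL Q‖ ^ 2 ≤ 3 * M * (‖toL Q‖ * ‖toL (derX i F)‖) := by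
    rw [h1, hF, integral_derX_mul, norm_neg]
    refine (norm_integral_le_integral_norm _).trans ?_
    calc _ ≤ ∫ x, 3 * M * (‖Q x‖ * ‖derX i F x‖) :=
          integral_mono (integrable_mul f (derX i G)).norm
            ((integrable_norm_mul Q (derX i F)).const_mul _) h2
      _ ≤ _ := by
          rw [integral_const_mul]
          gcongr
          exact integral_norm_mul_le _ _
  rcases (norm_nonneg (toL Q)).eq_or_lt with h0 | h0
  · rw [← h0]; positivity
  · nlinarith

/-- A Gagliardo-Nirenberg inequality. -/
theorem norm_toL_prodS_derX_le (i : Fin d) (f g : 𝓢(Space d, ℂ)) {M N : ℝ}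
    (hf : ∀ x, ‖f x‖ ≤ M) (hg : ∀ x, ‖g x‖ ≤ N)
    (hf2 : ‖toL (derX i (derX i f))‖ ≤ M) (hg2 : ‖toL (derX i (derX i g))‖ ≤ N) :
    ‖toL (prodS (derX i f) (derX i g))‖ ≤ 3 * (M * N) := by
  have hM0 : 0 ≤ M := (norm_nonneg _).trans (hf 0)
  have hN0 : 0 ≤ N := (norm_nonneg _).trans (hg 0)
  refine le_of_sq_le_sq ?_ (by positivity)
  set F := prodS (derX i f) (conjS (derX i f))
  set G := prodS (derX i g) (conjS (derX i g))
  have hF : ‖toL F‖ ≤ 3 * M * M :=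
    (norm_toL_sq_derX_le i f hf).trans (by gcongr)
  have hG : ‖toL G‖ ≤ 3 * N * N :=
    (norm_toL_sq_derX_le i g hg).trans (by gcongr)
  have h1 : ‖toL (prodS (derX i f) (derX i g))‖ ^ 2 = ∫ x, ‖F x‖ * ‖G x‖ := by
    rw [norm_sq_toL]
    refine integral_congr_ae (Filter.Eventually.of_forall fun x => ?_)
    simp [F, G]; ring
  calc _ ≤ ‖toL F‖ * ‖toL G‖ := by rw [h1]; exact integral_norm_mul_le F G
    _ ≤ (3 * M * M) * (3 * N * N) := by gcongr
    _ = _ := by ring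

/-! ### Tame trilinear estimates -/

/-- Bounds of the weighted derivatives of `f` up to order `j`, with a loss of a factor `ν` for each
order above `k₀`. -/
structure Tame (k₀ j : ℕ) (ν M : ℝ) (f : 𝓢(Space d, ℂ)) : Prop where
  nonneg : 0 ≤ M
  norm_le : ∀ (i : Fin d) (a b : ℕ), a + b ≤ j →
    ‖toL ((mulX i)^[a] ((derX i)^[b] f))‖ ≤ M * ν ^ (a + b - k₀)
  sup_le : ∀ (i : Fin d) (b : ℕ), b + k₀ ≤ j → ∀ x, ‖(derX i)^[b] f x‖ ≤ M * ν ^ b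

theorem Tame.conjS {k₀ j : ℕ} {ν M : ℝ} {f : 𝓢(Space d, ℂ)} (h : Tame k₀ j ν M f) :
    Tame k₀ j ν M (conjS f) where
  nonneg := h.nonneg
  norm_le i a b hab := by
    refine (le_of_eq (norm_toL_eq_of_norm_eq fun x => ?_)).trans (h.norm_le i a b hab)
    rw [iterate_mulX_apply, iterate_mulX_apply, iterate_derX_conjS, norm_mul, norm_mul, conjS_apply,
      norm_star]
  sup_le i b hb x := by
    rw [iterate_derX_conjS, conjS_apply, norm_star]
    exact h.sup_le i b hb x

/-- The factor with the most derivatives is taken in L² and the two others in the uniform norm,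
which costs k₀ further derivatives. This exceeds the available order j only if k₀ = 2, a = 0 and two
factors carry exactly one derivative each; the Gagliardo-Nirenberg inequality handles these cases.
The powers of ν add up to at most j - k₀, as if only one factor were of high order. -/
theorem Tame.norm_term_le_of_le {k₀ j : ℕ} {ν Mf Mg Mh : ℝ} {f g h : 𝓢(Space d, ℂ)}
    (hk : k₀ = 1 ∨ k₀ = 2) (hj : k₀ ≤ j) (hν : 1 ≤ ν) (hf : Tame k₀ j ν Mf f)
    (hg : Tame k₀ j ν Mg g) (hh : Tame k₀ j ν Mh h) (i : Fin d) {a n₁ n₂ n₃ : ℕ}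
    (h₂ : n₂ ≤ n₁) (h₃ : n₃ ≤ n₁) (hs : a + n₁ + n₂ + n₃ ≤ j) {P : 𝓢(Space d, ℂ)}
    (hP : ∀ x, P x = (x i : ℂ) ^ a * ((derX i)^[n₁] f x * (derX i)^[n₂] g x * (derX i)^[n₃] h x)) :
    ‖toL P‖ ≤ 3 * (Mf * Mg * Mh * ν ^ (j - k₀)) := by
  have hMf := hf.nonneg
  have hMg := hg.nonneg
  have hMh := hh.nonneg
  have hν0 : 0 < ν := by linarith
  have gn : ∀ {f g : 𝓢(Space d, ℂ)} {Mf Mg : ℝ}, Tame k₀ j ν Mf f → Tame k₀ j ν Mg g → k₀ = 2 →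
      ‖toL (prodS (derX i f) (derX i g))‖ ≤ 3 * (Mf * Mg) := by
    intro f g Mf Mg hf hg hk2
    subst hk2
    refine norm_toL_prodS_derX_le i f g (fun x => ?_) (fun x => ?_) ?_ ?_
    · simpa using hf.sup_le i 0 (by omega) x
    · simpa using hg.sup_le i 0 (by omega) x
    · simpa using hf.norm_le i 0 2 (by omega)
    · simpa using hg.norm_le i 0 2 (by omega)
  by_cases hB : k₀ = 2 ∧ a = 0 ∧ n₁ = 1 ∧ n₂ = 1
  · obtain ⟨hk2, rfl, rfl, rfl⟩ := hB
    have hS := hh.sup_le i n₃ (by omega)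
    calc ‖toL P‖ ≤ (Mh * ν ^ n₃) * ‖toL (prodS (derX i f) (derX i g))‖ := by
          refine norm_toL_le_of_le (by positivity) fun x => ?_
          rw [hP, norm_mul, norm_mul, norm_pow, pow_zero, one_mul, mul_comm]
          gcongr
          · exact hS x
          · simp
      _ ≤ (Mh * ν ^ (j - k₀)) * (3 * (Mf * Mg)) := by
          gcongr
          · omega
          · exact gn hf hg hk2
      _ = _ := by ring
  by_cases hB' : k₀ = 2 ∧ a = 0 ∧ n₁ = 1 ∧ n₃ = 1
  · obtain ⟨hk2, rfl, rfl, rfl⟩ := hB'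
    have hn : n₂ = 0 := by omega
    subst hn
    have hS := hg.sup_le i 0 (by omega)
    calc ‖toL P‖ ≤ (Mg * ν ^ 0) * ‖toL (prodS (derX i f) (derX i h))‖ := by
          refine norm_toL_le_of_le (by positivity) fun x => ?_
          rw [hP, norm_mul, norm_mul, norm_mul, norm_pow, pow_zero, one_mul, prodS_apply, norm_mul]
          calc _ = ‖(derX i)^[0] g x‖ * (‖derX i f x‖ * ‖derX i h x‖) := by simp; ring
            _ ≤ _ := by gcongr; exact hS x
      _ ≤ (Mg * ν ^ (j - k₀)) * (3 * (Mf * Mh)) := by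
          gcongr
          · omega
          · exact gn hf hh hk2
      _ = _ := by ring
  have e2 : n₂ + k₀ ≤ j := by omega
  have e3 : n₃ + k₀ ≤ j := by omega
  have hN := hf.norm_le i a n₁ (by omega)
  calc ‖toL P‖ ≤ (Mg * ν ^ n₂ * (Mh * ν ^ n₃)) * ‖toL ((mulX i)^[a] ((derX i)^[n₁] f))‖ := by
        refine norm_toL_le_of_le (by positivity) fun x => ?_
        rw [hP, iterate_mulX_apply, norm_mul, norm_mul, norm_mul, norm_mul]
        calc _ = ‖(derX i)^[n₂] g x‖ * ‖(derX i)^[n₃] h x‖ *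
              (‖(x i : ℂ) ^ a‖ * ‖(derX i)^[n₁] f x‖) := by ring
          _ ≤ _ := by
            gcongr
            · exact hg.sup_le i n₂ e2 x
            · exact hh.sup_le i n₃ e3 x
    _ ≤ (Mg * ν ^ n₂ * (Mh * ν ^ n₃)) * (Mf * ν ^ (a + n₁ - k₀)) := by gcongr
    _ = Mf * Mg * Mh * ν ^ (n₂ + n₃ + (a + n₁ - k₀)) := by rw [pow_add, pow_add]; ring
    _ ≤ Mf * Mg * Mh * ν ^ (j - k₀) := by
        gcongr
        · omega
    _ ≤ _ := by
        have : 0 ≤ Mf * Mg * Mh * ν ^ (j - k₀) := by positivity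
        linarith

theorem Tame.norm_term_le {k₀ j : ℕ} {ν Mf Mg Mh : ℝ} {f g h : 𝓢(Space d, ℂ)}
    (hk : k₀ = 1 ∨ k₀ = 2) (hj : k₀ ≤ j) (hν : 1 ≤ ν) (hf : Tame k₀ j ν Mf f)
    (hg : Tame k₀ j ν Mg g) (hh : Tame k₀ j ν Mh h) (i : Fin d) {a n₁ n₂ n₃ : ℕ}
    (hs : a + n₁ + n₂ + n₃ ≤ j) :
    ‖toL ((mulX i)^[a] (prodS (prodS ((derX i)^[n₁] f) ((derX i)^[n₂] g)) ((derX i)^[n₃] h)))‖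
      ≤ 3 * (Mf * Mg * Mh * ν ^ (j - k₀)) := by
  rcases le_total n₂ n₁ with h12 | h12
  · rcases le_total n₃ n₁ with h13 | h13
    · exact hf.norm_term_le_of_le hk hj hν hg hh i h12 h13 (by omega) fun x => by
        rw [iterate_mulX_apply]; rfl
    · rw [show Mf * Mg * Mh = Mh * Mf * Mg by ring]
      exact hh.norm_term_le_of_le hk hj hν hf hg i (n₁ := n₃) h13 (h12.trans h13) (a := a)
        (by omega) fun x => by
        rw [iterate_mulX_apply, prodS_apply, prodS_apply]; ring
  · rcases le_total n₃ n₂ with h23 | h23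
    · rw [show Mf * Mg * Mh = Mg * Mf * Mh by ring]
      exact hg.norm_term_le_of_le hk hj hν hf hh i (n₁ := n₂) h12 h23 (a := a)
        (by omega) fun x => by
        rw [iterate_mulX_apply, prodS_apply, prodS_apply]; ring
    · rw [show Mf * Mg * Mh = Mh * Mf * Mg by ring]
      exact hh.norm_term_le_of_le hk hj hν hf hg i (n₁ := n₃) (h12.trans h23) h23 (a := a)
        (by omega) fun x => by
        rw [iterate_mulX_apply, prodS_apply, prodS_apply]; ring

theorem Tame.norm_leibniz_le {k₀ j : ℕ} {ν Mf Mg Mh : ℝ} {f g h : 𝓢(Space d, ℂ)}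
    (hk : k₀ = 1 ∨ k₀ = 2) (hj : k₀ ≤ j) (hν : 1 ≤ ν) (hf : Tame k₀ j ν Mf f)
    (hg : Tame k₀ j ν Mg g) (hh : Tame k₀ j ν Mh h) (i : Fin d) {a : ℕ} (b : ℕ) {n₁ n₂ n₃ : ℕ}
    (hs : a + b + n₁ + n₂ + n₃ ≤ j) :
    ‖toL ((mulX i)^[a] ((derX i)^[b]
      (prodS (prodS ((derX i)^[n₁] f) ((derX i)^[n₂] g)) ((derX i)^[n₃] h))))‖
      ≤ 3 ^ b * (3 * (Mf * Mg * Mh * ν ^ (j - k₀))) := by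
  induction b generalizing n₁ n₂ n₃ with
  | zero =>
    rw [pow_zero, one_mul]
    exact hf.norm_term_le hk hj hν hg hh i (by omega)
  | succ b ih =>
    have e : derX i (prodS (prodS ((derX i)^[n₁] f) ((derX i)^[n₂] g)) ((derX i)^[n₃] h)) =
        prodS (prodS ((derX i)^[n₁ + 1] f) ((derX i)^[n₂] g)) ((derX i)^[n₃] h) +
        prodS (prodS ((derX i)^[n₁] f) ((derX i)^[n₂ + 1] g)) ((derX i)^[n₃] h) +
        prodS (prodS ((derX i)^[n₁] f) ((derX i)^[n₂] g)) ((derX i)^[n₃ + 1] h) := by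
      rw [derX_prodS, derX_prodS]
      simp only [Function.iterate_succ_apply']
      ext x
      simp only [_root_.add_apply, prodS_apply]
      ring
    have hD : ∀ F G : 𝓢(Space d, ℂ), (derX i)^[b] (F + G) = (derX i)^[b] F + (derX i)^[b] G :=
      fun F G => iterate_map_add (derX i) b F G
    have hX : ∀ F G : 𝓢(Space d, ℂ), (mulX i)^[a] (F + G) = (mulX i)^[a] F + (mulX i)^[a] G :=
      fun F G => iterate_map_add (mulX i) a F G
    rw [Function.iterate_succ_apply, e, hD, hD, hX, hX, map_add, map_add]
    refine (norm_add_le _ _).trans ((add_le_add_left (norm_add_le _ _) _).trans ?_)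
    have t1 := ih (n₁ := n₁ + 1) (n₂ := n₂) (n₃ := n₃) (by omega)
    have t2 := ih (n₁ := n₁) (n₂ := n₂ + 1) (n₃ := n₃) (by omega)
    have t3 := ih (n₁ := n₁) (n₂ := n₂) (n₃ := n₃ + 1) (by omega)
    rw [pow_succ]
    linarith

theorem exists_norm_Lam_prod_le [NeZero d] {k₀ j : ℕ} (hk : k₀ = 1 ∨ k₀ = 2) (hj : k₀ ≤ j) :
    ∃ C : ℝ, 0 < C ∧ ∀ (K : ℕ) (ν Mf Mg Mh : ℝ) (f g h : 𝓢(Space d, ℂ)), 1 ≤ ν →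
      Tame k₀ j ν Mf f → Tame k₀ j ν Mg g → Tame k₀ j ν Mh h →
      ‖Lam K j (toL (prodS (prodS f g) h))‖ ≤ C * (Mf * Mg * Mh * ν ^ (j - k₀)) := by
  obtain ⟨C, hC, h⟩ := exists_norm_Lam_le (d := d) j
  refine ⟨C * (3 ^ j * 3), by positivity, fun K ν Mf Mg Mh f g h' hν hf hg hh => ?_⟩
  have hMf := hf.nonneg
  have hMg := hg.nonneg
  have hMh := hh.nonneg
  have h0 : 0 ≤ Mf * Mg * Mh * ν ^ (j - k₀) := by positivity
  rw [mul_assoc C, mul_assoc (3 ^ j)]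
  refine h K _ _ (by positivity) (weakBound_toL fun i a b hab => ?_)
  refine (hf.norm_leibniz_le hk hj hν hg hh i b (n₁ := 0) (n₂ := 0) (n₃ := 0)
    (by omega)).trans ?_
  gcongr
  · norm_num
  · omega

end GP

/-! ### Interpolation between spectral norms and the cubic term on Σ_K. -/

namespace GP

variable {d : ℕ}

theorem norm_Lam_mono [NeZero d] (K : ℕ) {s t : ℕ} (h : s ≤ t) (u : L2 d) :
    ‖Lam K s u‖ ≤ ‖Lam K t u‖ := by
  refine le_of_sq_le_sq ?_ (norm_nonneg _)
  rw [norm_sq_Lam, norm_sq_Lam]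
  refine Finset.sum_le_sum fun m _ => ?_
  gcongr
  · exact one_le_lam m

theorem norm_le_norm_Lam [NeZero d] {K : ℕ} {u : L2 d} (hu : u ∈ SigmaK d K) (s : ℕ) :
    ‖u‖ ≤ ‖Lam K s u‖ := by
  conv_lhs => rw [← Lam_zero_of_mem hu]
  exact norm_Lam_mono K (Nat.zero_le s) u

theorem pow_le_one_add_pow {t : ℝ} (ht : 0 ≤ t) {r R : ℕ} (h : r ≤ R) : t ^ r ≤ 1 + t ^ R := by
  rcases le_total t 1 with h1 | h1
  · linarith [pow_le_one₀ ht h1 (n := r), pow_nonneg ht R]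
  · linarith [pow_le_pow_right₀ h1 h]

/-- On each eigenspace apply t^r ≤ 1 + t^R with t = λ/ν². The parameter ν measures the growth per
order, so interpolated norms are again powers of ν. -/
theorem norm_Lam_interpolate [NeZero d] (K : ℕ) {k r R : ℕ} (h : r ≤ R) {ν M : ℝ} (hν : 0 < ν)
    (hM : 0 ≤ M) {u : L2 d} (h0 : ‖Lam K k u‖ ≤ M) (h1 : ‖Lam K ((k + R : ℕ) : ℤ) u‖ ≤ M * ν ^ R) :
    ‖Lam K ((k + r : ℕ) : ℤ) u‖ ≤ 2 * M * ν ^ r := by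
  refine le_of_sq_le_sq ?_ (by positivity)
  have key : ‖Lam K ((k + r : ℕ) : ℤ) u‖ ^ 2 ≤
      (ν ^ r) ^ 2 * (‖Lam K k u‖ ^ 2 + ‖Lam K ((k + R : ℕ) : ℤ) u‖ ^ 2 / (ν ^ R) ^ 2) := by
    simp only [norm_sq_Lam, zpow_natCast]
    rw [Finset.sum_div, ← Finset.sum_add_distrib, Finset.mul_sum]
    refine Finset.sum_le_sum fun m _ => ?_
    have hl : 0 ≤ lam m := zero_le_one.trans (one_le_lam m)
    have := pow_le_one_add_pow (t := lam m / ν ^ 2) (by positivity) h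
    rw [div_pow, div_pow, div_le_iff₀ (by positivity)] at this
    have e1 : (ν ^ 2) ^ r = (ν ^ r) ^ 2 := by ring
    have e2 : (ν ^ 2) ^ R = (ν ^ R) ^ 2 := by ring
    rw [e1, e2] at this
    have h2 : 0 ≤ lam m ^ k * ‖coef u m‖ ^ 2 := by positivity
    calc lam m ^ (k + r) * ‖coef u m‖ ^ 2 = lam m ^ r * (lam m ^ k * ‖coef u m‖ ^ 2) := by
          rw [pow_add]; ring
      _ ≤ ((1 + lam m ^ R / (ν ^ R) ^ 2) * (ν ^ r) ^ 2) * (lam m ^ k * ‖coef u m‖ ^ 2) := by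
          gcongr
      _ = _ := by rw [pow_add]; ring
  have h2 : ‖Lam K ((k + R : ℕ) : ℤ) u‖ ^ 2 / (ν ^ R) ^ 2 ≤ M ^ 2 := by
    rw [div_le_iff₀ (by positivity), ← mul_pow]; gcongr
  have h3 : ‖Lam K k u‖ ^ 2 ≤ M ^ 2 := by gcongr
  calc _ ≤ (ν ^ r) ^ 2 * (M ^ 2 + M ^ 2) := key.trans (by gcongr)
    _ ≤ _ := by
      rw [mul_pow, mul_pow]
      have : 0 ≤ M ^ 2 * (ν ^ r) ^ 2 := by positivity
      linarith

theorem iterate_mem_hermiteSpan (i : Fin d) (a b : ℕ) {f : 𝓢(Space d, ℂ)}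
    (hf : f ∈ hermiteSpan d) : (mulX i)^[a] ((derX i)^[b] f) ∈ hermiteSpan d := by
  have h : (derX i)^[b] f ∈ hermiteSpan d := by
    induction b with
    | zero => exact hf
    | succ b ih => rw [Function.iterate_succ_apply']; exact derX_mem i ih
  induction a with
  | zero => exact h
  | succ a ih => rw [Function.iterate_succ_apply']; exact mulX_mem i ih

theorem exists_tame [NeZero d] (hd : d ≤ 3) {j : ℕ} (hj : sobolevOrder d ≤ j) :
    ∃ C : ℝ, 0 < C ∧ ∀ (K : ℕ) (f : 𝓢(Space d, ℂ)), f ∈ hermiteSpan d → toL f ∈ SigmaK d K →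
      ∀ ν M : ℝ, 1 ≤ ν → 0 ≤ M → ‖Lam K (sobolevOrder d) (toL f)‖ ≤ M →
        ‖Lam K j (toL f)‖ ≤ M * ν ^ (j - sobolevOrder d) →
        Tame (sobolevOrder d) j ν (C * M) f := by
  set k₀ := sobolevOrder d with hk₀
  choose c hc0 hc using fun (i : Fin d) (a b : ℕ) =>
    ((OrderLE.iterate (orderLE_mulX i) a).comp (OrderLE.iterate (orderLE_derX i) b)).exists_norm_le
      fun f hf => iterate_mem_hermiteSpan i a b hf
  choose c' hc0' hc' using fun (i : Fin d) (b : ℕ) => exists_norm_iterate_derX_apply_le hd i b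
  set C₁ := ∑ i, ∑ a ∈ Finset.range (j + 1), ∑ b ∈ Finset.range (j + 1), c i a b with hC₁
  set C₂ := ∑ i, ∑ b ∈ Finset.range (j + 1), c' i b with hC₂
  have h1 : ∀ i a b, a ≤ j → b ≤ j → c i a b ≤ C₁ := by
    intro i a b ha hb
    calc c i a b ≤ ∑ b ∈ Finset.range (j + 1), c i a b :=
          Finset.single_le_sum (f := fun b => c i a b) (fun b _ => (hc0 i a b).le)
            (Finset.mem_range.2 (by omega))
      _ ≤ ∑ a ∈ Finset.range (j + 1), ∑ b ∈ Finset.range (j + 1), c i a b :=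
          Finset.single_le_sum (f := fun a => ∑ b ∈ Finset.range (j + 1), c i a b)
            (fun a _ => Finset.sum_nonneg fun b _ => (hc0 i a b).le)
            (Finset.mem_range.2 (by omega))
      _ ≤ C₁ := Finset.single_le_sum
            (f := fun i => ∑ a ∈ Finset.range (j + 1), ∑ b ∈ Finset.range (j + 1), c i a b)
            (fun i _ => Finset.sum_nonneg fun a _ => Finset.sum_nonneg fun b _ => (hc0 i a b).le)
            (Finset.mem_univ i)
  have h2 : ∀ i b, b ≤ j → c' i b ≤ C₂ := by
    intro i b hb
    calc c' i b ≤ ∑ b ∈ Finset.range (j + 1), c' i b :=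
          Finset.single_le_sum (f := fun b => c' i b) (fun b _ => (hc0' i b).le)
            (Finset.mem_range.2 (by omega))
      _ ≤ C₂ := Finset.single_le_sum (f := fun i => ∑ b ∈ Finset.range (j + 1), c' i b)
            (fun i _ => Finset.sum_nonneg fun b _ => (hc0' i b).le) (Finset.mem_univ i)
  have hC₁0 : 0 < C₁ := (hc0 0 0 0).trans_le (h1 0 0 0 (by omega) (by omega))
  have hC₂0 : 0 < C₂ := (hc0' 0 0).trans_le (h2 0 0 (by omega))
  refine ⟨2 * (C₁ + C₂), by positivity, fun K f hf hK ν M hν hM hX hY => ?_⟩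
  have hν0 : 0 < ν := by linarith
  have hint : ∀ r, r ≤ j - k₀ → ‖Lam K ((k₀ + r : ℕ) : ℤ) (toL f)‖ ≤ 2 * M * ν ^ r := by
    intro r hr
    refine norm_Lam_interpolate K hr hν0 hM hX ?_
    rwa [Nat.add_sub_cancel' hj]
  refine ⟨by positivity, fun i a b hab => ?_, fun i b hb x => ?_⟩
  · calc _ ≤ c i a b * ‖Lam K ((k₀ + (a + b - k₀) : ℕ) : ℤ) (toL f)‖ :=
          hc i a b K f hf hK _ (by omega)
      _ ≤ (C₁ + C₂) * (2 * M * ν ^ (a + b - k₀)) := by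
          gcongr
          · linarith [h1 i a b (by omega) (by omega)]
          · exact hint _ (by omega)
      _ = _ := by ring
  · calc _ ≤ c' i b * ‖Lam K ((b + k₀ : ℕ) : ℤ) (toL f)‖ := hc' i b K f hf hK x
      _ ≤ (C₁ + C₂) * (2 * M * ν ^ b) := by
          gcongr
          · linarith [h2 i b (by omega)]
          · rw [add_comm b]; exact hint _ (by omega)
      _ = _ := by ring

/-! ### The cubic term on `Σ_K` -/

theorem toL_schw_eq (K : ℕ) (u : L2 d) : toL (schw K u) = projK K u := by
  rw [← toL_schw (projK_mem K u), schw, schw]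
  congr 1
  exact Finset.sum_congr rfl fun m hm => by rw [coef_projK K u hm]

/-- The trilinear map `(u, v, w) ↦ P_K (u \bar v w)`, for functions of `Σ_K`. -/
noncomputable def triK (K : ℕ) (u v w : L2 d) : L2 d :=
  projK K (toL (prodS (prodS (schw K u) (conjS (schw K v))) (schw K w)))

theorem triK_mem (K : ℕ) (u v w : L2 d) : triK K u v w ∈ SigmaK d K := projK_mem _ _

theorem schw_sub (K : ℕ) (u v : L2 d) : schw K (u - v) = schw K u - schw K v := by
  simp only [schw, coef_sub, sub_smul, Finset.sum_sub_distrib]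

theorem triK_sub_left (K : ℕ) (u u' v w : L2 d) :
    triK K (u - u') v w = triK K u v w - triK K u' v w := by
  rw [triK, triK, triK, ← map_sub, ← map_sub]
  congr 2
  ext x
  simp only [schw_sub, prodS_apply, _root_.sub_apply]; ring

theorem triK_sub_right (K : ℕ) (u v w w' : L2 d) :
    triK K u v (w - w') = triK K u v w - triK K u v w' := by
  rw [triK, triK, triK, ← map_sub, ← map_sub]
  congr 2
  ext x
  simp only [schw_sub, prodS_apply, _root_.sub_apply]; ring

theorem triK_sub_mid (K : ℕ) (u v v' w : L2 d) :
    triK K u (v - v') w = triK K u v w - triK K u v' w := by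
  rw [triK, triK, triK, ← map_sub, ← map_sub]
  congr 2
  ext x
  simp only [schw_sub, prodS_apply, _root_.sub_apply, conjS_apply, star_sub]; ring

/-- The tame trilinear estimate. -/
theorem exists_norm_Lam_triK_le [NeZero d] (hd : d ≤ 3) {j : ℕ} (hj : sobolevOrder d ≤ j) :
    ∃ C : ℝ, 0 < C ∧ ∀ (K : ℕ) (u v w : L2 d) (ν Mu Mv Mw : ℝ), 1 ≤ ν →
      0 ≤ Mu → 0 ≤ Mv → 0 ≤ Mw →
      ‖Lam K (sobolevOrder d) u‖ ≤ Mu → ‖Lam K (sobolevOrder d) v‖ ≤ Mv →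
      ‖Lam K (sobolevOrder d) w‖ ≤ Mw → ‖Lam K j u‖ ≤ Mu * ν ^ (j - sobolevOrder d) →
      ‖Lam K j v‖ ≤ Mv * ν ^ (j - sobolevOrder d) → ‖Lam K j w‖ ≤ Mw * ν ^ (j - sobolevOrder d) →
      ‖Lam K j (triK K u v w)‖ ≤ C * (Mu * Mv * Mw * ν ^ (j - sobolevOrder d)) := by
  obtain ⟨C₁, hC₁, h₁⟩ := exists_tame hd hj
  obtain ⟨C₂, hC₂, h₂⟩ := exists_norm_Lam_prod_le (d := d) (sobolevOrder_le_two d) hj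
  refine ⟨C₂ * C₁ ^ 3, by positivity,
    fun K u v w ν Mu Mv Mw hν hMu hMv hMw hXu hXv hXw hYu hYv hYw => ?_⟩
  have ht : ∀ (u : L2 d) (M : ℝ), 0 ≤ M → ‖Lam K (sobolevOrder d) u‖ ≤ M →
      ‖Lam K j u‖ ≤ M * ν ^ (j - sobolevOrder d) →
      Tame (sobolevOrder d) j ν (C₁ * M) (schw K u) := by
    intro u M hM hX hY
    refine h₁ K _ (schw_mem K u) ?_ ν M hν hM ?_ ?_
    · rw [toL_schw_eq]; exact projK_mem K u
    · rwa [toL_schw_eq, Lam_projK]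
    · rwa [toL_schw_eq, Lam_projK]
  rw [triK, Lam_projK]
  refine (h₂ K ν _ _ _ _ _ _ hν (ht u Mu hMu hXu hYu) (ht v Mv hMv hXv hYv).conjS
    (ht w Mw hMw hXw hYw)).trans (le_of_eq ?_)
  ring

theorem exists_norm_Lam_triK_le_mul [NeZero d] (hd : d ≤ 3) {k : ℕ} (hk : sobolevOrder d ≤ k) :
    ∃ C : ℝ, 0 < C ∧ ∀ (K : ℕ) (u v w : L2 d),
      ‖Lam K k (triK K u v w)‖ ≤ C * (‖Lam K k u‖ * ‖Lam K k v‖ * ‖Lam K k w‖) := by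
  obtain ⟨C, hC, h⟩ := exists_norm_Lam_triK_le hd hk
  refine ⟨C, hC, fun K u v w => ?_⟩
  have := h K u v w 1 _ _ _ le_rfl (norm_nonneg _) (norm_nonneg _) (norm_nonneg _)
    (norm_Lam_mono K hk u) (norm_Lam_mono K hk v) (norm_Lam_mono K hk w) (by simp) (by simp)
    (by simp)
  simpa using this

/-- Elements of Σ_K are Schwartz functions, so the integrability test in `cubic` succeeds. Writing
|u|² as u times its conjugate then expands the cubic into four trilinear terms. -/
theorem projK_cubic {K : ℕ} {u v : L2 d} (hu : u ∈ SigmaK d K) (hv : v ∈ SigmaK d K) :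
    projK K (cubic u v) =
      (1 / 4 : ℂ) • (triK K u u u + triK K u u v + triK K v v u + triK K v v v) := by
  set f := schw K u with hf
  set g := schw K v with hg
  set F : 𝓢(Space d, ℂ) := (1 / 4 : ℂ) • (prodS (prodS f (conjS f)) f + prodS (prodS f (conjS f)) g
    + prodS (prodS g (conjS g)) f + prodS (prodS g (conjS g)) g) with hF
  have hfu : (u : Space d → ℂ) =ᵐ[volume] f := by
    conv_lhs => rw [← toL_schw hu]
    exact SchwartzMap.coeFn_toLp _ _ _
  have hgv : (v : Space d → ℂ) =ᵐ[volume] g := by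
    conv_lhs => rw [← toL_schw hv]
    exact SchwartzMap.coeFn_toLp _ _ _
  have hae : (fun x => (((‖u x‖ ^ 2 + ‖v x‖ ^ 2) / 2 : ℝ) : ℂ) * ((u x + v x) / 2))
      =ᵐ[volume] F := by
    filter_upwards [hfu, hgv] with x h1 h2
    have e : ∀ z : ℂ, ((‖z‖ : ℝ) : ℂ) ^ 2 = z * star z := fun z => by
      have := Complex.mul_conj z
      rw [Complex.normSq_eq_norm_sq] at this
      rw [← Complex.ofReal_pow]; exact this.symm
    rw [h1, h2, hF]
    simp only [_root_.smul_apply, _root_.add_apply, prodS_apply, conjS_apply, smul_eq_mul]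
    push_cast
    rw [e, e]
    ring
  have hm : MemLp (fun x => (((‖u x‖ ^ 2 + ‖v x‖ ^ 2) / 2 : ℝ) : ℂ) * ((u x + v x) / 2)) 2
      (volume : Measure (Space d)) := (memLp_congr_ae hae).2 (F.memLp 2)
  have hc : cubic u v = toL F := by
    rw [cubic, dif_pos hm]
    exact (MemLp.toLp_eq_toLp_iff hm (F.memLp 2)).2 hae
  rw [hc, hF, map_smul, map_smul, map_add, map_add, map_add, map_add, map_add, map_add]
  rfl

end GP

namespace GP

variable {d : ℕ}

/-! ### The cutoff -/

theorem IsCutoff.exists_bound {θ : ℝ → ℝ} (hθ : IsCutoff θ) :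
    ∃ C : ℝ, 0 < C ∧ ∀ x, 0 ≤ x → |θ x| ≤ C := by
  obtain ⟨C, hC⟩ := (isCompact_Icc (a := (0 : ℝ)) (b := 2)).exists_bound_of_continuousOn
    (hθ.smooth.continuousOn.mono Icc_subset_Ici_self)
  refine ⟨|C| + 1, by positivity, fun x hx => ?_⟩
  rcases le_or_gt x 2 with h | h
  · have := hC x ⟨hx, h⟩
    rw [Real.norm_eq_abs] at this
    linarith [le_abs_self C]
  · rw [hθ.eq_zero x h, abs_zero]; positivity

theorem IsCutoff.exists_lipschitz_Icc {θ : ℝ → ℝ} (hθ : IsCutoff θ) :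
    ∃ C : ℝ, 0 < C ∧ ∀ x ∈ Icc (0 : ℝ) 3, ∀ y ∈ Icc (0 : ℝ) 3, |θ x - θ y| ≤ C * |x - y| := by
  have hs := hθ.smooth.mono (show Icc (0 : ℝ) 3 ⊆ Ici 0 from Icc_subset_Ici_self)
  have hu : UniqueDiffOn ℝ (Icc (0 : ℝ) 3) := uniqueDiffOn_Icc (by norm_num)
  obtain ⟨C, hC⟩ := (isCompact_Icc (a := (0 : ℝ)) (b := 3)).exists_bound_of_continuousOn
    (hs.continuousOn_derivWithin hu (by simp))
  refine ⟨|C| + 1, by positivity, fun x hx y hy => ?_⟩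
  exact Convex.norm_image_sub_le_of_norm_derivWithin_le (hs.differentiableOn (by simp))
    (fun z hz => (hC z hz).trans (by linarith [le_abs_self C])) (convex_Icc _ _) hy hx

theorem IsCutoff.exists_lipschitz_sq {θ : ℝ → ℝ} (hθ : IsCutoff θ) {L : ℕ} (hL : 1 ≤ L) :
    ∃ C : ℝ, 0 < C ∧ ∀ r s : ℝ, 0 ≤ r → 0 ≤ s → |θ (r ^ 2 / L) - θ (s ^ 2 / L)| ≤ C * |r - s| := by
  obtain ⟨C, hC, h⟩ := hθ.exists_lipschitz_Icc
  have hL0 : (0 : ℝ) < L := by exact_mod_cast hL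
  -- Truncating r at √(3L) changes nothing, as the cutoff already vanishes beyond √(2L). On the
  -- truncated range r² is Lipschitz.
  set ρ : ℝ := Real.sqrt (3 * L) with hρ
  have hρ0 : 0 < ρ := Real.sqrt_pos.2 (by positivity)
  have hρ2 : ρ ^ 2 = 3 * L := Real.sq_sqrt (by positivity)
  have hmin : ∀ r : ℝ, 0 ≤ r → θ (r ^ 2 / L) = θ (min r ρ ^ 2 / L) := by
    intro r hr
    rcases le_total r ρ with h1 | h1
    · rw [min_eq_left h1]
    · rw [min_eq_right h1, hρ2, hθ.eq_zero, hθ.eq_zero]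
      · rw [lt_div_iff₀ hL0]; linarith
      · rw [lt_div_iff₀ hL0]; nlinarith
  refine ⟨C * (2 * ρ / L), by positivity, fun r s hr hs => ?_⟩
  rw [hmin r hr, hmin s hs]
  have hr' : 0 ≤ min r ρ := le_min hr hρ0.le
  have hs' : 0 ≤ min s ρ := le_min hs hρ0.le
  have hI : ∀ t : ℝ, 0 ≤ t → t ≤ ρ → t ^ 2 / L ∈ Icc (0 : ℝ) 3 := by
    intro t ht htρ
    refine ⟨by positivity, ?_⟩
    rw [div_le_iff₀ hL0, ← hρ2]
    gcongr
  have habs : |min r ρ - min s ρ| ≤ |r - s| := by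
    have := abs_min_sub_min_le_max r ρ s ρ
    simpa using this
  calc _ ≤ C * |min r ρ ^ 2 / L - min s ρ ^ 2 / L| :=
        h _ (hI _ hr' (min_le_right _ _)) _ (hI _ hs' (min_le_right _ _))
    _ = C * ((min r ρ + min s ρ) / L * |min r ρ - min s ρ|) := by
        rw [← sub_div, sq_sub_sq, mul_div_right_comm, abs_mul, abs_of_nonneg (by positivity)]
    _ ≤ C * (2 * ρ / L * |r - s|) := by
        gcongr
        linarith [min_le_right r ρ, min_le_right s ρ]
    _ = _ := by ring

theorem weightedDerivS_sub (α β : Fin d → ℕ) (f g : 𝓢(Space d, ℂ)) :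
    weightedDerivS α β (f - g) = weightedDerivS α β f - weightedDerivS α β g := by
  have h : ∀ (T : Fin d → 𝓢(Space d, ℂ) →L[ℂ] 𝓢(Space d, ℂ)) (γ : Fin d → ℕ) (l : List (Fin d))
      (f g : 𝓢(Space d, ℂ)), l.foldr (fun i g => (T i)^[γ i] g) (f - g) =
        l.foldr (fun i g => (T i)^[γ i] g) f - l.foldr (fun i g => (T i)^[γ i] g) g := by
    intro T γ l f g
    induction l with
    | nil => rfl
    | cons i l ih => rw [List.foldr_cons, List.foldr_cons, List.foldr_cons, ih, iterate_map_sub]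
  rw [weightedDerivS, h derX, h mulX]; rfl

/-- `sigmaNorm` is built from chosen representatives and is not a norm by construction. On Σ_K it is
the norm of a vector of weighted derivatives, additive in u, in a finite Hilbert sum. -/
theorem abs_sigmaNorm_sub_le (k : ℕ) {K : ℕ} {u v : L2 d} (hu : u ∈ SigmaK d K)
    (hv : v ∈ SigmaK d K) : |sigmaNorm k u - sigmaNorm k v| ≤ sigmaNorm k (u - v) := by
  set a : L2 d → PiLp 2 (fun _ : indexPairs d k => L2 d) := fun u =>
    WithLp.toLp 2 fun p => toL (weightedDerivS p.1.1 p.1.2 (schw K u)) with ha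
  have h : ∀ w ∈ SigmaK d K, sigmaNorm k w = ‖a w‖ := by
    intro w hw
    conv_lhs => rw [← toL_schw hw]
    rw [sigmaNorm_toL, PiLp.norm_eq_of_L2, ← Finset.sum_coe_sort]
  rw [h u hu, h v hv, h _ (Submodule.sub_mem _ hu hv)]
  have : a (u - v) = a u - a v := by
    ext1 p
    simp only [ha, schw_sub, weightedDerivS_sub, map_sub]
    rfl
  rw [this]
  exact abs_norm_sub_norm_le _ _

/-! ### The truncated nonlinearity on `Σ_K` -/

/-- `P_K (½ (|u|² + |v|²) (u + v) / 2)` for `u, v ∈ Σ_K`. -/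
noncomputable def cubK (K : ℕ) (u v : L2 d) : L2 d :=
  (1 / 4 : ℂ) • (triK K u u u + triK K u u v + triK K v v u + triK K v v v)

/-- The value of the cutoff at `u`. -/
noncomputable def cut (θ : ℝ → ℝ) (k L : ℕ) (u : L2 d) : ℝ := θ (sigmaNorm k u ^ 2 / L)

/-- The projection of the truncated nonlinearity. -/
noncomputable def nonK (θ : ℝ → ℝ) (k L K : ℕ) (u v : L2 d) : L2 d :=
  ((cut θ k L u * cut θ k L v : ℝ) : ℂ) • cubK K u v

theorem projK_nonlin {θ : ℝ → ℝ} {k L K : ℕ} {u v : L2 d} (hu : u ∈ SigmaK d K)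
    (hv : v ∈ SigmaK d K) : projK K (nonlin θ k L u v) = nonK θ k L K u v := by
  rw [nonlin, map_smul, projK_cubic hu hv]; rfl

theorem nonK_mem (θ : ℝ → ℝ) (k L K : ℕ) (u v : L2 d) : nonK θ k L K u v ∈ SigmaK d K := by
  refine Submodule.smul_mem _ _ (Submodule.smul_mem _ _ ?_)
  exact Submodule.add_mem _ (Submodule.add_mem _ (Submodule.add_mem _ (triK_mem _ _ _ _)
    (triK_mem _ _ _ _)) (triK_mem _ _ _ _)) (triK_mem _ _ _ _)

theorem nonK_comm (θ : ℝ → ℝ) (k L K : ℕ) (u v : L2 d) :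
    nonK θ k L K u v = nonK θ k L K v u := by
  rw [nonK, nonK, mul_comm, cubK, cubK]
  congr 2
  abel

theorem sigmaNorm_nonneg (k : ℕ) (u : L2 d) : 0 ≤ sigmaNorm k u := Real.sqrt_nonneg _

theorem exists_norm_Lam_le_sigmaNorm [NeZero d] (k : ℕ) : ∃ C : ℝ, 0 < C ∧
    ∀ (K : ℕ) (u : L2 d), MemSigma k u → ‖Lam K k u‖ ≤ C * sigmaNorm k u := by
  obtain ⟨C, hC, h⟩ := exists_norm_Lam_le (d := d) k
  exact ⟨C, hC, fun K u hu => h K u _ (sigmaNorm_nonneg k u) (weakBound_of_memSigma hu)⟩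

theorem exists_norm_Lam_le_of_cut_ne_zero [NeZero d] {θ : ℝ → ℝ} (hθ : IsCutoff θ) (k : ℕ) {L : ℕ}
    (hL : 1 ≤ L) : ∃ M : ℝ, 0 < M ∧ ∀ (K : ℕ) (u : L2 d), u ∈ SigmaK d K → cut θ k L u ≠ 0 →
      ‖Lam K k u‖ ≤ M := by
  obtain ⟨C, hC, h⟩ := exists_norm_Lam_le_sigmaNorm (d := d) k
  have hL0 : (0 : ℝ) < L := by exact_mod_cast hL
  refine ⟨C * Real.sqrt (2 * L), by positivity, fun K u hu hcut => ?_⟩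
  refine (h K u (memSigma_of_mem hu k)).trans ?_
  gcongr
  refine Real.le_sqrt_of_sq_le ?_
  by_contra! hc
  exact hcut (hθ.eq_zero _ (by rw [lt_div_iff₀ hL0]; exact hc))

theorem abs_cut_le {θ : ℝ → ℝ} {C : ℝ} (h : ∀ x, 0 ≤ x → |θ x| ≤ C) (k L : ℕ) (u : L2 d) :
    |cut θ k L u| ≤ C := h _ (by positivity)

theorem norm_Lam_cubK_le {K : ℕ} {s : ℤ} {A : ℝ} {u v : L2 d}
    (h : ∀ a b c : L2 d, (a = u ∨ a = v) → (b = u ∨ b = v) → (c = u ∨ c = v) →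
      ‖Lam K s (triK K a b c)‖ ≤ A) : ‖Lam K s (cubK K u v)‖ ≤ A := by
  rw [cubK, map_smul, norm_smul, map_add, map_add, map_add]
  have h1 := h u u u (.inl rfl) (.inl rfl) (.inl rfl)
  have h2 := h u u v (.inl rfl) (.inl rfl) (.inr rfl)
  have h3 := h v v u (.inr rfl) (.inr rfl) (.inl rfl)
  have h4 := h v v v (.inr rfl) (.inr rfl) (.inr rfl)
  have := norm_add₄_le (a := Lam K s (triK K u u u)) (b := Lam K s (triK K u u v))
    (c := Lam K s (triK K v v u)) (d := Lam K s (triK K v v v))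
  norm_num
  linarith

/-- Unless the nonlinearity vanishes, both cutoffs force the Σ^k norms below a constant M. The tame
estimate then leaves only one factor in the Σ^j norm, so a cubic expression grows linearly. -/
theorem exists_norm_Lam_nonK_le [NeZero d] (hd : d ≤ 3) {θ : ℝ → ℝ} (hθ : IsCutoff θ) {k j L : ℕ}
    (hL : 1 ≤ L) (hk : sobolevOrder d ≤ k) (hkj : k ≤ j) : ∃ C : ℝ, 0 < C ∧
    ∀ (K : ℕ) (u v : L2 d), u ∈ SigmaK d K → v ∈ SigmaK d K →
      ‖Lam K j (nonK θ k L K u v)‖ ≤ C * max ‖Lam K j u‖ ‖Lam K j v‖ := by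
  obtain ⟨Cθ, hCθ, hb⟩ := hθ.exists_bound
  obtain ⟨M, hM, hcut⟩ := exists_norm_Lam_le_of_cut_ne_zero (d := d) hθ k hL
  obtain ⟨C, hC, h⟩ := exists_norm_Lam_triK_le hd (hk.trans hkj)
  refine ⟨Cθ ^ 2 * (C * M ^ 2), by positivity, fun K u v hu hv => ?_⟩
  set Y := max ‖Lam K j u‖ ‖Lam K j v‖ with hY
  have hYu : ‖Lam K j u‖ ≤ Y := le_max_left _ _
  have hYv : ‖Lam K j v‖ ≤ Y := le_max_right _ _
  have hY0 : 0 ≤ Y := (norm_nonneg _).trans hYu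
  by_cases hz : cut θ k L u = 0 ∨ cut θ k L v = 0
  · have : nonK θ k L K u v = 0 := by
      rcases hz with hz | hz <;> simp [nonK, hz]
    rw [this, map_zero, norm_zero]; positivity
  push Not at hz
  have hXu : ‖Lam K (sobolevOrder d) u‖ ≤ M := (norm_Lam_mono K hk u).trans (hcut K u hu hz.1)
  have hXv : ‖Lam K (sobolevOrder d) v‖ ≤ M := (norm_Lam_mono K hk v).trans (hcut K v hv hz.2)
  have hcub : ‖Lam K j (cubK K u v)‖ ≤ C * M ^ 2 * Y := by
    refine norm_Lam_cubK_le fun a b c ha hb hc => ?_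
    have hY3 : ∀ a, (a = u ∨ a = v) → ‖Lam K j a‖ ≤ Y := by
      rintro a (rfl | rfl); exacts [hYu, hYv]
    have hX3 : ∀ a, (a = u ∨ a = v) → ‖Lam K (sobolevOrder d) a‖ ≤ M := by
      rintro a (rfl | rfl); exacts [hXu, hXv]
    -- If Y ≤ M, the plain cubic bound Y³ ≤ M² Y suffices, with ν = 1. Otherwise the tame estimate
    -- is needed with some ν > 1.
    rcases le_or_gt Y M with hYM | hYM
    · have := h K a b c 1 Y Y Y le_rfl hY0 hY0 hY0
        ((norm_Lam_mono K (hk.trans hkj) a).trans (hY3 a ha))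
        ((norm_Lam_mono K (hk.trans hkj) b).trans (hY3 b hb))
        ((norm_Lam_mono K (hk.trans hkj) c).trans (hY3 c hc))
        (by simpa using hY3 a ha) (by simpa using hY3 b hb) (by simpa using hY3 c hc)
      refine this.trans ?_
      rw [one_pow, mul_one, mul_assoc C]
      gcongr
      nlinarith
    · have hR : j - sobolevOrder d ≠ 0 := by
        intro h0
        have hjk : j = sobolevOrder d := by omega
        have : Y ≤ M := by
          rw [hY, hjk]; exact max_le hXu hXv
        linarith
      have hYM1 : 1 ≤ Y / M := by rw [le_div_iff₀ hM]; linarith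
      -- This is the value for which M ν^{j - k₀} = Y, so that M and Y serve as the low and the high
      -- bounds for both arguments.
      set ν : ℝ := (Y / M) ^ ((j - sobolevOrder d : ℕ) : ℝ)⁻¹ with hν
      have hν1 : 1 ≤ ν := Real.one_le_rpow hYM1 (by positivity)
      have hνR : ν ^ (j - sobolevOrder d) = Y / M :=
        Real.rpow_inv_natCast_pow (by positivity) hR
      have hMν : M * ν ^ (j - sobolevOrder d) = Y := by rw [hνR]; field_simp
      have := h K a b c ν M M M hν1 hM.le hM.le hM.le (hX3 a ha) (hX3 b hb) (hX3 c hc)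
        (by rw [hMν]; exact hY3 a ha) (by rw [hMν]; exact hY3 b hb) (by rw [hMν]; exact hY3 c hc)
      refine this.trans (le_of_eq ?_)
      rw [mul_assoc (M * M), hMν]; ring
  rw [nonK, map_smul, norm_smul, Complex.norm_real, Real.norm_eq_abs, abs_mul]
  calc _ ≤ (Cθ * Cθ) * (C * M ^ 2 * Y) := by
        gcongr
        · exact abs_cut_le hb k L u
        · exact abs_cut_le hb k L v
    _ = _ := by ring

theorem exists_norm_Lam_cubK_sub_le [NeZero d] (hd : d ≤ 3) {k : ℕ} (hk : sobolevOrder d ≤ k) :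
    ∃ C : ℝ, 0 < C ∧ ∀ (K : ℕ) (M : ℝ) (u v v' : L2 d), ‖Lam K k u‖ ≤ M → ‖Lam K k v‖ ≤ M →
      ‖Lam K k v'‖ ≤ M →
      ‖Lam K k (cubK K u v - cubK K u v')‖ ≤ C * M ^ 2 * ‖Lam K k (v - v')‖ := by
  obtain ⟨C, hC, h⟩ := exists_norm_Lam_triK_le_mul hd hk
  refine ⟨2 * C, by positivity, fun K M u v v' hu hv hv' => ?_⟩
  have hM : 0 ≤ M := (norm_nonneg _).trans hu
  set w := v - v' with hw
  -- Telescoping gives six trilinear terms, each with one factor w. The factor 6/4 is at most the 2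
  -- of the constant.
  have e : cubK K u v - cubK K u v' = (1 / 4 : ℂ) • (triK K u u w + (triK K w v u + triK K v' w u)
      + (triK K w v v + triK K v' w v + triK K v' v' w)) := by
    rw [cubK, cubK, ← smul_sub, hw]
    simp only [triK_sub_left, triK_sub_mid, triK_sub_right]
    congr 1
    abel
  have b1 : ∀ a b : L2 d, ‖Lam K k a‖ ≤ M → ‖Lam K k b‖ ≤ M →
      ‖Lam K k (triK K a b w)‖ ≤ C * (M * M * ‖Lam K k w‖) := fun a b ha hb =>
    (h K a b w).trans (by gcongr)
  have b2 : ∀ a b : L2 d, ‖Lam K k a‖ ≤ M → ‖Lam K k b‖ ≤ M →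
      ‖Lam K k (triK K a w b)‖ ≤ C * (M * M * ‖Lam K k w‖) := fun a b ha hb =>
    (h K a w b).trans (by
      rw [mul_right_comm]
      gcongr)
  have b3 : ∀ a b : L2 d, ‖Lam K k a‖ ≤ M → ‖Lam K k b‖ ≤ M →
      ‖Lam K k (triK K w a b)‖ ≤ C * (M * M * ‖Lam K k w‖) := fun a b ha hb =>
    (h K w a b).trans (by
      rw [mul_comm ‖Lam K k w‖, mul_right_comm]
      gcongr)
  rw [e, map_smul, norm_smul]
  simp only [map_add]
  have t1 := b1 u u hu hu
  have t2 := b3 v u hv hu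
  have t3 := b2 v' u hv' hu
  have t4 := b3 v v hv hv
  have t5 := b2 v' v hv' hv
  have t6 := b1 v' v' hv' hv'
  set A := C * (M * M * ‖Lam K k w‖) with hA
  have hA0 : 0 ≤ A := by positivity
  have n1 := norm_add₃_le (a := Lam K k (triK K u u w))
    (b := Lam K k (triK K w v u) + Lam K k (triK K v' w u))
    (c := Lam K k (triK K w v v) + Lam K k (triK K v' w v) + Lam K k (triK K v' v' w))
  have n2 := norm_add_le (Lam K k (triK K w v u)) (Lam K k (triK K v' w u))
  have n3 := norm_add₃_le (a := Lam K k (triK K w v v)) (b := Lam K k (triK K v' w v))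
    (c := Lam K k (triK K v' v' w))
  have : 2 * C * M ^ 2 * ‖Lam K k w‖ = 2 * A := by rw [hA]; ring
  rw [this]
  norm_num
  linarith

theorem nonK_sub_right (θ : ℝ → ℝ) (k L K : ℕ) (u v v' : L2 d) :
    nonK θ k L K u v - nonK θ k L K u v' =
      ((cut θ k L u : ℝ) : ℂ) • ((cut θ k L v - cut θ k L v' : ℝ) : ℂ) • cubK K u v +
      ((cut θ k L u : ℝ) : ℂ) • ((cut θ k L v' : ℝ) : ℂ) • (cubK K u v - cubK K u v') := by
  rw [nonK, nonK]
  push_cast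
  module

theorem norm_map_smul_add_smul_le {E : Type*} [NormedAddCommGroup E] [NormedSpace ℂ E]
    (T : E →L[ℂ] E) (a b c : ℝ) (x y : E) :
    ‖T ((a : ℂ) • (b : ℂ) • x + (a : ℂ) • (c : ℂ) • y)‖ ≤
      |a| * (|b| * ‖T x‖) + |a| * (|c| * ‖T y‖) := by
  rw [map_add, map_smul, map_smul, map_smul, map_smul]
  refine (norm_add_le _ _).trans (le_of_eq ?_)
  simp only [norm_smul, Complex.norm_real, Real.norm_eq_abs]

theorem exists_abs_cut_sub_le [NeZero d] {θ : ℝ → ℝ} (hθ : IsCutoff θ) (k : ℕ) {L : ℕ}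
    (hL : 1 ≤ L) : ∃ C : ℝ, 0 < C ∧ ∀ (K : ℕ) (v v' : L2 d), v ∈ SigmaK d K → v' ∈ SigmaK d K →
      |cut θ k L v - cut θ k L v'| ≤ C * ‖Lam K k (v - v')‖ := by
  obtain ⟨Cl, hCl, hlip⟩ := hθ.exists_lipschitz_sq hL
  obtain ⟨C₃, hC₃, h₃⟩ := exists_sigmaNorm_le (d := d) k
  refine ⟨Cl * C₃, by positivity, fun K v v' hv hv' => ?_⟩
  calc _ ≤ Cl * |sigmaNorm k v - sigmaNorm k v'| :=
        hlip _ _ (sigmaNorm_nonneg _ _) (sigmaNorm_nonneg _ _)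
    _ ≤ Cl * (C₃ * ‖Lam K k (v - v')‖) := by
        gcongr
        exact (abs_sigmaNorm_sub_le k hv hv').trans (h₃ K _ (Submodule.sub_mem _ hv hv'))
    _ = _ := by ring

/-- If both cutoffs at v and v' vanish there is nothing to prove, and by symmetry one may assume
that the one at v does not. Then v is bounded in Σ^k, and the difference of the cutoffs is
multiplied by a cubic of bounded functions. The difference of the cubics carries the cutoff at v',
so v' may be assumed bounded there. -/
theorem exists_norm_Lam_nonK_sub_right_le [NeZero d] (hd : d ≤ 3) {θ : ℝ → ℝ} (hθ : IsCutoff θ)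
    {k L : ℕ} (hL : 1 ≤ L) (hk : sobolevOrder d ≤ k) : ∃ C : ℝ, 0 < C ∧
    ∀ (K : ℕ) (u v v' : L2 d), u ∈ SigmaK d K → v ∈ SigmaK d K → v' ∈ SigmaK d K →
      ‖Lam K k (nonK θ k L K u v - nonK θ k L K u v')‖ ≤ C * ‖Lam K k (v - v')‖ := by
  obtain ⟨Cθ, hCθ, hb⟩ := hθ.exists_bound
  obtain ⟨Cl, hCl, hcutlip⟩ := exists_abs_cut_sub_le (d := d) hθ k hL
  obtain ⟨M, hM, hcut⟩ := exists_norm_Lam_le_of_cut_ne_zero (d := d) hθ k hL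
  obtain ⟨C₁, hC₁, h₁⟩ := exists_norm_Lam_triK_le_mul hd hk
  obtain ⟨C₂, hC₂, h₂⟩ := exists_norm_Lam_cubK_sub_le hd hk
  refine ⟨Cθ * (Cl * (C₁ * M ^ 3)) + Cθ * (Cθ * (C₂ * M ^ 2)), by positivity, ?_⟩
  have main : ∀ (K : ℕ) (u v v' : L2 d), u ∈ SigmaK d K → v ∈ SigmaK d K → v' ∈ SigmaK d K →
      cut θ k L v ≠ 0 → ‖Lam K k (nonK θ k L K u v - nonK θ k L K u v')‖ ≤
        (Cθ * (Cl * (C₁ * M ^ 3)) + Cθ * (Cθ * (C₂ * M ^ 2))) * ‖Lam K k (v - v')‖ := by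
    intro K u v v' hu hv hv' hcv
    by_cases hcu : cut θ k L u = 0
    · simp only [nonK, hcu, zero_mul, Complex.ofReal_zero, zero_smul, sub_zero, map_zero, norm_zero]
      positivity
    have hXu := hcut K u hu hcu
    have hXv := hcut K v hv hcv
    rw [nonK_sub_right, add_mul]
    refine (norm_map_smul_add_smul_le _ _ _ _ _ _).trans (add_le_add ?_ ?_)
    · have hcub : ‖Lam K k (cubK K u v)‖ ≤ C₁ * M ^ 3 := by
        refine norm_Lam_cubK_le fun a b c ha hb hc => (h₁ K a b c).trans ?_
        have hX3 : ∀ a, (a = u ∨ a = v) → ‖Lam K k a‖ ≤ M := by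
          rintro a (rfl | rfl); exacts [hXu, hXv]
        have h1 := hX3 a ha
        have h2 := hX3 b hb
        have h3 := hX3 c hc
        rw [show M ^ 3 = M * M * M by ring]
        gcongr
      have hu1 := abs_cut_le hb k L u
      refine (mul_le_mul hu1 (mul_le_mul (hcutlip K v v' hv hv') hcub (norm_nonneg _)
        (mul_nonneg hCl.le (norm_nonneg _)))
        (mul_nonneg (abs_nonneg _) (norm_nonneg _)) hCθ.le).trans (le_of_eq ?_)
      ring
    · by_cases hcv' : cut θ k L v' = 0
      · rw [hcv']; simp only [abs_zero, zero_mul, mul_zero]; positivity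
      have hsub := h₂ K M u v v' hXu hXv (hcut K v' hv' hcv')
      have hu1 := abs_cut_le hb k L u
      have hv1 := abs_cut_le hb k L v'
      refine (mul_le_mul hu1 (mul_le_mul hv1 hsub (norm_nonneg _) hCθ.le)
        (mul_nonneg (abs_nonneg _) (norm_nonneg _)) hCθ.le).trans (le_of_eq ?_)
      ring
  intro K u v v' hu hv hv'
  by_cases hcv : cut θ k L v = 0
  · by_cases hcv' : cut θ k L v' = 0
    · simp only [nonK, hcv, hcv', mul_zero, Complex.ofReal_zero, zero_smul, sub_zero, map_zero,
        norm_zero]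
      positivity
    · have := main K u v' v hu hv' hv hcv'
      rwa [map_sub, map_sub, norm_sub_rev, norm_sub_rev (Lam K k v'), ← map_sub, ← map_sub] at this
  · exact main K u v v' hu hv hv' hcv

theorem exists_norm_Lam_nonK_sub_le [NeZero d] (hd : d ≤ 3) {θ : ℝ → ℝ} (hθ : IsCutoff θ)
    {k L : ℕ} (hL : 1 ≤ L) (hk : sobolevOrder d ≤ k) : ∃ C : ℝ, 0 < C ∧
    ∀ (K : ℕ) (u u' v v' : L2 d), u ∈ SigmaK d K → u' ∈ SigmaK d K → v ∈ SigmaK d K →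
      v' ∈ SigmaK d K → ‖Lam K k (nonK θ k L K u v - nonK θ k L K u' v')‖ ≤
        C * (‖Lam K k (u - u')‖ + ‖Lam K k (v - v')‖) := by
  obtain ⟨C, hC, h⟩ := exists_norm_Lam_nonK_sub_right_le hd hθ hL hk
  refine ⟨C, hC, fun K u u' v v' hu hu' hv hv' => ?_⟩
  have e : nonK θ k L K u v - nonK θ k L K u' v' = (nonK θ k L K v u - nonK θ k L K v u') +
      (nonK θ k L K u' v - nonK θ k L K u' v') := by
    rw [nonK_comm θ k L K v u, nonK_comm θ k L K v u']; abel
  rw [e, map_add, mul_add]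
  exact (norm_add_le _ _).trans (add_le_add (h K v u u' hv hu hu') (h K u' v v' hu' hv hv'))

end GP

namespace GP

variable {d : ℕ}

/-! ### Energy identities for symmetric operators -/

section Abstract

variable {E : Type*} [NormedAddCommGroup E] [InnerProductSpace ℂ E]

theorem re_inner_I_smul_right (x y : E) : (inner ℂ x (Complex.I • y)).re = -(inner ℂ x y).im := by
  rw [inner_smul_right]; simp

theorem im_inner_I_smul_left (x y : E) : (inner ℂ (Complex.I • x) y).im = -(inner ℂ x y).re := by
  rw [inner_smul_left]; simp

theorem re_inner_ofReal_smul_right (a : ℝ) (x y : E) :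
    (inner ℂ x ((a : ℂ) • y)).re = a * (inner ℂ x y).re := by
  rw [inner_smul_right]; simp

theorem im_inner_ofReal_smul_right (a : ℝ) (x y : E) :
    (inner ℂ x ((a : ℂ) • y)).im = a * (inner ℂ x y).im := by
  rw [inner_smul_right]; simp

theorem re_inner_ofReal_smul_left (a : ℝ) (x y : E) :
    (inner ℂ ((a : ℂ) • x) y).re = a * (inner ℂ x y).re := by
  rw [inner_smul_left]; simp

theorem re_inner_comm (x y : E) : (inner ℂ x y).re = (inner ℂ y x).re := by
  rw [← inner_conj_symm, Complex.conj_re]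

theorem im_inner_comm (x y : E) : (inner ℂ x y).im = -(inner ℂ y x).im := by
  rw [← inner_conj_symm, Complex.conj_im]

variable {S A B : E →L[ℂ] E}

theorem re_inner_sub_eq (hS : ∀ x y, inner ℂ (S x) y = inner ℂ x (S y)) (u v : E) :
    (inner ℂ (S v) v).re - (inner ℂ (S u) u).re = (inner ℂ (S (u + v)) (v - u)).re := by
  rw [map_add, inner_add_left, inner_sub_right, inner_sub_right]
  have : (inner ℂ (S u) v).re = (inner ℂ (S v) u).re := by
    rw [hS u v, re_inner_comm]
  simp only [Complex.add_re, Complex.sub_re]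
  linarith

theorem im_inner_comm_eq (hS : ∀ x y, inner ℂ (S x) y = inner ℂ x (S y))
    (hB : ∀ x y, inner ℂ (B x) y = inner ℂ x (B y)) (s : E) :
    (inner ℂ s ((S * B - B * S) s)).im = 2 * (inner ℂ (S s) (B s)).im := by
  change (inner ℂ s (S (B s) - B (S s))).im = _
  have h1 : inner ℂ s (S (B s)) = inner ℂ (S s) (B s) := (hS _ _).symm
  have h2 : inner ℂ s (B (S s)) = inner ℂ (B s) (S s) := (hB _ _).symm
  rw [inner_sub_right, h1, h2, Complex.sub_im, im_inner_comm (B s)]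
  ring

/-- The commutator of two symmetric operators is skew, so the imaginary part of its form is a real
symmetric bilinear form. This allows the expansion of the form at u = w - z. -/
theorem im_inner_comm_symm (hS : ∀ x y, inner ℂ (S x) y = inner ℂ x (S y))
    (hB : ∀ x y, inner ℂ (B x) y = inner ℂ x (B y)) (w z : E) :
    (inner ℂ w ((S * B - B * S) z)).im = (inner ℂ z ((S * B - B * S) w)).im := by
  change (inner ℂ w (S (B z) - B (S z))).im = (inner ℂ z (S (B w) - B (S w))).im
  have h1 : inner ℂ w (S (B z)) = inner ℂ (B (S w)) z := by rw [hB, hS]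
  have h2 : inner ℂ w (B (S z)) = inner ℂ (S (B w)) z := by rw [hS, hB]
  rw [inner_sub_right, inner_sub_right, h1, h2, Complex.sub_im, Complex.sub_im,
    im_inner_comm z, im_inner_comm z]
  ring

/-- The variation of the energy along one step of a Crank-Nicolson scheme. -/
theorem energy_step_identity (hS : ∀ x y, inner ℂ (S x) y = inner ℂ x (S y))
    (hB : ∀ x y, inner ℂ (B x) y = inner ℂ x (B y)) (hSA : ∀ x, (inner ℂ (S x) (A x)).im = 0)
    {a b δ : ℝ} {u v G w z : E} (hw : w = ((1 / 2 : ℝ) : ℂ) • (u + v)) (hz : v = u + (2 : ℂ) • z)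
    (hstep : z = -(Complex.I • ((a : ℂ) • A w + (b : ℂ) • B w + ((δ / 2 : ℝ) : ℂ) • G))) :
    (inner ℂ (S v) v).re - (inner ℂ (S u) u).re - 2 * b * (inner ℂ u ((S * B - B * S) u)).im =
      2 * b * (2 * (a * (inner ℂ (A w) ((S * B - B * S) w)).re +
        b * (inner ℂ (B w) ((S * B - B * S) w)).re +
        δ / 2 * (inner ℂ G ((S * B - B * S) w)).re) - (inner ℂ z ((S * B - B * S) z)).im) +
      2 * δ * (inner ℂ (S w) G).im := by
  have hsymm := im_inner_comm_symm hS hB w z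
  have hcomm := im_inner_comm_eq hS hB w
  set D := S * B - B * S with hD
  have e1 : u = w - z := by
    rw [hw, hz]; push_cast; module
  have e2 : u + v = ((2 : ℝ) : ℂ) • w := by
    rw [hw]; push_cast; module
  have e3 : v - u = ((2 : ℝ) : ℂ) • z := by
    rw [hz]; push_cast; module
  have h1 : (inner ℂ (S v) v).re - (inner ℂ (S u) u).re = 4 * (inner ℂ (S w) z).re := by
    rw [re_inner_sub_eq hS, e2, e3, map_smul, re_inner_ofReal_smul_left,
      re_inner_ofReal_smul_right]
    ring
  -- The A term disappears because ⟨Sw, Aw⟩ is real; this holds in the application because S is a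
  -- power of A.
  have h2 : (inner ℂ (S w) z).re = b * (inner ℂ (S w) (B w)).im + δ / 2 * (inner ℂ (S w) G).im := by
    rw [hstep, inner_neg_right, Complex.neg_re, re_inner_I_smul_right, neg_neg, inner_add_right,
      inner_add_right, Complex.add_im, Complex.add_im, im_inner_ofReal_smul_right,
      im_inner_ofReal_smul_right, im_inner_ofReal_smul_right, hSA]
    ring
  have h3 : (inner ℂ z (D w)).im = a * (inner ℂ (A w) (D w)).re + b * (inner ℂ (B w) (D w)).re +
      δ / 2 * (inner ℂ G (D w)).re := by
    conv_lhs => rw [hstep]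
    rw [inner_neg_left, Complex.neg_im, im_inner_I_smul_left, neg_neg, inner_add_left,
      inner_add_left, Complex.add_re, Complex.add_re, re_inner_ofReal_smul_left,
      re_inner_ofReal_smul_left, re_inner_ofReal_smul_left]
  -- The form must be evaluated at u, which is known before the noise is drawn, and not at the
  -- midpoint w. The linear term in z is rewritten by the scheme in `h3`; the quadratic one is kept.
  have h4 : (inner ℂ u (D u)).im = (inner ℂ w (D w)).im - 2 * (inner ℂ z (D w)).im +
      (inner ℂ z (D z)).im := by
    rw [e1, map_sub, inner_sub_left, inner_sub_right, inner_sub_right]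
    simp only [Complex.sub_im]
    rw [hsymm]
    ring
  rw [h1, h2, h4, ← h3]
  linear_combination (-2 * b) * hcomm

end Abstract

end GP

namespace GP

variable {d : ℕ}

/-! ### The operators `B_K` in the spectral norms -/

theorem _root_.IsSelfAdjoint.neg_I_smul_comm {R : Type*} [Ring R] [StarRing R] [Algebra ℂ R]
    [StarModule ℂ R] {S T : R} (hS : IsSelfAdjoint S) (hT : IsSelfAdjoint T) :
    IsSelfAdjoint ((-Complex.I) • (S * T - T * S)) := by
  rw [IsSelfAdjoint, star_smul, star_sub, star_mul, star_mul, hS.star_eq, hT.star_eq]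
  simp only [Complex.star_def, map_neg, Complex.conj_I, neg_neg]
  rw [neg_smul, ← smul_neg, neg_sub]

/-- Multiplied by -i the commutator becomes self-adjoint, so `norm_conj_symmetric_le` applies. It
then factors as Λ_j (Λ_{-j} D Λ_{-j}) Λ_j with a bounded middle term. -/
theorem norm_inner_comm_le {V : Type*} [NormedAddCommGroup V] [InnerProductSpace ℂ V]
    [CompleteSpace V] {Λ : ℤ → V →L[ℂ] V} (hsa : ∀ s, IsSelfAdjoint (Λ s))
    (hmul : ∀ s t, Λ s * Λ t = Λ (s + t)) {T : V →L[ℂ] V} (hT : IsSelfAdjoint T)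
    (h0T : Λ 0 * T = T) (hT0 : T * Λ 0 = T) (j : ℤ) {C : ℝ}
    (hC : ‖(Λ (2 * j) * T - T * Λ (2 * j)) * Λ (-(2 * j))‖ ≤ C) (z w : V) :
    ‖inner ℂ z ((Λ (2 * j) * T - T * Λ (2 * j)) w)‖ ≤ C * (‖Λ j z‖ * ‖Λ j w‖) := by
  set D₀ := Λ (2 * j) * T - T * Λ (2 * j) with hD₀
  set D := (-Complex.I) • D₀ with hD
  have h0D : Λ 0 * D = D := by
    rw [hD, mul_smul_comm, hD₀, mul_sub, ← mul_assoc, hmul, zero_add, ← mul_assoc, h0T]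
  have hD0 : D * Λ 0 = D := by
    rw [hD, smul_mul_assoc, hD₀, sub_mul, mul_assoc, hT0, mul_assoc, hmul, add_zero]
  have hDsa : IsSelfAdjoint D := (hsa _).neg_I_smul_comm hT
  have hn : ‖Λ (-j) * D * Λ (-j)‖ ≤ C := by
    refine (norm_conj_symmetric_le hsa hmul hDsa h0D j).trans ?_
    rwa [hD, smul_mul_assoc, norm_smul, norm_neg, Complex.norm_I, one_mul]
  have hsymm : ∀ s x y, inner ℂ (Λ s x) y = inner ℂ x (Λ s y) := fun s x y =>
    (ContinuousLinearMap.isSelfAdjoint_iff_isSymmetric.1 (hsa s)) x y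
  have e : inner ℂ z (D w) = inner ℂ (Λ j z) ((Λ (-j) * D * Λ (-j)) (Λ j w)) := by
    have : Λ j * (Λ (-j) * D * Λ (-j)) * Λ j = D := by
      rw [← mul_assoc, ← mul_assoc, hmul, mul_assoc, hmul, add_neg_cancel, neg_add_cancel, h0D, hD0]
    rw [hsymm]
    conv_lhs => rw [← this]
    rfl
  have e2 : ‖inner ℂ z (D₀ w)‖ = ‖inner ℂ z (D w)‖ := by
    rw [hD, _root_.smul_apply, inner_smul_right, norm_mul, norm_neg, Complex.norm_I, one_mul]
  rw [e2, e]
  refine (norm_inner_le_norm _ _).trans ?_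
  calc _ ≤ ‖Λ j z‖ * (C * ‖Λ j w‖) := by
        gcongr
        exact (ContinuousLinearMap.le_opNorm _ _).trans (by gcongr)
    _ = _ := by ring

namespace StabilityAssumption

variable {B : ℕ → L2 d →L[ℂ] L2 d} {K : ℕ}

theorem symm (hB : StabilityAssumption B) (hK : 1 ≤ K) (u v : L2 d) :
    inner ℂ (B K u) v = inner ℂ u (B K v) :=
  (ContinuousLinearMap.isSelfAdjoint_iff_isSymmetric.1 (hB.selfAdjoint K hK)) u v

theorem Lam_zero_mul (hB : StabilityAssumption B) (hK : 1 ≤ K) : Lam K 0 * B K = B K := by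
  ext1 u
  exact Lam_zero_of_mem (hB.mem_SigmaK K hK u)

/-- Taking adjoints, an operator with values in Σ_K that is self-adjoint also vanishes on the
orthogonal complement of Σ_K. Hence the estimates need no restriction to u ∈ Σ_K. -/
theorem mul_Lam_zero (hB : StabilityAssumption B) (hK : 1 ≤ K) : B K * Lam K 0 = B K := by
  have h := congrArg star (hB.Lam_zero_mul hK)
  rwa [star_mul, (hB.selfAdjoint K hK).star_eq, (isSelfAdjoint_Lam K 0).star_eq] at h

theorem apply_projK (hB : StabilityAssumption B) (hK : 1 ≤ K) (u : L2 d) :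
    B K (projK K u) = B K u := by
  rw [projK_eq]
  exact congrArg (fun T : L2 d →L[ℂ] L2 d => T u) (hB.mul_Lam_zero hK)

theorem exists_norm_Lam_growth_le [NeZero d] (hB : StabilityAssumption B) (k : ℕ) :
    ∃ C : ℝ, 0 < C ∧ ∀ K : ℕ, 1 ≤ K → ∀ u : L2 d,
      ‖Lam K k (B K u)‖ ≤ C * K * ‖Lam K k u‖ := by
  obtain ⟨C₁, hC₁, h₁⟩ := exists_norm_Lam_le_sigmaNorm (d := d) k
  obtain ⟨C₂, hC₂, h₂⟩ := exists_sigmaNorm_le (d := d) k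
  obtain ⟨C₃, hC₃, h₃⟩ := hB.bound_growth k
  refine ⟨C₁ * C₃ * C₂, by positivity, fun K hK u => ?_⟩
  have hu := projK_mem K u
  rw [← hB.apply_projK hK u, ← Lam_projK K k u]
  calc _ ≤ C₁ * sigmaNorm k (B K (projK K u)) :=
        h₁ K _ (memSigma_of_mem (hB.mem_SigmaK K hK _) k)
    _ ≤ C₁ * (C₃ * K * (C₂ * ‖Lam K k (projK K u)‖)) := by
        gcongr
        exact (h₃ K hK _ (memSigma_of_mem hu k)).trans (by gcongr; exact h₂ K _ hu)
    _ = _ := by ring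

/-- The commutator `[A^j, B_K]` on `Σ_K`. -/
noncomputable def comm (B : ℕ → L2 d →L[ℂ] L2 d) (K j : ℕ) : L2 d →L[ℂ] L2 d :=
  Lam K (2 * j) * B K - B K * Lam K (2 * j)

theorem exists_norm_comm_le [NeZero d] (hB : StabilityAssumption B) (j : ℕ) :
    ∃ C : ℝ, 0 < C ∧ ∀ K : ℕ, 1 ≤ K → ∀ u : L2 d,
      ‖comm B K j u‖ ≤ C * ‖Lam K (2 * j) u‖ := by
  obtain ⟨C₂, hC₂, h₂⟩ := exists_sigmaNorm_le (d := d) (2 * j)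
  obtain ⟨C₃, hC₃, h₃⟩ := hB.comm_bound j
  refine ⟨C₃ * C₂, by positivity, fun K hK u => ?_⟩
  have hu := projK_mem K u
  have e : comm B K j u = opA j (B K (projK K u)) - B K (opA j (projK K u)) := by
    rw [opA_of_mem (hB.mem_SigmaK K hK _), opA_of_mem hu, hB.apply_projK hK, Lam_projK]
    rfl
  rw [e, mul_assoc]
  refine (h₃ K hK _ (memSigma_of_mem hu _)).trans ?_
  gcongr
  have := h₂ K _ hu
  rw [Lam_projK] at this
  exact_mod_cast this

theorem exists_abs_inner_comm_le [NeZero d] (hB : StabilityAssumption B) (j : ℕ) :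
    ∃ C : ℝ, 0 < C ∧ ∀ K : ℕ, 1 ≤ K → ∀ z w : L2 d,
      ‖inner ℂ z (comm B K j w)‖ ≤ C * (‖Lam K j z‖ * ‖Lam K j w‖) := by
  obtain ⟨C, hC, h⟩ := hB.exists_norm_comm_le j
  refine ⟨C, hC, fun K hK z w => ?_⟩
  have hn : ‖comm B K j * Lam K (-(2 * (j : ℤ)))‖ ≤ C := by
    refine ContinuousLinearMap.opNorm_le_bound _ hC.le fun u => ?_
    refine (h K hK (Lam K (-(2 * (j : ℤ))) u)).trans ?_
    rw [Lam_Lam, add_neg_cancel, ← projK_eq]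
    gcongr
    exact Submodule.norm_starProjection_apply_le _ _
  exact norm_inner_comm_le (isSelfAdjoint_Lam K) (Lam_mul K) (hB.selfAdjoint K hK)
    (hB.Lam_zero_mul hK) (hB.mul_Lam_zero hK) j hn z w

/-- This controls the term of order δt χ² of the energy balance, without any power of K. The general
bound on the commutator form would lose a factor K here. -/
theorem exists_abs_re_inner_comm_le [NeZero d] (hB : StabilityAssumption B) (j : ℕ) :
    ∃ C : ℝ, 0 < C ∧ ∀ K : ℕ, 1 ≤ K → ∀ w : L2 d,
      |(inner ℂ (B K w) (comm B K j w)).re| ≤ C * ‖Lam K j w‖ ^ 2 := by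
  obtain ⟨C₂, hC₂, h₂⟩ := exists_sigmaNorm_le (d := d) j
  obtain ⟨C₃, hC₃, h₃⟩ := hB.comm_pairing j
  refine ⟨C₃ * C₂ ^ 2, by positivity, fun K hK w => ?_⟩
  have hw := projK_mem K w
  have h := h₃ K hK _ (memSigma_of_mem hw j)
  rw [hB.apply_projK hK, opA_of_mem (hB.mem_SigmaK K hK _), opA_of_mem (hB.mem_SigmaK K hK _)] at h
  have e : (inner ℂ (B K w) (comm B K j w)).re = (inner ℂ (Lam K (2 * j) (B K w)) (B K w) -
      inner ℂ (projK K w) (Lam K (2 * j) (B K (B K w)))).re := by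
    change (inner ℂ (B K w) (Lam K (2 * j) (B K w) - B K (Lam K (2 * j) w))).re = _
    rw [inner_sub_right, Complex.sub_re, Complex.sub_re, Lam_symm]
    congr 1
    rw [← hB.symm hK, ← Lam_symm, ← Lam_symm, Lam_projK, re_inner_comm, Lam_symm]
  rw [e]
  refine h.trans ?_
  rw [mul_assoc, ← mul_pow]
  gcongr
  · exact sigmaNorm_nonneg _ _
  · have := h₂ K _ hw
    rwa [Lam_projK] at this

end StabilityAssumption

/-! ### The linear Crank-Nicolson operators -/

/-- `(δt/2) A_K + (√δt/2) χ B_K` as a bounded operator. -/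
noncomputable def halfOp (B : ℕ → L2 d →L[ℂ] L2 d) (δt : ℝ) (K : ℕ) (χ : ℝ) : L2 d →L[ℂ] L2 d :=
  ((δt / 2 : ℝ) : ℂ) • Lam K 2 + ((Real.sqrt δt / 2 * χ : ℝ) : ℂ) • B K

section Linear

variable {B : ℕ → L2 d →L[ℂ] L2 d} {K : ℕ}

theorem halfStep_eq [NeZero d] (B : ℕ → L2 d →L[ℂ] L2 d) (δt : ℝ) (K : ℕ) (χ : ℝ) (u : L2 d) :
    halfStep B δt K χ u = halfOp B δt K χ u := by
  rw [halfStep, opA_of_mem (projK_mem K u), Lam_projK]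
  rfl

theorem halfOp_mem (hB : StabilityAssumption B) (hK : 1 ≤ K) (δt χ : ℝ) (u : L2 d) :
    halfOp B δt K χ u ∈ SigmaK d K :=
  Submodule.add_mem _ (Submodule.smul_mem _ _ (Lam_mem K 2 u))
    (Submodule.smul_mem _ _ (hB.mem_SigmaK K hK u))

theorem isSelfAdjoint_halfOp (hB : StabilityAssumption B) (hK : 1 ≤ K) (δt χ : ℝ) :
    IsSelfAdjoint (halfOp B δt K χ) := by
  have h : ∀ a : ℝ, IsSelfAdjoint (a : ℂ) := fun a => by
    rw [IsSelfAdjoint, Complex.star_def, Complex.conj_ofReal]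
  exact ((h _).smul (isSelfAdjoint_Lam K 2)).add ((h _).smul (hB.selfAdjoint K hK))

/-- The inverse of `1 + i H` as a bounded operator, where `H` is `halfOp`. -/
noncomputable def resOp (B : ℕ → L2 d →L[ℂ] L2 d) (δt : ℝ) (K : ℕ) (χ : ℝ) : L2 d →L[ℂ] L2 d :=
  Ring.inverse (1 + Complex.I • halfOp B δt K χ)

theorem resOp_spec (hB : StabilityAssumption B) (hK : 1 ≤ K) (δt χ : ℝ) (u : L2 d) :
    resOp B δt K χ u + Complex.I • halfOp B δt K χ (resOp B δt K χ u) = u := by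
  have h := Ring.mul_inverse_cancel _ (isUnit_one_add_I_smul (isSelfAdjoint_halfOp hB hK δt χ))
  exact congrArg (fun T : L2 d →L[ℂ] L2 d => T u) h

theorem norm_le_norm_add_I_smul (hB : StabilityAssumption B) (hK : 1 ≤ K) (δt χ : ℝ) (u : L2 d) :
    ‖u‖ ≤ ‖u + Complex.I • halfOp B δt K χ u‖ := by
  refine le_of_sq_le_sq ?_ (norm_nonneg _)
  rw [norm_sq_add_I_smul (isSelfAdjoint_halfOp hB hK δt χ)]
  linarith [sq_nonneg ‖halfOp B δt K χ u‖]

theorem resOp_unique (hB : StabilityAssumption B) (hK : 1 ≤ K) {δt χ : ℝ} {u v : L2 d}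
    (h : u + Complex.I • halfOp B δt K χ u = v) : u = resOp B δt K χ v := by
  have h1 := norm_le_norm_add_I_smul hB hK δt χ (u - resOp B δt K χ v)
  have h2 : u - resOp B δt K χ v + Complex.I • halfOp B δt K χ (u - resOp B δt K χ v) = 0 := by
    rw [map_sub, smul_sub, sub_add_sub_comm, h, resOp_spec hB hK, sub_self]
  rw [h2, norm_zero] at h1
  exact sub_eq_zero.1 (norm_le_zero_iff.1 h1)

theorem norm_resOp_apply_le (hB : StabilityAssumption B) (hK : 1 ≤ K) (δt χ : ℝ) (u : L2 d) :
    ‖resOp B δt K χ u‖ ≤ ‖u‖ := by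
  have h := norm_le_norm_add_I_smul hB hK δt χ (resOp B δt K χ u)
  rwa [resOp_spec hB hK] at h

theorem resOp_mem (hB : StabilityAssumption B) (hK : 1 ≤ K) (δt χ : ℝ) {u : L2 d}
    (hu : u ∈ SigmaK d K) : resOp B δt K χ u ∈ SigmaK d K := by
  rw [eq_sub_of_add_eq (resOp_spec hB hK δt χ u)]
  exact Submodule.sub_mem _ hu (Submodule.smul_mem _ _ (halfOp_mem hB hK _ _ _))

/-- `resolvent` selects some preimage in Σ_K. One exists because `resOp` preserves Σ_K, and it is
unique because 1 + iH is bounded below. -/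
theorem resolvent_eq [NeZero d] (hB : StabilityAssumption B) (hK : 1 ≤ K) (δt χ : ℝ) {v : L2 d}
    (hv : v ∈ SigmaK d K) : resolvent B δt K χ v = resOp B δt K χ v := by
  have hex : ∃ u ∈ (SigmaK d K : Set (L2 d)),
      (fun u : L2 d => u + Complex.I • halfStep B δt K χ u) u = v :=
    ⟨_, resOp_mem hB hK δt χ hv, by
      simp only [halfStep_eq]
      exact resOp_spec hB hK δt χ v⟩
  have h := Function.invFunOn_eq hex
  simp only [halfStep_eq] at h
  refine resOp_unique hB hK ?_
  rw [resolvent]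
  simp only [halfStep_eq]
  exact h

/-- The Cayley transform as a bounded operator. -/
noncomputable def cayOp (B : ℕ → L2 d →L[ℂ] L2 d) (δt : ℝ) (K : ℕ) (χ : ℝ) : L2 d →L[ℂ] L2 d :=
  resOp B δt K χ * (1 - Complex.I • halfOp B δt K χ)

theorem cayley_eq [NeZero d] (hB : StabilityAssumption B) (hK : 1 ≤ K) (δt χ : ℝ) {u : L2 d}
    (hu : u ∈ SigmaK d K) : cayley B δt K χ u = cayOp B δt K χ u := by
  rw [cayley, halfStep_eq, resolvent_eq hB hK]
  · rfl
  · exact Submodule.sub_mem _ hu (Submodule.smul_mem _ _ (halfOp_mem hB hK _ _ _))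

theorem cayOp_mem (hB : StabilityAssumption B) (hK : 1 ≤ K) (δt χ : ℝ) {u : L2 d}
    (hu : u ∈ SigmaK d K) : cayOp B δt K χ u ∈ SigmaK d K :=
  resOp_mem hB hK δt χ (Submodule.sub_mem _ hu (Submodule.smul_mem _ _ (halfOp_mem hB hK _ _ _)))

theorem norm_sq_Lam_eq_re_inner [NeZero d] (K j : ℕ) (u : L2 d) :
    ‖Lam K j u‖ ^ 2 = (inner ℂ (Lam K (2 * j) u) u).re := by
  rw [two_mul, ← Lam_Lam, Lam_symm, inner_self_eq_norm_sq_to_K]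
  norm_cast

/-- Splitting 2j = (j - 1) + (j + 1) turns the product into ‖Λ_{j+1} u‖². Integer exponents cover
the case j = 0. -/
theorem im_inner_Lam_Lam [NeZero d] (K j : ℕ) (u : L2 d) :
    (inner ℂ (Lam K (2 * j) u) (Lam K 2 u)).im = 0 := by
  rw [show (2 * j : ℤ) = (j - 1) + (j + 1) by ring, ← Lam_Lam, Lam_symm, Lam_Lam,
    show ((j - 1 : ℤ) + 2) = j + 1 by ring, inner_self_eq_norm_sq_to_K]
  norm_cast

end Linear

end GP

/-! ### The commutator form, linear stability and admissible thresholds. -/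

namespace GP

variable {d : ℕ} {B : ℕ → L2 d →L[ℂ] L2 d} {K : ℕ}

/-- The quadratic form of the commutator `[A^j, B_K]`, which drives the energy. -/
noncomputable def comForm (B : ℕ → L2 d →L[ℂ] L2 d) (K j : ℕ) (u : L2 d) : ℝ :=
  (inner ℂ u (StabilityAssumption.comm B K j u)).im

theorem comForm_eq (hB : StabilityAssumption B) (hK : 1 ≤ K) (j : ℕ) (u : L2 d) :
    comForm B K j u = 2 * (inner ℂ (Lam K (2 * j) u) (B K u)).im :=
  im_inner_comm_eq (S := Lam K (2 * j)) (B := B K) (Lam_symm K _) (hB.symm hK) u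

theorem im_inner_halfOp [NeZero d] (hB : StabilityAssumption B) (hK : 1 ≤ K) (j : ℕ) (δt χ : ℝ)
    (u : L2 d) : (inner ℂ (Lam K (2 * j) u) (halfOp B δt K χ u)).im =
      Real.sqrt δt / 4 * χ * comForm B K j u := by
  change (inner ℂ (Lam K (2 * j) u) (((δt / 2 : ℝ) : ℂ) • Lam K 2 u +
    ((Real.sqrt δt / 2 * χ : ℝ) : ℂ) • B K u)).im = _
  rw [inner_add_right, Complex.add_im, im_inner_ofReal_smul_right, im_inner_ofReal_smul_right,
    im_inner_Lam_Lam, comForm_eq hB hK]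
  ring

/-- Test v + iHv = u against A^j v. The real part leaves |v|² minus the commutator form, itself at
most |v|²/8, so 7/8 |v|² ≤ |v||u| and |v|² ≤ 2|u|² follows. -/
theorem norm_sq_Lam_resOp_le [NeZero d] (hB : StabilityAssumption B) (hK : 1 ≤ K) {j : ℕ}
    {δt χ C : ℝ} (hq : ∀ u : L2 d, |comForm B K j u| ≤ C * ‖Lam K j u‖ ^ 2)
    (hχ : Real.sqrt δt * |χ| * C ≤ 1 / 2) (u : L2 d) :
    ‖Lam K j (resOp B δt K χ u)‖ ^ 2 ≤ 2 * ‖Lam K j u‖ ^ 2 := by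
  set v := resOp B δt K χ u with hv
  have hspec := resOp_spec hB hK δt χ u
  rw [← hv] at hspec
  have h1 : (inner ℂ (Lam K (2 * j) v) u).re =
      ‖Lam K j v‖ ^ 2 - Real.sqrt δt / 4 * χ * comForm B K j v := by
    conv_lhs => rw [← hspec]
    rw [inner_add_right, Complex.add_re, re_inner_I_smul_right, im_inner_halfOp hB hK,
      norm_sq_Lam_eq_re_inner]
    ring
  have h2 : (inner ℂ (Lam K (2 * j) v) u).re ≤ ‖Lam K j v‖ * ‖Lam K j u‖ := by
    rw [two_mul, ← Lam_Lam, Lam_symm]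
    exact (Complex.re_le_norm _).trans (norm_inner_le_norm _ _)
  have h3 : Real.sqrt δt / 4 * χ * comForm B K j v ≤ 1 / 8 * ‖Lam K j v‖ ^ 2 := by
    calc _ ≤ |Real.sqrt δt / 4 * χ * comForm B K j v| := le_abs_self _
      _ = Real.sqrt δt / 4 * |χ| * |comForm B K j v| := by
          rw [abs_mul, abs_mul, abs_of_nonneg (by positivity)]
      _ ≤ Real.sqrt δt / 4 * |χ| * (C * ‖Lam K j v‖ ^ 2) := by gcongr; exact hq v
      _ = (Real.sqrt δt * |χ| * C) * (‖Lam K j v‖ ^ 2 / 4) := by ring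
      _ ≤ 1 / 2 * (‖Lam K j v‖ ^ 2 / 4) := by gcongr
      _ = _ := by ring
  generalize ‖Lam K j v‖ = a at *
  generalize ‖Lam K j u‖ = b at *
  nlinarith [sq_nonneg (a - b)]

theorem cayOp_sub (hB : StabilityAssumption B) (hK : 1 ≤ K) (δt χ : ℝ) (u : L2 d) :
    cayOp B δt K χ u - u = -(Complex.I • halfOp B δt K χ (u + cayOp B δt K χ u)) := by
  have h : cayOp B δt K χ u + Complex.I • halfOp B δt K χ (cayOp B δt K χ u) =
      u - Complex.I • halfOp B δt K χ u := resOp_spec hB hK δt χ _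
  rw [map_add, smul_add, ← sub_eq_zero]
  rw [← sub_eq_zero] at h
  rw [← h]
  abel

/-- Testing against A^j(u + v), the energy changes only by the commutator form at u + v, at most |u
+ v|²/8 ≤ (|u|² + |v|²)/4. Hence |v|² ≤ (5/3)|u|². -/
theorem norm_sq_Lam_cayOp_le [NeZero d] (hB : StabilityAssumption B) (hK : 1 ≤ K) {j : ℕ}
    {δt χ C : ℝ} (hq : ∀ u : L2 d, |comForm B K j u| ≤ C * ‖Lam K j u‖ ^ 2)
    (hχ : Real.sqrt δt * |χ| * C ≤ 1 / 2) (u : L2 d) :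
    ‖Lam K j (cayOp B δt K χ u)‖ ^ 2 ≤ 2 * ‖Lam K j u‖ ^ 2 := by
  set v := cayOp B δt K χ u with hv
  have h1 : ‖Lam K j v‖ ^ 2 - ‖Lam K j u‖ ^ 2 =
      Real.sqrt δt / 4 * χ * comForm B K j (u + v) := by
    rw [norm_sq_Lam_eq_re_inner, norm_sq_Lam_eq_re_inner, re_inner_sub_eq (Lam_symm K _),
      hv, cayOp_sub hB hK, inner_neg_right, Complex.neg_re, re_inner_I_smul_right, neg_neg,
      im_inner_halfOp hB hK]
  have h2 : ‖Lam K j (u + v)‖ ^ 2 ≤ 2 * ‖Lam K j u‖ ^ 2 + 2 * ‖Lam K j v‖ ^ 2 := by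
    rw [map_add]
    have := norm_add_le (Lam K j u) (Lam K j v)
    have h0 := norm_nonneg (Lam K j u + Lam K j v)
    generalize ‖Lam K j u + Lam K j v‖ = c at *
    generalize ‖Lam K j u‖ = a at *
    generalize ‖Lam K j v‖ = b at *
    nlinarith [sq_nonneg (a - b)]
  have h3 : Real.sqrt δt / 4 * χ * comForm B K j (u + v) ≤ 1 / 8 * ‖Lam K j (u + v)‖ ^ 2 := by
    calc _ ≤ |Real.sqrt δt / 4 * χ * comForm B K j (u + v)| := le_abs_self _
      _ = Real.sqrt δt / 4 * |χ| * |comForm B K j (u + v)| := by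
          rw [abs_mul, abs_mul, abs_of_nonneg (by positivity)]
      _ ≤ Real.sqrt δt / 4 * |χ| * (C * ‖Lam K j (u + v)‖ ^ 2) := by gcongr; exact hq _
      _ = (Real.sqrt δt * |χ| * C) * (‖Lam K j (u + v)‖ ^ 2 / 4) := by ring
      _ ≤ 1 / 2 * (‖Lam K j (u + v)‖ ^ 2 / 4) := by gcongr
      _ = _ := by ring
  linarith [sq_nonneg ‖Lam K j u‖]

theorem exists_abs_comForm_le [NeZero d] (hB : StabilityAssumption B) (j : ℕ) :
    ∃ C : ℝ, 0 < C ∧ ∀ K : ℕ, 1 ≤ K → ∀ u : L2 d, |comForm B K j u| ≤ C * ‖Lam K j u‖ ^ 2 := by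
  obtain ⟨C, hC, h⟩ := hB.exists_abs_inner_comm_le j
  refine ⟨C, hC, fun K hK u => ?_⟩
  rw [sq]
  exact (Complex.abs_im_le_norm _).trans (h K hK u u)

theorem exists_admissibleThreshold [NeZero d] (hB : StabilityAssumption B) (j : ℕ) :
    ∃ C₀ : ℝ, AdmissibleThreshold B j C₀ := by
  obtain ⟨C, hC, h⟩ := exists_abs_comForm_le hB j
  refine ⟨1 / (2 * C), by positivity, fun K hK δt _ _ χ hχ u hu => ?_⟩
  have hχ' : Real.sqrt δt * |χ| * C ≤ 1 / 2 := by
    rw [lt_div_iff₀ (by positivity)] at hχ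
    linarith
  rw [cayley_eq hB hK δt χ hu, resolvent_eq hB hK δt χ hu, energy_of_mem hu,
    energy_of_mem (cayOp_mem hB hK δt χ hu), energy_of_mem (resOp_mem hB hK δt χ hu)]
  exact ⟨norm_sq_Lam_cayOp_le hB hK (h K hK) hχ' u, norm_sq_Lam_resOp_le hB hK (h K hK) hχ' u⟩

section Admissible

variable {j : ℕ} {C₀ δt χ : ℝ}

theorem AdmissibleThreshold.norm_cayOp_le [NeZero d] (hC : AdmissibleThreshold B j C₀)
    (hB : StabilityAssumption B) (hK : 1 ≤ K) (h0 : 0 < δt) (h1 : δt < 1)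
    (hχ : Real.sqrt δt * |χ| < C₀) {u : L2 d} (hu : u ∈ SigmaK d K) :
    ‖Lam K j (cayOp B δt K χ u)‖ ≤ Real.sqrt 2 * ‖Lam K j u‖ := by
  have h := (hC.2 K hK δt h0 h1 χ hχ u hu).1
  rw [cayley_eq hB hK δt χ hu, energy_of_mem hu, energy_of_mem (cayOp_mem hB hK δt χ hu)] at h
  refine le_of_sq_le_sq ?_ (by positivity)
  rwa [mul_pow, Real.sq_sqrt (by norm_num)]

theorem AdmissibleThreshold.norm_resOp_le [NeZero d] (hC : AdmissibleThreshold B j C₀)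
    (hB : StabilityAssumption B) (hK : 1 ≤ K) (h0 : 0 < δt) (h1 : δt < 1)
    (hχ : Real.sqrt δt * |χ| < C₀) {u : L2 d} (hu : u ∈ SigmaK d K) :
    ‖Lam K j (resOp B δt K χ u)‖ ≤ Real.sqrt 2 * ‖Lam K j u‖ := by
  have h := (hC.2 K hK δt h0 h1 χ hχ u hu).2
  rw [resolvent_eq hB hK δt χ hu, energy_of_mem hu, energy_of_mem (resOp_mem hB hK δt χ hu)] at h
  refine le_of_sq_le_sq ?_ (by positivity)
  rwa [mul_pow, Real.sq_sqrt (by norm_num)]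

theorem norm_Lam_zero_apply_le (K : ℕ) (u : L2 d) : ‖Lam K 0 u‖ ≤ ‖u‖ := by
  rw [← projK_eq]
  exact Submodule.norm_starProjection_apply_le _ _

/-- The resolvent is also bounded on the intermediate spaces. -/
theorem AdmissibleThreshold.norm_resOp_le_of_le [NeZero d] (hC : AdmissibleThreshold B j C₀)
    (hB : StabilityAssumption B) (hK : 1 ≤ K) (h0 : 0 < δt) (h1 : δt < 1)
    (hχ : Real.sqrt δt * |χ| < C₀) {k : ℕ} (hkj : k ≤ j) {u : L2 d} (hu : u ∈ SigmaK d K) :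
    ‖Lam K k (resOp B δt K χ u)‖ ≤ Real.sqrt 2 * ‖Lam K k u‖ := by
  have h2 : (1 : ℝ) ≤ Real.sqrt 2 := by
    rw [Real.one_le_sqrt]; norm_num
  -- The threshold is admissible for j only. The resolvent is a contraction of L² for every χ, and
  -- `norm_conj_le_of_endpoints` interpolates between L² and Σ^j to reach Σ^k, where the fixed point
  -- argument takes place.
  have hz : ‖(Lam K 0 : L2 d →L[ℂ] L2 d) * resOp B δt K χ * Lam K 0‖ ≤ Real.sqrt 2 := by
    refine ContinuousLinearMap.opNorm_le_bound _ (by positivity) fun x => ?_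
    calc _ ≤ ‖resOp B δt K χ (Lam K 0 x)‖ := norm_Lam_zero_apply_le K _
      _ ≤ ‖Lam K 0 x‖ := norm_resOp_apply_le hB hK δt χ _
      _ ≤ 1 * ‖x‖ := by rw [one_mul]; exact norm_Lam_zero_apply_le K x
      _ ≤ _ := by gcongr
  have hj : ‖(Lam K j : L2 d →L[ℂ] L2 d) * resOp B δt K χ * Lam K (-j)‖ ≤ Real.sqrt 2 := by
    refine ContinuousLinearMap.opNorm_le_bound _ (by positivity) fun x => ?_
    calc _ ≤ Real.sqrt 2 * ‖Lam K j (Lam K (-j) x)‖ :=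
          hC.norm_resOp_le hB hK h0 h1 hχ (Lam_mem K _ x)
      _ ≤ _ := by
          rw [Lam_Lam, add_neg_cancel]
          gcongr
          exact norm_Lam_zero_apply_le K x
  have hk := norm_conj_le_of_endpoints (lam := fun s => (Lam K s : L2 d →L[ℂ] L2 d))
    (isSelfAdjoint_Lam K) (Lam_mul K) hkj hz hj
  have e : Lam K k (resOp B δt K χ u) =
      ((Lam K k * resOp B δt K χ * Lam K (-k) : L2 d →L[ℂ] L2 d)) (Lam K k u) := by
    change _ = Lam K k (resOp B δt K χ (Lam K (-k) (Lam K k u)))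
    rw [Lam_Lam, neg_add_cancel, Lam_zero_of_mem hu]
  rw [e]
  exact (ContinuousLinearMap.le_opNorm _ _).trans (by gcongr)

end Admissible

/-! ### The energy balance of one step -/

theorem lam_le_of_mem_box {m : Fin d → ℕ} (hm : m ∈ box d K) : lam m ≤ 2 * d * K := by
  have h : lam m ≤ ∑ _i : Fin d, (2 * (K : ℝ)) := by
    refine Finset.sum_le_sum fun i _ => ?_
    have : ((m i + 1 : ℕ) : ℝ) ≤ K := by exact_mod_cast mem_box.1 hm i
    push_cast at this
    linarith
  refine h.trans (le_of_eq ?_)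
  simp; ring

theorem norm_Lam_Lam_two_le [NeZero d] (K j : ℕ) (u : L2 d) :
    ‖Lam K j (Lam K 2 u)‖ ≤ 2 * d * K * ‖Lam K j u‖ := by
  refine le_of_sq_le_sq ?_ (by positivity)
  rw [Lam_Lam, mul_pow, norm_sq_Lam, norm_sq_Lam, Finset.mul_sum]
  refine Finset.sum_le_sum fun m hm => ?_
  have h0 : (0 : ℝ) < lam m := by linarith [one_le_lam m]
  have h1 := lam_le_of_mem_box hm
  rw [zpow_add₀ h0.ne', mul_comm (lam m ^ (j : ℤ)), mul_assoc]
  gcongr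
  exact_mod_cast pow_le_pow_left₀ h0.le h1 2

/-- Power counting with r = δt^{1/4}, where D stands for the dimension and a₁, …, a₅ for the five
inner products of `energy_step_identity`. Those with r⁶ have powers of r to spare, one of which
absorbs K in a₁. The term with a₄, quadratic in z, has exactly r² · r² and produces the cube of |χ|.
-/
theorem energy_step_bound {r m Cc Cp Cg K₀ D K E χ a₁ a₂ a₃ a₄ a₅ : ℝ} (hr : 0 < r) (hr1 : r ≤ 1)
    (hCc : 0 ≤ Cc) (hCg : 0 ≤ Cg) (hD : 0 ≤ D) (hK : 0 ≤ K)
    (hKr : K * r ≤ K₀) (h₁ : |a₁| ≤ Cc * (2 * D * K * m * m)) (h₂ : |a₂| ≤ Cp * m ^ 2)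
    (h₃ : |a₃| ≤ Cc * (Cg * m * m)) (h₄ : |a₄| ≤ Cc * (r * (E * (1 + |χ|)) * m) ^ 2)
    (h₅ : |a₅| ≤ m * (Cg * m)) (x1 : |χ| ≤ 1 + |χ| ^ 3) (x2 : |χ| ^ 2 ≤ 1 + |χ| ^ 3)
    (x3 : |χ| * (1 + |χ|) ^ 2 ≤ 4 * (1 + |χ| ^ 3)) :
    |2 * (r ^ 2 / 2 * χ) * (2 * (r ^ 4 / 2 * a₁ + r ^ 2 / 2 * χ * a₂ + r ^ 4 / 2 * a₃) - a₄) +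
      2 * r ^ 4 * a₅| ≤
      (2 * Cc * D * K₀ + Cp + Cc * Cg + 4 * Cc * E ^ 2 + 2 * Cg) * r ^ 4 * (1 + |χ| ^ 3) * m ^ 2 := by
  have hχ0 : 0 ≤ |χ| := abs_nonneg χ
  set Z := 1 + |χ| ^ 3 with hZ
  have hZ1 : 1 ≤ Z := by rw [hZ]; linarith [pow_nonneg hχ0 3]
  have hCp : 0 ≤ Cp * m ^ 2 := (abs_nonneg _).trans h₂
  have e : 2 * (r ^ 2 / 2 * χ) * (2 * (r ^ 4 / 2 * a₁ + r ^ 2 / 2 * χ * a₂ + r ^ 4 / 2 * a₃) - a₄) +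
      2 * r ^ 4 * a₅ = r ^ 6 * (χ * a₁) + r ^ 4 * (χ ^ 2 * a₂) + r ^ 6 * (χ * a₃) +
        r ^ 2 * (-(χ * a₄)) + 2 * r ^ 4 * a₅ := by ring
  have hr2 : r ^ 2 ≤ 1 := pow_le_one₀ hr.le hr1
  have b1 : |r ^ 6 * (χ * a₁)| ≤ r ^ 4 * Z * m ^ 2 * (2 * Cc * D * K₀) := by
    rw [abs_mul, abs_mul, abs_of_nonneg (by positivity)]
    calc _ ≤ r ^ 6 * (Z * (Cc * (2 * D * K * m * m))) := by gcongr
      _ = r * (r ^ 4 * Z * m ^ 2 * (2 * Cc * D * (K * r))) := by ring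
      _ ≤ 1 * (r ^ 4 * Z * m ^ 2 * (2 * Cc * D * K₀)) := by gcongr
      _ = _ := one_mul _
  have b2 : |r ^ 4 * (χ ^ 2 * a₂)| ≤ r ^ 4 * Z * m ^ 2 * Cp := by
    rw [abs_mul, abs_mul, abs_of_nonneg (by positivity : 0 ≤ r ^ 4), abs_pow]
    calc _ ≤ r ^ 4 * (Z * (Cp * m ^ 2)) := by gcongr
      _ = _ := by ring
  have b3 : |r ^ 6 * (χ * a₃)| ≤ r ^ 4 * Z * m ^ 2 * (Cc * Cg) := by
    rw [abs_mul, abs_mul, abs_of_nonneg (by positivity)]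
    calc _ ≤ r ^ 6 * (Z * (Cc * (Cg * m * m))) := by gcongr
      _ = r ^ 2 * (r ^ 4 * Z * m ^ 2 * (Cc * Cg)) := by ring
      _ ≤ 1 * (r ^ 4 * Z * m ^ 2 * (Cc * Cg)) := by gcongr
      _ = _ := one_mul _
  have b4 : |r ^ 2 * (-(χ * a₄))| ≤ r ^ 4 * Z * m ^ 2 * (4 * Cc * E ^ 2) := by
    rw [abs_mul, abs_neg, abs_mul, abs_of_nonneg (by positivity)]
    calc _ ≤ r ^ 2 * (|χ| * (Cc * (r * (E * (1 + |χ|)) * m) ^ 2)) := by gcongr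
      _ = r ^ 4 * m ^ 2 * (Cc * E ^ 2) * (|χ| * (1 + |χ|) ^ 2) := by ring
      _ ≤ r ^ 4 * m ^ 2 * (Cc * E ^ 2) * (4 * Z) := by gcongr
      _ = _ := by ring
  have b5 : |2 * r ^ 4 * a₅| ≤ r ^ 4 * Z * m ^ 2 * (2 * Cg) := by
    rw [abs_mul, abs_of_nonneg (by positivity)]
    calc _ ≤ 2 * r ^ 4 * (m * (Cg * m)) := by gcongr
      _ = r ^ 4 * 1 * m ^ 2 * (2 * Cg) := by ring
      _ ≤ _ := by gcongr
  rw [e]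
  have s1 := abs_add_le (r ^ 6 * (χ * a₁) + r ^ 4 * (χ ^ 2 * a₂) + r ^ 6 * (χ * a₃) +
        r ^ 2 * (-(χ * a₄))) (2 * r ^ 4 * a₅)
  have s2 := abs_add_le (r ^ 6 * (χ * a₁) + r ^ 4 * (χ ^ 2 * a₂) + r ^ 6 * (χ * a₃))
    (r ^ 2 * (-(χ * a₄)))
  have s3 := abs_add_le (r ^ 6 * (χ * a₁) + r ^ 4 * (χ ^ 2 * a₂)) (r ^ 6 * (χ * a₃))
  have s4 := abs_add_le (r ^ 6 * (χ * a₁)) (r ^ 4 * (χ ^ 2 * a₂))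
  calc _ ≤ r ^ 4 * Z * m ^ 2 * (2 * Cc * D * K₀) + r ^ 4 * Z * m ^ 2 * Cp +
        r ^ 4 * Z * m ^ 2 * (Cc * Cg) + r ^ 4 * Z * m ^ 2 * (4 * Cc * E ^ 2) +
        r ^ 4 * Z * m ^ 2 * (2 * Cg) := by linarith
    _ = _ := by ring

theorem norm_map_neg_I_smul_le {E : Type*} [NormedAddCommGroup E] [NormedSpace ℂ E]
    (T : E →L[ℂ] E) (a b c : ℝ) (x y z : E) :
    ‖T (-(Complex.I • ((a : ℂ) • x + (b : ℂ) • y + (c : ℂ) • z)))‖ ≤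
      |a| * ‖T x‖ + |b| * ‖T y‖ + |c| * ‖T z‖ := by
  rw [map_neg, norm_neg, map_smul, norm_smul, Complex.norm_I, one_mul, map_add, map_add, map_smul,
    map_smul, map_smul]
  refine norm_add₃_le.trans (le_of_eq ?_)
  simp only [norm_smul, Complex.norm_real, Real.norm_eq_abs]

-- Up to an error of order δt, the energy moves by the noise times a form evaluated at the starting
-- point of the step. This is what the martingale argument needs, and the reason for the restriction
-- K = O(δt^{-1/4}).
set_option maxHeartbeats 1000000 in
theorem exists_energy_step_le [NeZero d] (hB : StabilityAssumption B) (j : ℕ) {K₀ Cg : ℝ}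
    (hK₀ : 0 < K₀) (hCg : 0 ≤ Cg) : ∃ C : ℝ, 0 < C ∧ ∀ K : ℕ, 1 ≤ K → ∀ r χ m : ℝ, 0 < r → r ≤ 1 →
      K * r ≤ K₀ → ∀ u v G : L2 d, ‖Lam K j u‖ ≤ m → ‖Lam K j v‖ ≤ m → ‖Lam K j G‖ ≤ Cg * m →
      v - u = -(Complex.I • (halfOp B (r ^ 4) K χ (u + v) + ((r ^ 4 : ℝ) : ℂ) • G)) →
      |‖Lam K j v‖ ^ 2 - ‖Lam K j u‖ ^ 2 - r ^ 2 * χ * comForm B K j u| ≤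
        C * r ^ 4 * (1 + |χ| ^ 3) * m ^ 2 := by
  obtain ⟨Cc, hCc, hc⟩ := hB.exists_abs_inner_comm_le j
  obtain ⟨Cp, hCp, hp⟩ := hB.exists_abs_re_inner_comm_le j
  obtain ⟨Cb, hCb, hb⟩ := hB.exists_norm_Lam_growth_le j
  set E : ℝ := d * K₀ + Cb * K₀ + Cg with hE
  have hE0 : 0 ≤ E := by positivity
  refine ⟨2 * Cc * d * K₀ + Cp + Cc * Cg + 4 * Cc * E ^ 2 + 2 * Cg, by positivity, ?_⟩
  intro K hK r χ m hr hr1 hKr u v G hu hv hG hstep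
  have hm : 0 ≤ m := (norm_nonneg _).trans hu
  have hsqrt : Real.sqrt (r ^ 4) = r ^ 2 := by
    rw [show r ^ 4 = (r ^ 2) ^ 2 by ring, Real.sqrt_sq (by positivity)]
  set w : L2 d := ((1 / 2 : ℝ) : ℂ) • (u + v) with hw
  set z : L2 d := ((1 / 2 : ℝ) : ℂ) • (v - u) with hzdef
  have hz : v = u + (2 : ℂ) • z := by rw [hzdef]; push_cast; module
  have hzw : z = -(Complex.I • (((r ^ 4 / 2 : ℝ) : ℂ) • Lam K 2 w +
      ((r ^ 2 / 2 * χ : ℝ) : ℂ) • B K w + ((r ^ 4 / 2 : ℝ) : ℂ) • G)) := by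
    have e : halfOp B (r ^ 4) K χ (u + v) = ((r ^ 4 / 2 : ℝ) : ℂ) • Lam K 2 (u + v) +
        ((r ^ 2 / 2 * χ : ℝ) : ℂ) • B K (u + v) := by
      rw [halfOp, hsqrt]; rfl
    rw [hzdef, hstep, e, hw, map_smul, map_smul]
    generalize Lam K 2 (u + v) = x
    generalize B K (u + v) = y
    push_cast
    module
  have key := energy_step_identity (S := Lam K (2 * j)) (A := Lam K 2) (B := B K) (Lam_symm K _)
    (hB.symm hK) (im_inner_Lam_Lam K j) hw hz hzw
  rw [← norm_sq_Lam_eq_re_inner, ← norm_sq_Lam_eq_re_inner] at key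
  have hχ0 : 0 ≤ |χ| := abs_nonneg χ
  have hWm : ‖Lam K j w‖ ≤ m := by
    rw [hw, map_smul, norm_smul, map_add]
    have := norm_add_le (Lam K j u) (Lam K j v)
    norm_num
    linarith
  clear_value w z
  have hK0 : (0 : ℝ) ≤ K := Nat.cast_nonneg K
  have hAw : ‖Lam K j (Lam K 2 w)‖ ≤ 2 * d * K * m :=
    (norm_Lam_Lam_two_le K j w).trans (by gcongr)
  have hBw : ‖Lam K j (B K w)‖ ≤ Cb * K * m := (hb K hK w).trans (by gcongr)
  have hr2 : r ^ 2 ≤ r := pow_le_of_le_one hr.le hr1 (by norm_num)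
  have hr4 : r ^ 4 ≤ r := pow_le_of_le_one hr.le hr1 (by norm_num)
  -- Applying A or B_K costs a factor K, and the noise only brings r² = √δt. Since K r ≤ K₀, one
  -- power of r remains, just enough for the quadratic term in z.
  have hzm : ‖Lam K j z‖ ≤ r * (E * (1 + |χ|)) * m := by
    rw [hzw]
    refine (norm_map_neg_I_smul_le _ _ _ _ _ _ _).trans ?_
    rw [abs_of_nonneg (by positivity : 0 ≤ r ^ 4 / 2), abs_mul,
      abs_of_nonneg (by positivity : 0 ≤ r ^ 2 / 2)]
    have t1 : r ^ 4 / 2 * ‖Lam K j (Lam K 2 w)‖ ≤ r * (d * K₀) * m := by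
      calc _ ≤ r ^ 4 / 2 * (2 * d * K * m) := by gcongr
        _ = r ^ 2 * (r * d * (K * r) * m) := by ring
        _ ≤ 1 * (r * d * K₀ * m) := by gcongr; linarith
        _ = _ := by ring
    have t2 : r ^ 2 / 2 * |χ| * ‖Lam K j (B K w)‖ ≤ r * (Cb * K₀) * |χ| * m := by
      calc _ ≤ r ^ 2 / 2 * |χ| * (Cb * K * m) := by gcongr
        _ = 1 / 2 * (r * (Cb * (K * r)) * |χ| * m) := by ring
        _ ≤ 1 * (r * (Cb * K₀) * |χ| * m) := by gcongr; norm_num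
        _ = _ := by ring
    have t3 : r ^ 4 / 2 * ‖Lam K j G‖ ≤ r * Cg * m := by
      calc _ ≤ r / 1 * (Cg * m) := by gcongr; norm_num
        _ = _ := by ring
    have t4 : 0 ≤ r * (d * K₀ + Cg) * |χ| * m := by positivity
    have t5 : 0 ≤ r * (Cb * K₀) * m := by positivity
    rw [hE]
    linarith
  have x1 := pow_le_one_add_pow hχ0 (show 1 ≤ 3 by norm_num)
  have x2 := pow_le_one_add_pow hχ0 (show 2 ≤ 3 by norm_num)
  rw [pow_one] at x1
  have x3 : |χ| * (1 + |χ|) ^ 2 ≤ 4 * (1 + |χ| ^ 3) := by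
    have : |χ| * (1 + |χ|) ^ 2 = |χ| + 2 * |χ| ^ 2 + |χ| ^ 3 := by ring
    linarith
  have hre : ∀ {x : L2 d} {c : ℝ}, ‖Lam K j x‖ ≤ c →
      |(inner ℂ x (StabilityAssumption.comm B K j w)).re| ≤ Cc * (c * m) := by
    intro x c hx
    refine (Complex.abs_re_le_norm _).trans ((hc K hK x w).trans ?_)
    have : 0 ≤ c := (norm_nonneg _).trans hx
    gcongr
  have hA1 := hre hAw
  have hG1 := hre hG
  have hB1 : |(inner ℂ (B K w) (StabilityAssumption.comm B K j w)).re| ≤ Cp * m ^ 2 :=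
    (hp K hK w).trans (by gcongr)
  have hZ1 : |(inner ℂ z (StabilityAssumption.comm B K j z)).im| ≤
      Cc * (r * (E * (1 + |χ|)) * m) ^ 2 := by
    refine (Complex.abs_im_le_norm _).trans ((hc K hK z z).trans ?_)
    rw [sq]
    gcongr
  have hS1 : |(inner ℂ (Lam K (2 * j) w) G).im| ≤ m * (Cg * m) := by
    rw [two_mul, ← Lam_Lam, Lam_symm]
    refine (Complex.abs_im_le_norm _).trans ((norm_inner_le_norm _ _).trans ?_)
    gcongr
  change _ = 2 * (r ^ 2 / 2 * χ) * (2 * (r ^ 4 / 2 * (inner ℂ (Lam K 2 w)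
    (StabilityAssumption.comm B K j w)).re + r ^ 2 / 2 * χ * (inner ℂ (B K w)
    (StabilityAssumption.comm B K j w)).re + r ^ 4 / 2 * (inner ℂ G
    (StabilityAssumption.comm B K j w)).re) - (inner ℂ z (StabilityAssumption.comm B K j z)).im) +
    2 * r ^ 4 * (inner ℂ (Lam K (2 * j) w) G).im at key
  have hlhs : ‖Lam K j v‖ ^ 2 - ‖Lam K j u‖ ^ 2 - r ^ 2 * χ * comForm B K j u =
      ‖Lam K j v‖ ^ 2 - ‖Lam K j u‖ ^ 2 - 2 * (r ^ 2 / 2 * χ) *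
        (inner ℂ u (StabilityAssumption.comm B K j u)).im := by
    rw [comForm]; ring
  rw [hlhs]
  refine (congrArg abs key).le.trans ?_
  exact energy_step_bound hr hr1 hCc.le hCg (Nat.cast_nonneg d) hK0 hKr hA1 hB1 hG1 hZ1 hS1
    x1 x2 x3

end GP

namespace GP

/-! ### A maximal inequality for discrete stochastic energy balances -/

/-- The running maximum of a sequence. -/
noncomputable def runMax (a : ℕ → ℝ) : ℕ → ℝ
  | 0 => a 0
  | n + 1 => max (runMax a n) (a (n + 1))

theorem le_runMax (a : ℕ → ℝ) {i n : ℕ} (h : i ≤ n) : a i ≤ runMax a n := by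
  induction n with
  | zero => rw [Nat.le_zero.1 h, runMax]
  | succ n ih =>
    rw [runMax]
    rcases Nat.le_succ_iff.1 h with h | h
    · exact (ih h).trans (le_max_left _ _)
    · rw [h]; exact le_max_right _ _

theorem runMax_le {a : ℕ → ℝ} {n : ℕ} {b : ℝ} (h : ∀ i ≤ n, a i ≤ b) : runMax a n ≤ b := by
  induction n with
  | zero => exact h 0 le_rfl
  | succ n ih => exact max_le (ih fun i hi => h i (by omega)) (h _ le_rfl)

/-- A pathwise form of Doob's maximal inequality. -/
theorem runMax_sq_le (a : ℕ → ℝ) (n : ℕ) :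
    runMax a n ^ 2 ≤ 4 * a n ^ 2 - 4 * ∑ i ∈ Finset.range n, runMax a i * (a (i + 1) - a i) := by
  -- Discrete summation by parts: when the maximum does not move the right side changes by exactly
  -- the summand, and when it jumps to a(n+1) the gain is half a square.
  have h : ∑ i ∈ Finset.range n, runMax a i * (a (i + 1) - a i) ≤
      runMax a n * a n - runMax a n ^ 2 / 2 := by
    induction n with
    | zero => simp only [Finset.range_zero, Finset.sum_empty, runMax]; nlinarith [sq_nonneg (a 0)]
    | succ n ih =>
      rw [Finset.sum_range_succ]
      have : runMax a n * a (n + 1) - runMax a n ^ 2 / 2 ≤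
          runMax a (n + 1) * a (n + 1) - runMax a (n + 1) ^ 2 / 2 := by
        rw [runMax]
        rcases le_total (runMax a n) (a (n + 1)) with h | h
        · rw [max_eq_right h]; nlinarith [sq_nonneg (runMax a n - a (n + 1))]
        · rw [max_eq_left h]
      linarith
  nlinarith [sq_nonneg (2 * a n - runMax a n)]

theorem gronwall_sum {b : ℕ → ℝ} {A ε : ℝ} (hA : 0 ≤ A) (hε : 0 ≤ ε) {N : ℕ}
    (h : ∀ n ≤ N, b n ≤ A + ε * ∑ i ∈ Finset.range n, b i) :
    ∀ n ≤ N, b n ≤ A * Real.exp (ε * n) := by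
  have h1 : ∀ n ≤ N, A + ε * ∑ i ∈ Finset.range n, b i ≤ A * (1 + ε) ^ n := by
    intro n hn
    induction n with
    | zero => simp
    | succ n ih =>
      have h2 := ih (by omega)
      have h3 := h n (by omega)
      rw [Finset.sum_range_succ, pow_succ]
      nlinarith
  intro n hn
  refine (h n hn).trans ((h1 n hn).trans ?_)
  gcongr
  rw [mul_comm, Real.exp_nat_mul]
  gcongr
  linarith [Real.add_one_le_exp ε]

/-- The polynomial weight `1 + |x|³`. -/
noncomputable def cubeWeight (x : ℝ) : ℝ := 1 + |x| ^ 3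

theorem one_le_cubeWeight (x : ℝ) : 1 ≤ cubeWeight x := by
  unfold cubeWeight; linarith [pow_nonneg (abs_nonneg x) 3]

theorem measurable_cubeWeight : Measurable cubeWeight := by
  unfold cubeWeight; fun_prop

theorem sq_le_cubeWeight (x : ℝ) : x ^ 2 ≤ cubeWeight x := by
  rw [← sq_abs]; exact pow_le_one_add_pow (abs_nonneg x) (by norm_num)

theorem abs_le_cubeWeight (x : ℝ) : |x| ≤ cubeWeight x := by
  have := pow_le_one_add_pow (abs_nonneg x) (show 1 ≤ 3 by norm_num)
  rwa [pow_one] at this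

theorem integrable_abs_pow_gaussian (n : ℕ) :
    Integrable (fun x : ℝ => |x| ^ n) (gaussianReal 0 1) := by
  have h := (memLp_id_gaussianReal (μ := 0) (v := 1) n).integrable_norm_pow' (p := n)
  simpa using h

theorem integrable_cubeWeight_sq : Integrable (fun x => cubeWeight x ^ 2) (gaussianReal 0 1) := by
  have h := ((integrable_const (1 : ℝ)).add ((integrable_abs_pow_gaussian 3).const_mul 2)).add
    (integrable_abs_pow_gaussian 6)
  refine h.congr (Filter.Eventually.of_forall fun x => ?_)
  simp only [Pi.add_apply, cubeWeight]
  ring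

/-- Second moment of the weight under the standard Gaussian law. -/
noncomputable def cubeMoment : ℝ := ∫ x, cubeWeight x ^ 2 ∂(gaussianReal 0 1)

theorem cubeMoment_nonneg : 0 ≤ cubeMoment := integral_nonneg fun _ => sq_nonneg _

theorem integral_odd_gaussian {f : ℝ → ℝ} (hodd : ∀ x, f (-x) = -f x) :
    ∫ x, f x ∂(gaussianReal 0 1) = 0 := by
  have h1 : ∫ x, f x ∂((gaussianReal 0 1).map (fun x => -x)) = ∫ x, f (-x) ∂(gaussianReal 0 1) :=
    integral_map_equiv (MeasurableEquiv.neg ℝ) f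
  rw [gaussianReal_map_neg, neg_zero] at h1
  simp only [hodd] at h1
  rw [integral_neg] at h1
  linarith

section Probability

variable {Ω : Type*}

theorem measurable_runMax {F : ℕ → MeasurableSpace Ω} (hF : Monotone F) {e : ℕ → Ω → ℝ} {N : ℕ}
    (he : ∀ n ≤ N, Measurable[F n] (e n)) :
    ∀ n ≤ N, Measurable[F n] (fun ω => runMax (fun i => e i ω) n) := by
  intro n hn
  induction n with
  | zero => exact he 0 hn
  | succ n ih =>
    exact ((ih (by omega)).mono (hF (Nat.le_succ n)) le_rfl).max (he _ hn)

/-- A nonnegative adapted process, driven by a centered noise of size `√δt` and by a drift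
of size `δt`, both proportional to the process. -/
structure EnergyBalance (F : ℕ → MeasurableSpace Ω) (χ : ℕ → Ω → ℝ) (f : ℝ → ℝ) (C s e₀ : ℝ)
    (N : ℕ) (e x : ℕ → Ω → ℝ) : Prop where
  measurable_e : ∀ n ≤ N, Measurable[F n] (e n)
  measurable_x : ∀ n < N, Measurable[F n] (x n)
  nonneg : ∀ n ω, 0 ≤ e n ω
  init : ∀ ω, e 0 ω = e₀
  abs_x_le : ∀ n < N, ∀ ω, |x n ω| ≤ C * e n ω
  bound : ∀ n < N, ∀ ω, e (n + 1) ω ≤ 9 * e n ω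
  step : ∀ n < N, ∀ ω, |e (n + 1) ω - e n ω - s * (x n ω * f (χ n ω))| ≤
    C * s ^ 2 * cubeWeight (χ n ω) * e n ω

namespace EnergyBalance

variable {F : ℕ → MeasurableSpace Ω} {χ : ℕ → Ω → ℝ} {f : ℝ → ℝ} {C s e₀ : ℝ} {N : ℕ}
  {e x : ℕ → Ω → ℝ}

/-- This crude deterministic bound, useless as N grows, only serves to make all the integrals below
finite. -/
theorem le_pow (h : EnergyBalance F χ f C s e₀ N e x) {n : ℕ} (hn : n ≤ N) (ω : Ω) :
    e n ω ≤ 9 ^ n * e₀ := by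
  induction n with
  | zero => rw [h.init, pow_zero, one_mul]
  | succ n ih =>
    have := h.bound n (by omega) ω
    have := ih (by omega)
    rw [pow_succ]
    linarith

theorem runMax_nonneg (h : EnergyBalance F χ f C s e₀ N e x) (n : ℕ) (ω : Ω) :
    0 ≤ runMax (fun i => e i ω) n :=
  (h.nonneg n ω).trans (le_runMax (fun i => e i ω) le_rfl)

theorem le_pow_max (h : EnergyBalance F χ f C s e₀ N e x) {n : ℕ} (hn : n ≤ N) (ω : Ω) :
    runMax (fun i => e i ω) n ≤ 9 ^ N * e₀ := by
  have h0 : 0 ≤ e₀ := by rw [← h.init ω]; exact h.nonneg 0 ω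
  refine runMax_le fun i hi => (h.le_pow (hi.trans hn) ω).trans ?_
  gcongr
  · norm_num
  · omega

end EnergyBalance

variable [mΩ : MeasurableSpace Ω] {P : Measure Ω}

/-- A sequence of standard Gaussian variables, each independent of the past. -/
structure IsGaussianNoise (F : ℕ → MeasurableSpace Ω) (χ : ℕ → Ω → ℝ) (P : Measure Ω) :
    Prop where
  le : ∀ n, F n ≤ mΩ
  mono : Monotone F
  measurable : ∀ n, Measurable[F (n + 1)] (χ n)
  indep : ∀ n (Y : Ω → ℝ), Measurable[F n] Y → IndepFun Y (χ n) P
  law : ∀ n, HasLaw (χ n) (gaussianReal 0 1) P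

namespace IsGaussianNoise

variable {F : ℕ → MeasurableSpace Ω} {χ : ℕ → Ω → ℝ}

theorem integrable_mul_comp (h : IsGaussianNoise F χ P) {n : ℕ} {Y : Ω → ℝ} (hY : Measurable[F n] Y)
    {c : ℝ} (hc : ∀ ω, |Y ω| ≤ c) {f : ℝ → ℝ} (hf : Measurable f)
    (hfw : ∀ x, |f x| ≤ cubeWeight x ^ 2) : Integrable (fun ω => Y ω * f (χ n ω)) P := by
  have hχ : Measurable (χ n) := (h.measurable n).mono (h.le _) le_rfl
  have h1 : Integrable (fun ω => f (χ n ω)) P := by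
    have h2 : Integrable f (gaussianReal 0 1) :=
      integrable_cubeWeight_sq.mono' hf.aestronglyMeasurable (Filter.Eventually.of_forall hfw)
    rw [← (h.law n).map_eq] at h2
    exact h2.comp_measurable hχ
  exact h1.bdd_mul (hY.mono (h.le n) le_rfl).aestronglyMeasurable (Filter.Eventually.of_forall hc)

theorem integral_mul_comp (h : IsGaussianNoise F χ P) {n : ℕ} {Y : Ω → ℝ} (hY : Measurable[F n] Y)
    {f : ℝ → ℝ} (hf : Measurable f) :
    ∫ ω, Y ω * f (χ n ω) ∂P = (∫ ω, Y ω ∂P) * ∫ x, f x ∂(gaussianReal 0 1) := by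
  have hχ : Measurable (χ n) := (h.measurable n).mono (h.le _) le_rfl
  have h1 := (h.indep n Y hY).integral_fun_comp_mul_comp (f := id) (g := f)
    (hY.mono (h.le n) le_rfl).aemeasurable hχ.aemeasurable aestronglyMeasurable_id
    hf.aestronglyMeasurable
  have h2 := (h.law n).integral_comp (f := f) hf.aestronglyMeasurable
  simp only [id] at h1
  rw [h1, ← h2]
  rfl

theorem integral_mul_odd (h : IsGaussianNoise F χ P) {n : ℕ} {Y : Ω → ℝ} (hY : Measurable[F n] Y)
    {f : ℝ → ℝ} (hf : Measurable f) (hodd : ∀ x, f (-x) = -f x) :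
    ∫ ω, Y ω * f (χ n ω) ∂P = 0 := by
  rw [h.integral_mul_comp hY hf, integral_odd_gaussian hodd, mul_zero]

end IsGaussianNoise

namespace EnergyBalance

variable [IsProbabilityMeasure P] {F : ℕ → MeasurableSpace Ω} {χ : ℕ → Ω → ℝ} {f : ℝ → ℝ}
  {C s e₀ : ℝ} {N : ℕ} {e x : ℕ → Ω → ℝ}

/-- The term linear in s is centred since it multiplies an F_n-measurable factor by an odd function
of an independent Gaussian. In the constant, 2C comes from the product of e with the remainder and
4C² from the square of the increment. -/
theorem integral_sq_succ_le (h : EnergyBalance F χ f C s e₀ N e x) (hχ : IsGaussianNoise F χ P)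
    (hC : 0 ≤ C) (hs : 0 ≤ s) (hs1 : s ≤ 1) (hf : Measurable f) (hodd : ∀ x, f (-x) = -f x)
    (hfx : ∀ x, |f x| ≤ |x|) {n : ℕ} (hn : n < N) :
    ∫ ω, e (n + 1) ω ^ 2 ∂P ≤
      (1 + (2 * C + 4 * C ^ 2) * cubeMoment * s ^ 2) * ∫ ω, e n ω ^ 2 ∂P := by
  have hen := h.measurable_e n hn.le
  have hxn := h.measurable_x n hn
  have hpt : ∀ ω, e (n + 1) ω ^ 2 ≤ e n ω ^ 2 + 2 * s * (e n ω * x n ω * f (χ n ω)) +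
      (2 * C + 4 * C ^ 2) * s ^ 2 * (e n ω ^ 2 * cubeWeight (χ n ω) ^ 2) := by
    intro ω
    have h1 := h.step n hn ω
    have h2 := h.abs_x_le n hn ω
    have h3 := h.nonneg n ω
    have g1 := one_le_cubeWeight (χ n ω)
    have g2 := sq_le_cubeWeight (χ n ω)
    set g := cubeWeight (χ n ω) with hg
    set D := e (n + 1) ω - e n ω - s * (x n ω * f (χ n ω)) with hD
    have e1 : e (n + 1) ω = e n ω + s * (x n ω * f (χ n ω)) + D := by rw [hD]; ring
    have hgg : g ≤ g ^ 2 := by nlinarith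
    have b1 : 2 * e n ω * D ≤ 2 * C * s ^ 2 * (e n ω ^ 2 * g ^ 2) := by
      calc 2 * e n ω * D ≤ 2 * e n ω * (C * s ^ 2 * g * e n ω) := by
            gcongr; exact (le_abs_self D).trans h1
        _ = 2 * C * s ^ 2 * (e n ω ^ 2 * g) := by ring
        _ ≤ _ := by gcongr
    have b2 : (s * (x n ω * f (χ n ω))) ^ 2 ≤ C ^ 2 * s ^ 2 * (e n ω ^ 2 * g ^ 2) := by
      have c1 : x n ω ^ 2 ≤ (C * e n ω) ^ 2 := by rw [← sq_abs]; gcongr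
      have c2 : f (χ n ω) ^ 2 ≤ g ^ 2 := by
        calc f (χ n ω) ^ 2 ≤ χ n ω ^ 2 := sq_le_sq.2 (hfx _)
          _ ≤ g := g2
          _ ≤ g ^ 2 := hgg
      calc _ = s ^ 2 * (x n ω ^ 2 * f (χ n ω) ^ 2) := by ring
        _ ≤ s ^ 2 * ((C * e n ω) ^ 2 * g ^ 2) := by gcongr
        _ = _ := by ring
    have b3 : D ^ 2 ≤ C ^ 2 * s ^ 2 * (e n ω ^ 2 * g ^ 2) := by
      calc D ^ 2 = |D| ^ 2 := (sq_abs D).symm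
        _ ≤ (C * s ^ 2 * g * e n ω) ^ 2 := by gcongr
        _ = s ^ 2 * (C ^ 2 * s ^ 2 * (e n ω ^ 2 * g ^ 2)) := by ring
        _ ≤ 1 * (C ^ 2 * s ^ 2 * (e n ω ^ 2 * g ^ 2)) := by
            gcongr; exact pow_le_one₀ hs hs1
        _ = _ := one_mul _
    have b4 : (s * (x n ω * f (χ n ω)) + D) ^ 2 ≤ 2 * (s * (x n ω * f (χ n ω))) ^ 2 + 2 * D ^ 2 := by
      nlinarith [sq_nonneg (s * (x n ω * f (χ n ω)) - D)]
    rw [e1]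
    calc _ = e n ω ^ 2 + 2 * s * (e n ω * x n ω * f (χ n ω)) + 2 * e n ω * D +
          (s * (x n ω * f (χ n ω)) + D) ^ 2 := by ring
      _ ≤ _ := by linarith
  have hbd : ∀ ω, |e n ω| ≤ 9 ^ n * e₀ := fun ω => by
    rw [abs_of_nonneg (h.nonneg n ω)]; exact h.le_pow hn.le ω
  have hbx : ∀ ω, |e n ω * x n ω| ≤ 9 ^ n * e₀ * (C * (9 ^ n * e₀)) := fun ω => by
    rw [abs_mul]
    have h1 := hbd ω
    have h2 := (h.abs_x_le n hn ω).trans (mul_le_mul_of_nonneg_left (h.le_pow hn.le ω) hC)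
    have h3 : 0 ≤ 9 ^ n * e₀ := (abs_nonneg _).trans h1
    gcongr
  have hbsq : ∀ ω, |e n ω ^ 2| ≤ (9 ^ n * e₀) ^ 2 := fun ω => by
    rw [abs_pow]
    gcongr
    exact hbd ω
  have hmsq : Measurable[F n] (fun ω => e n ω ^ 2) := hen.pow_const 2
  have i1 : Integrable (fun ω => e n ω ^ 2) P :=
    Integrable.of_bound (hmsq.mono (hχ.le n) le_rfl).aestronglyMeasurable _
      (Filter.Eventually.of_forall hbsq)
  have hfw : ∀ x, |f x| ≤ cubeWeight x ^ 2 := fun x => (hfx x).trans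
    ((abs_le_cubeWeight x).trans (by nlinarith [one_le_cubeWeight x]))
  have i2 : Integrable (fun ω => e n ω * x n ω * f (χ n ω)) P :=
    hχ.integrable_mul_comp (hen.mul hxn) hbx hf hfw
  have i3 : Integrable (fun ω => e n ω ^ 2 * cubeWeight (χ n ω) ^ 2) P :=
    hχ.integrable_mul_comp (f := fun x => cubeWeight x ^ 2) hmsq hbsq
      (measurable_cubeWeight.pow_const 2) (fun x => by rw [abs_of_nonneg (sq_nonneg _)])
  have i4 : Integrable (fun ω => e (n + 1) ω ^ 2) P := by
    refine Integrable.of_bound (((h.measurable_e (n + 1) hn).pow_const 2).mono (hχ.le _)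
      le_rfl).aestronglyMeasurable ((9 ^ (n + 1) * e₀) ^ 2) (Filter.Eventually.of_forall fun ω => ?_)
    rw [Real.norm_eq_abs, abs_pow, abs_of_nonneg (h.nonneg _ ω)]
    have := h.nonneg (n + 1) ω
    gcongr
    exact h.le_pow hn ω
  have i12 : Integrable (fun ω => e n ω ^ 2 + 2 * s * (e n ω * x n ω * f (χ n ω))) P :=
    i1.add (i2.const_mul _)
  calc ∫ ω, e (n + 1) ω ^ 2 ∂P ≤ ∫ ω, (e n ω ^ 2 + 2 * s * (e n ω * x n ω * f (χ n ω)) +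
      (2 * C + 4 * C ^ 2) * s ^ 2 * (e n ω ^ 2 * cubeWeight (χ n ω) ^ 2)) ∂P :=
        integral_mono i4 (i12.add (i3.const_mul _)) hpt
    _ = _ := by
      rw [integral_add i12 (i3.const_mul _), integral_add i1 (i2.const_mul _),
        integral_const_mul, integral_const_mul,
        hχ.integral_mul_odd (Y := fun ω => e n ω * x n ω) (hen.mul hxn) hf hodd,
        hχ.integral_mul_comp (f := fun x => cubeWeight x ^ 2) hmsq
          (measurable_cubeWeight.pow_const 2)]
      rw [cubeMoment]
      ring

theorem integral_sq_le (h : EnergyBalance F χ f C s e₀ N e x) (hχ : IsGaussianNoise F χ P)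
    (hC : 0 ≤ C) (hs : 0 ≤ s) (hs1 : s ≤ 1) (hf : Measurable f) (hodd : ∀ x, f (-x) = -f x)
    (hfx : ∀ x, |f x| ≤ |x|) {n : ℕ} (hn : n ≤ N) :
    ∫ ω, e n ω ^ 2 ∂P ≤ e₀ ^ 2 * Real.exp ((2 * C + 4 * C ^ 2) * cubeMoment * (n * s ^ 2)) := by
  set a := (2 * C + 4 * C ^ 2) * cubeMoment with ha
  have ha0 : 0 ≤ a := by have := cubeMoment_nonneg; positivity
  have key : ∫ ω, e n ω ^ 2 ∂P ≤ e₀ ^ 2 * (1 + a * s ^ 2) ^ n := by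
    induction n with
    | zero => simp [h.init]
    | succ n ih =>
      refine (h.integral_sq_succ_le hχ hC hs hs1 hf hodd hfx hn).trans ?_
      rw [pow_succ (1 + a * s ^ 2), ← mul_assoc, mul_comm _ (1 + a * s ^ 2)]
      gcongr
      exact ih (by omega)
  refine key.trans ?_
  rw [show a * (n * s ^ 2) = n * (a * s ^ 2) by ring, Real.exp_nat_mul]
  gcongr
  linarith [Real.add_one_le_exp (a * s ^ 2)]

/-- In the pathwise Doob inequality the weights are running maxima up to the current time, hence
F_i-measurable, so the noise terms have zero mean. Only the drift survives, and it is ready for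
Gronwall's lemma. -/
theorem integral_runMax_sq_le (h : EnergyBalance F χ f C s e₀ N e x) (hχ : IsGaussianNoise F χ P)
    (hC : 0 ≤ C) (hf : Measurable f) (hodd : ∀ x, f (-x) = -f x)
    (hfx : ∀ x, |f x| ≤ |x|) {n : ℕ} (hn : n ≤ N) :
    ∫ ω, runMax (fun i => e i ω) n ^ 2 ∂P ≤ 4 * ∫ ω, e n ω ^ 2 ∂P +
      4 * C * cubeMoment * s ^ 2 * ∑ i ∈ Finset.range n, ∫ ω, runMax (fun i => e i ω) i ^ 2 ∂P := by
  set M : ℕ → Ω → ℝ := fun n ω => runMax (fun i => e i ω) n with hM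
  have hMm : ∀ n ≤ N, Measurable[F n] (M n) := measurable_runMax hχ.mono h.measurable_e
  have hM0 : ∀ n ω, 0 ≤ M n ω := h.runMax_nonneg
  have heM : ∀ n ω, e n ω ≤ M n ω := fun n ω => le_runMax (fun i => e i ω) le_rfl
  have hMb : ∀ n ≤ N, ∀ ω, |M n ω| ≤ 9 ^ N * e₀ := fun n hn ω => by
    rw [abs_of_nonneg (hM0 n ω)]; exact h.le_pow_max hn ω
  have hMsqb : ∀ n ≤ N, ∀ ω, |M n ω ^ 2| ≤ (9 ^ N * e₀) ^ 2 := fun n hn ω => by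
    rw [abs_pow]; gcongr; exact hMb n hn ω
  have hMsq : ∀ n ≤ N, Measurable[F n] (fun ω => M n ω ^ 2) := fun n hn => (hMm n hn).pow_const 2
  have iM : ∀ n ≤ N, Integrable (fun ω => M n ω ^ 2) P := fun n hn =>
    Integrable.of_bound ((hMsq n hn).mono (hχ.le n) le_rfl).aestronglyMeasurable _
      (Filter.Eventually.of_forall (hMsqb n hn))
  have ie : Integrable (fun ω => e n ω ^ 2) P := by
    refine (iM n hn).mono' (((h.measurable_e n hn).pow_const 2).mono (hχ.le n)
      le_rfl).aestronglyMeasurable (Filter.Eventually.of_forall fun ω => ?_)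
    rw [Real.norm_eq_abs, abs_of_nonneg (sq_nonneg _)]
    have := h.nonneg n ω
    gcongr
    exact heM n ω
  have hfw : ∀ x, |f x| ≤ cubeWeight x ^ 2 := fun x => (hfx x).trans
    ((abs_le_cubeWeight x).trans (by nlinarith [one_le_cubeWeight x]))
  have ix : ∀ i ∈ Finset.range n, Integrable (fun ω => M i ω * x i ω * f (χ i ω)) P := by
    intro i hi
    have hiN : i < N := (Finset.mem_range.1 hi).trans_le hn
    refine hχ.integrable_mul_comp ((hMm i hiN.le).mul (h.measurable_x i hiN))
      (c := 9 ^ N * e₀ * (C * (9 ^ N * e₀))) (fun ω => ?_) hf hfw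
    rw [Pi.mul_apply, abs_mul]
    have h1 := hMb i hiN.le ω
    have h2 : |x i ω| ≤ C * (9 ^ N * e₀) := (h.abs_x_le i hiN ω).trans (by
      gcongr; exact (heM i ω).trans ((le_abs_self _).trans h1))
    have h3 : 0 ≤ 9 ^ N * e₀ := (abs_nonneg _).trans h1
    gcongr
  have ig : ∀ i ∈ Finset.range n, Integrable (fun ω => M i ω ^ 2 * cubeWeight (χ i ω) ^ 2) P := by
    intro i hi
    have hiN : i < N := (Finset.mem_range.1 hi).trans_le hn
    exact hχ.integrable_mul_comp (f := fun x => cubeWeight x ^ 2) (hMsq i hiN.le) (hMsqb i hiN.le)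
      (measurable_cubeWeight.pow_const 2) (fun x => by rw [abs_of_nonneg (sq_nonneg _)])
  have hpt : ∀ ω, M n ω ^ 2 ≤ 4 * e n ω ^ 2 + ∑ i ∈ Finset.range n,
      ((-4 * s) * (M i ω * x i ω * f (χ i ω)) +
        4 * C * s ^ 2 * (M i ω ^ 2 * cubeWeight (χ i ω) ^ 2)) := by
    intro ω
    have h1 := runMax_sq_le (fun i => e i ω) n
    refine h1.trans ?_
    rw [sub_eq_add_neg, Finset.mul_sum, ← Finset.sum_neg_distrib]
    gcongr with i hi
    have hiN : i < N := (Finset.mem_range.1 hi).trans_le hn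
    have h2 := h.step i hiN ω
    have g1 := one_le_cubeWeight (χ i ω)
    set g := cubeWeight (χ i ω) with hg
    have hgg : g ≤ g ^ 2 := by nlinarith
    have h3 := (neg_abs_le (e (i + 1) ω - e i ω - s * (x i ω * f (χ i ω))))
    have h4 : e i ω ≤ M i ω := heM i ω
    have h5 := hM0 i ω
    have h6 : C * s ^ 2 * g * e i ω ≤ C * s ^ 2 * (M i ω * g ^ 2) := by
      calc _ = C * s ^ 2 * (e i ω * g) := by ring
        _ ≤ _ := by gcongr
    have h7 : -(e (i + 1) ω - e i ω) ≤ C * s ^ 2 * (M i ω * g ^ 2) - s * (x i ω * f (χ i ω)) := by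
      linarith
    change -(4 * (M i ω * (e (i + 1) ω - e i ω))) ≤ _
    nlinarith [mul_le_mul_of_nonneg_left h7 h5]
  have iadd : ∀ i ∈ Finset.range n, Integrable (fun ω => (-4 * s) * (M i ω * x i ω * f (χ i ω)) +
      4 * C * s ^ 2 * (M i ω ^ 2 * cubeWeight (χ i ω) ^ 2)) P :=
    fun i hi => ((ix i hi).const_mul _).add ((ig i hi).const_mul _)
  have isum : Integrable (fun ω => ∑ i ∈ Finset.range n,
      ((-4 * s) * (M i ω * x i ω * f (χ i ω)) +
        4 * C * s ^ 2 * (M i ω ^ 2 * cubeWeight (χ i ω) ^ 2))) P :=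
    integrable_finsetSum _ iadd
  calc ∫ ω, M n ω ^ 2 ∂P ≤ ∫ ω, (4 * e n ω ^ 2 + ∑ i ∈ Finset.range n,
      ((-4 * s) * (M i ω * x i ω * f (χ i ω)) +
        4 * C * s ^ 2 * (M i ω ^ 2 * cubeWeight (χ i ω) ^ 2))) ∂P :=
        integral_mono (iM n hn) ((ie.const_mul _).add isum) hpt
    _ = _ := by
      rw [integral_add (ie.const_mul _) isum, integral_const_mul,
        integral_finsetSum _ iadd,
        Finset.mul_sum]
      congr 1
      refine Finset.sum_congr rfl fun i hi => ?_
      have hiN : i < N := (Finset.mem_range.1 hi).trans_le hn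
      rw [integral_add ((ix i hi).const_mul _) ((ig i hi).const_mul _), integral_const_mul,
        integral_const_mul, hχ.integral_mul_odd (Y := fun ω => M i ω * x i ω)
          ((hMm i hiN.le).mul (h.measurable_x i hiN)) hf hodd,
        hχ.integral_mul_comp (f := fun x => cubeWeight x ^ 2) (hMsq i hiN.le)
          (measurable_cubeWeight.pow_const 2)]
      rw [cubeMoment]
      ring

/-- The maximal inequality for energy balances. -/
theorem lintegral_runMax_le (h : EnergyBalance F χ f C s e₀ N e x) (hχ : IsGaussianNoise F χ P)
    (hC : 0 ≤ C) (hs : 0 ≤ s) (hs1 : s ≤ 1) (hf : Measurable f) (hodd : ∀ x, f (-x) = -f x)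
    (hfx : ∀ x, |f x| ≤ |x|) {T : ℝ} (hT : N * s ^ 2 ≤ T) :
    ∫⁻ ω, ENNReal.ofReal (runMax (fun i => e i ω) N) ∂P ≤ ENNReal.ofReal
      ((4 * Real.exp ((2 * C + 4 * C ^ 2) * cubeMoment * T) *
        Real.exp (4 * C * cubeMoment * T) + 1) * e₀) := by
  have hm0 := cubeMoment_nonneg
  obtain ⟨ω₀⟩ : Nonempty Ω := P.nonempty_of_neZero
  have he0 : 0 ≤ e₀ := by rw [← h.init ω₀]; exact h.nonneg 0 ω₀
  set a := (2 * C + 4 * C ^ 2) * cubeMoment with ha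
  have ha0 : 0 ≤ a := by positivity
  set ε := 4 * C * cubeMoment * s ^ 2 with hε
  set A := 4 * (e₀ ^ 2 * Real.exp (a * T)) with hA
  have hb : ∀ n ≤ N, ∫ ω, runMax (fun i => e i ω) n ^ 2 ∂P ≤ A + ε *
      ∑ i ∈ Finset.range n, ∫ ω, runMax (fun i => e i ω) i ^ 2 ∂P := by
    intro n hn
    refine (h.integral_runMax_sq_le hχ hC hf hodd hfx hn).trans ?_
    have h1 := h.integral_sq_le hχ hC hs hs1 hf hodd hfx hn
    have h2 : Real.exp (a * (n * s ^ 2)) ≤ Real.exp (a * T) := by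
      have : (n : ℝ) ≤ N := by exact_mod_cast hn
      refine Real.exp_le_exp.2 ?_
      gcongr
      exact (mul_le_mul_of_nonneg_right this (sq_nonneg s)).trans hT
    rw [hA]
    gcongr
    exact h1.trans (by gcongr)
  have hG := gronwall_sum (by positivity) (by positivity) hb N le_rfl
  have hG2 : ∫ ω, runMax (fun i => e i ω) N ^ 2 ∂P ≤
      4 * Real.exp (a * T) * Real.exp (4 * C * cubeMoment * T) * e₀ ^ 2 := by
    refine hG.trans ?_
    have : ε * N ≤ 4 * C * cubeMoment * T := by
      rw [hε, mul_assoc, mul_comm (s ^ 2)]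
      gcongr
    calc A * Real.exp (ε * N) ≤ A * Real.exp (4 * C * cubeMoment * T) := by gcongr
      _ = _ := by rw [hA]; ring
  set Z := 4 * Real.exp (a * T) * Real.exp (4 * C * cubeMoment * T) with hZ
  have hMm : Measurable (fun ω => runMax (fun i => e i ω) N) :=
    (measurable_runMax hχ.mono h.measurable_e N le_rfl).mono (hχ.le N) le_rfl
  have iM : Integrable (fun ω => runMax (fun i => e i ω) N) P :=
    Integrable.of_bound hMm.aestronglyMeasurable (9 ^ N * e₀) (Filter.Eventually.of_forall fun ω => by
      rw [Real.norm_eq_abs, abs_of_nonneg (h.runMax_nonneg N ω)]; exact h.le_pow_max le_rfl ω)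
  have iM2 : Integrable (fun ω => runMax (fun i => e i ω) N ^ 2) P :=
    Integrable.of_bound (hMm.pow_const 2).aestronglyMeasurable ((9 ^ N * e₀) ^ 2)
      (Filter.Eventually.of_forall fun ω => by
        rw [Real.norm_eq_abs, abs_pow, abs_of_nonneg (h.runMax_nonneg N ω)]
        have := h.runMax_nonneg N ω
        gcongr
        exact h.le_pow_max le_rfl ω)
  rw [← ofReal_integral_eq_lintegral_ofReal iM
    (Filter.Eventually.of_forall fun ω => h.runMax_nonneg N ω)]
  refine ENNReal.ofReal_le_ofReal ?_
  rcases he0.eq_or_lt with h0 | h0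
  · rw [← h0, mul_zero]
    refine integral_nonpos fun ω => ?_
    have := h.le_pow_max (n := N) le_rfl ω
    rwa [← h0, mul_zero] at this
  -- The second moment is proportional to e₀² with e₀ deterministic, so this elementary inequality
  -- gives a first moment proportional to e₀. If e₀ = 0, the process vanishes by the crude bound.
  · have hpt : ∀ ω, runMax (fun i => e i ω) N ≤ runMax (fun i => e i ω) N ^ 2 / e₀ + e₀ := by
      intro ω
      have h1 : runMax (fun i => e i ω) N ^ 2 / e₀ + e₀ - runMax (fun i => e i ω) N =
          ((runMax (fun i => e i ω) N - e₀ / 2) ^ 2 + 3 / 4 * e₀ ^ 2) / e₀ := by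
        field_simp; ring
      have h2 : 0 ≤ ((runMax (fun i => e i ω) N - e₀ / 2) ^ 2 + 3 / 4 * e₀ ^ 2) / e₀ := by
        positivity
      linarith
    calc _ ≤ ∫ ω, (runMax (fun i => e i ω) N ^ 2 / e₀ + e₀) ∂P :=
          integral_mono iM ((iM2.div_const _).add (integrable_const _)) hpt
      _ = (∫ ω, runMax (fun i => e i ω) N ^ 2 ∂P) / e₀ + e₀ := by
          rw [integral_add (iM2.div_const _) (integrable_const _), integral_div]
          simp
      _ ≤ Z * e₀ ^ 2 / e₀ + e₀ := by gcongr
      _ = (Z + 1) * e₀ := by field_simp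

end EnergyBalance

end Probability

end GP

namespace GP

variable {d : ℕ}

/-! ### Solving one step of the scheme -/

/-- The fixed point map of one step of the scheme. -/
noncomputable def picard (B : ℕ → L2 d →L[ℂ] L2 d) (θ : ℝ → ℝ) (k L : ℕ) (δt : ℝ) (K : ℕ) (χ : ℝ)
    (u v : L2 d) : L2 d :=
  cayOp B δt K χ (Lam K 0 u) -
    (Complex.I * (δt : ℂ)) • resOp B δt K χ (nonK θ k L K (Lam K 0 u) (Lam K 0 v))

/-- The fixed point map, conjugated in order to be a contraction for the norm of `L²`. -/
noncomputable def picardConj (B : ℕ → L2 d →L[ℂ] L2 d) (θ : ℝ → ℝ) (k L : ℕ) (δt : ℝ) (K : ℕ)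
    (χ : ℝ) (u y : L2 d) : L2 d :=
  Lam K k (picard B θ k L δt K χ u (Lam K (-k) y))

/-- The solution of one step of the scheme, as the limit of the Picard iteration. -/
noncomputable def stepSol (B : ℕ → L2 d →L[ℂ] L2 d) (θ : ℝ → ℝ) (k L : ℕ) (δt : ℝ) (K : ℕ)
    (χ : ℝ) (u : L2 d) : L2 d :=
  Lam K (-k) (Filter.limUnder Filter.atTop fun m : ℕ => (picardConj B θ k L δt K χ u)^[m] 0)

section Step

variable {B : ℕ → L2 d →L[ℂ] L2 d} {θ : ℝ → ℝ} {k j L K : ℕ} {δt χ C₀ Cl Cg : ℝ} {u v G : L2 d}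

theorem picard_mem (hB : StabilityAssumption B) (hK : 1 ≤ K) (θ : ℝ → ℝ) (k L : ℕ) (δt χ : ℝ)
    (u v : L2 d) : picard B θ k L δt K χ u v ∈ SigmaK d K :=
  Submodule.sub_mem _ (cayOp_mem hB hK δt χ (Lam_mem K 0 u))
    (Submodule.smul_mem _ _ (resOp_mem hB hK δt χ (nonK_mem θ k L K _ _)))

theorem stepSol_mem (B : ℕ → L2 d →L[ℂ] L2 d) (θ : ℝ → ℝ) (k L : ℕ) (δt : ℝ) (K : ℕ)
    (χ : ℝ) (u : L2 d) : stepSol B θ k L δt K χ u ∈ SigmaK d K := Lam_mem _ _ _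

theorem continuous_halfOp (B : ℕ → L2 d →L[ℂ] L2 d) (δt : ℝ) (K : ℕ) :
    Continuous (halfOp B δt K) := by
  unfold halfOp
  have h : Continuous fun χ : ℝ => ((Real.sqrt δt / 2 * χ : ℝ) : ℂ) := by fun_prop
  exact continuous_const.add (h.smul continuous_const)

theorem continuous_resOp (hB : StabilityAssumption B) (hK : 1 ≤ K) (δt : ℝ) :
    Continuous (resOp B δt K) := by
  have h1 : Continuous fun χ => (1 : L2 d →L[ℂ] L2 d) + Complex.I • halfOp B δt K χ :=
    continuous_const.add ((continuous_halfOp B δt K).const_smul Complex.I)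
  refine continuous_iff_continuousAt.2 fun χ => ?_
  obtain ⟨U, hU⟩ := isUnit_one_add_I_smul (isSelfAdjoint_halfOp hB hK δt χ)
  have h2 := NormedRing.inverse_continuousAt U
  rw [hU] at h2
  exact ContinuousAt.comp (f := fun χ => (1 : L2 d →L[ℂ] L2 d) + Complex.I • halfOp B δt K χ)
    h2 h1.continuousAt

theorem continuous_cayOp (hB : StabilityAssumption B) (hK : 1 ≤ K) (δt : ℝ) :
    Continuous (cayOp B δt K) :=
  (continuous_resOp hB hK δt).mul
    (continuous_const.sub ((continuous_halfOp B δt K).const_smul Complex.I))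

/-- The projected nonlinearity is Lipschitz continuous on `Σ_K` with constant `C`. -/
def LipschitzNonK (d : ℕ) (θ : ℝ → ℝ) (k L : ℕ) (C : ℝ) : Prop :=
  ∀ (K : ℕ) (u u' v v' : L2 d), u ∈ SigmaK d K → u' ∈ SigmaK d K → v ∈ SigmaK d K →
    v' ∈ SigmaK d K → ‖Lam K k (nonK θ k L K u v - nonK θ k L K u' v')‖ ≤
      C * (‖Lam K k (u - u')‖ + ‖Lam K k (v - v')‖)

theorem LipschitzNonK.continuous [NeZero d] (hl : LipschitzNonK d θ k L Cl) (K : ℕ) :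
    Continuous fun p : L2 d × L2 d => nonK θ k L K (Lam K 0 p.1) (Lam K 0 p.2) := by
  refine continuous_iff_continuousAt.2 fun p => ?_
  rw [ContinuousAt, tendsto_iff_norm_sub_tendsto_zero]
  have hc : Continuous fun q : L2 d × L2 d => Cl * (‖Lam K k (Lam K 0 q.1 - Lam K 0 p.1)‖ +
      ‖Lam K k (Lam K 0 q.2 - Lam K 0 p.2)‖) := by
    have := (Lam K 0 : L2 d →L[ℂ] L2 d).continuous
    have := (Lam K k : L2 d →L[ℂ] L2 d).continuous
    fun_prop
  have h0 := hc.tendsto p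
  simp only [sub_self, map_zero, norm_zero, add_zero, mul_zero] at h0
  refine squeeze_zero (fun _ => norm_nonneg _) (fun q => ?_) h0
  refine (norm_le_norm_Lam (Submodule.sub_mem _ (nonK_mem θ k L K _ _) (nonK_mem θ k L K _ _))
    k).trans ?_
  exact hl K _ _ _ _ (Lam_mem _ _ _) (Lam_mem _ _ _) (Lam_mem _ _ _) (Lam_mem _ _ _)

/-- Joint continuity in the noise, the previous value and the iterate makes every Picard iterate
measurable; the solution inherits this as a pointwise limit. -/
theorem continuous_picardConj [NeZero d] (hB : StabilityAssumption B) (hK : 1 ≤ K)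
    (hl : LipschitzNonK d θ k L Cl) (δt : ℝ) :
    Continuous fun p : ℝ × L2 d × L2 d => picardConj B θ k L δt K p.1 p.2.1 p.2.2 := by
  have h1 : Continuous fun p : ℝ × L2 d × L2 d => cayOp B δt K p.1 (Lam K 0 p.2.1) :=
    ((continuous_cayOp hB hK δt).comp continuous_fst).clm_apply
      ((Lam K 0 : L2 d →L[ℂ] L2 d).continuous.comp (continuous_fst.comp continuous_snd))
  have hf : Continuous fun p : ℝ × L2 d × L2 d => ((p.2.1, Lam K (-k) p.2.2) : L2 d × L2 d) := by
    have := (Lam K (-k) : L2 d →L[ℂ] L2 d).continuous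
    fun_prop
  have h2 : Continuous fun p : ℝ × L2 d × L2 d =>
      nonK θ k L K (Lam K 0 p.2.1) (Lam K 0 (Lam K (-k) p.2.2)) :=
    (hl.continuous K).comp
      (f := fun p : ℝ × L2 d × L2 d => ((p.2.1, Lam K (-k) p.2.2) : L2 d × L2 d)) hf
  have h3 : Continuous fun p : ℝ × L2 d × L2 d => resOp B δt K p.1
      (nonK θ k L K (Lam K 0 p.2.1) (Lam K 0 (Lam K (-k) p.2.2))) :=
    ((continuous_resOp hB hK δt).comp continuous_fst).clm_apply h2
  exact (Lam K k : L2 d →L[ℂ] L2 d).continuous.comp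
    (h1.sub (h3.const_smul (Complex.I * (δt : ℂ))))

theorem norm_I_mul_ofReal {δt : ℝ} (h0 : 0 ≤ δt) : ‖Complex.I * (δt : ℂ)‖ = δt := by
  rw [norm_mul, Complex.norm_I, one_mul, Complex.norm_real, Real.norm_eq_abs, abs_of_nonneg h0]

/-- The nonlinearity is globally Lipschitz in the norm of order k, so the contraction is set there.
The resolvent bound √2 and the factor δt bring its constant below 1/2. -/
theorem norm_Lam_picard_sub_le [NeZero d] (hC : AdmissibleThreshold B j C₀)
    (hB : StabilityAssumption B) (hK : 1 ≤ K) (h0 : 0 < δt) (h1 : δt < 1)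
    (hχ : Real.sqrt δt * |χ| < C₀) (hkj : k ≤ j) (hl : LipschitzNonK d θ k L Cl)
    (hs : δt * (Real.sqrt 2 * Cl) ≤ 1 / 2) (u : L2 d) {v v' : L2 d} (hv : v ∈ SigmaK d K)
    (hv' : v' ∈ SigmaK d K) :
    ‖Lam K k (picard B θ k L δt K χ u v - picard B θ k L δt K χ u v')‖ ≤
      1 / 2 * ‖Lam K k (v - v')‖ := by
  have e : picard B θ k L δt K χ u v - picard B θ k L δt K χ u v' =
      -((Complex.I * (δt : ℂ)) • resOp B δt K χ
        (nonK θ k L K (Lam K 0 u) v - nonK θ k L K (Lam K 0 u) v')) := by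
    rw [picard, picard, Lam_zero_of_mem hv, Lam_zero_of_mem hv', map_sub, smul_sub]
    abel
  have h := hl K _ _ v v' (Lam_mem K 0 u) (Lam_mem K 0 u) hv hv'
  rw [sub_self, map_zero, norm_zero, zero_add] at h
  have h2 := hC.norm_resOp_le_of_le hB hK h0 h1 hχ hkj
    (Submodule.sub_mem _ (nonK_mem θ k L K (Lam K 0 u) v) (nonK_mem θ k L K (Lam K 0 u) v'))
  rw [e, map_neg, norm_neg, map_smul, norm_smul, norm_I_mul_ofReal h0.le]
  calc _ ≤ δt * (Real.sqrt 2 * (Cl * ‖Lam K k (v - v')‖)) :=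
        mul_le_mul_of_nonneg_left (h2.trans (mul_le_mul_of_nonneg_left h (Real.sqrt_nonneg 2))) h0.le
    _ = δt * (Real.sqrt 2 * Cl) * ‖Lam K k (v - v')‖ := by ring
    _ ≤ _ := mul_le_mul_of_nonneg_right hs (norm_nonneg _)

theorem contractingWith_picardConj [NeZero d] (hC : AdmissibleThreshold B j C₀)
    (hB : StabilityAssumption B) (hK : 1 ≤ K) (h0 : 0 < δt) (h1 : δt < 1)
    (hχ : Real.sqrt δt * |χ| < C₀) (hkj : k ≤ j) (hl : LipschitzNonK d θ k L Cl)
    (hs : δt * (Real.sqrt 2 * Cl) ≤ 1 / 2) (u : L2 d) :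
    ContractingWith (1 / 2) (picardConj B θ k L δt K χ u) := by
  refine ⟨by rw [div_lt_one] <;> norm_num, LipschitzWith.of_dist_le_mul fun y y' => ?_⟩
  rw [dist_eq_norm, dist_eq_norm, picardConj, picardConj, ← map_sub]
  refine (norm_Lam_picard_sub_le hC hB hK h0 h1 hχ hkj hl hs u (Lam_mem _ _ _)
    (Lam_mem _ _ _)).trans ?_
  rw [← map_sub, Lam_Lam, add_neg_cancel]
  push_cast
  exact mul_le_mul_of_nonneg_left (norm_Lam_zero_apply_le K _) (by norm_num)

theorem tendsto_picardConj_iterate [NeZero d] (hC : AdmissibleThreshold B j C₀)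
    (hB : StabilityAssumption B) (hK : 1 ≤ K) (h0 : 0 < δt) (h1 : δt < 1)
    (hχ : Real.sqrt δt * |χ| < C₀) (hkj : k ≤ j) (hl : LipschitzNonK d θ k L Cl)
    (hs : δt * (Real.sqrt 2 * Cl) ≤ 1 / 2) (u : L2 d) :
    Filter.Tendsto (fun m : ℕ => Lam K (-k) ((picardConj B θ k L δt K χ u)^[m] 0)) Filter.atTop
      (nhds (stepSol B θ k L δt K χ u)) := by
  have h := contractingWith_picardConj hC hB hK h0 h1 hχ hkj hl hs u
  exact ((Lam K (-k) : L2 d →L[ℂ] L2 d).continuous.tendsto _).comp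
    (tendsto_nhds_limUnder ⟨_, h.tendsto_iterate_fixedPoint 0⟩)

theorem stepSol_eq [NeZero d] (hC : AdmissibleThreshold B j C₀)
    (hB : StabilityAssumption B) (hK : 1 ≤ K) (h0 : 0 < δt) (h1 : δt < 1)
    (hχ : Real.sqrt δt * |χ| < C₀) (hkj : k ≤ j) (hl : LipschitzNonK d θ k L Cl)
    (hs : δt * (Real.sqrt 2 * Cl) ≤ 1 / 2) (u : L2 d) :
    stepSol B θ k L δt K χ u = picard B θ k L δt K χ u (stepSol B θ k L δt K χ u) := by
  have h := contractingWith_picardConj hC hB hK h0 h1 hχ hkj hl hs u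
  have hy : Filter.limUnder Filter.atTop (fun m : ℕ => (picardConj B θ k L δt K χ u)^[m] 0) =
      h.fixedPoint := (h.tendsto_iterate_fixedPoint 0).limUnder_eq
  have hf : picardConj B θ k L δt K χ u h.fixedPoint = h.fixedPoint := h.fixedPoint_isFixedPt
  have hV : stepSol B θ k L δt K χ u = Lam K (-k) h.fixedPoint := by rw [stepSol, hy]
  rw [hV]
  conv_lhs => rw [← hf, picardConj, Lam_Lam, neg_add_cancel,
    Lam_zero_of_mem (picard_mem hB hK θ k L δt χ _ _)]

/-- No membership in Σ_K is assumed: every value of the fixed point map lies in it. -/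
theorem eq_of_eq_picard [NeZero d] (hC : AdmissibleThreshold B j C₀)
    (hB : StabilityAssumption B) (hK : 1 ≤ K) (h0 : 0 < δt) (h1 : δt < 1)
    (hχ : Real.sqrt δt * |χ| < C₀) (hkj : k ≤ j) (hl : LipschitzNonK d θ k L Cl)
    (hs : δt * (Real.sqrt 2 * Cl) ≤ 1 / 2) {u v v' : L2 d}
    (hv : v = picard B θ k L δt K χ u v) (hv' : v' = picard B θ k L δt K χ u v') : v = v' := by
  have hm : v ∈ SigmaK d K := by rw [hv]; exact picard_mem hB hK _ _ _ _ _ _ _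
  have hm' : v' ∈ SigmaK d K := by rw [hv']; exact picard_mem hB hK _ _ _ _ _ _ _
  have h := norm_Lam_picard_sub_le hC hB hK h0 h1 hχ hkj hl hs u hm hm'
  rw [← hv, ← hv'] at h
  have h2 := norm_le_norm_Lam (Submodule.sub_mem _ hm hm') k
  have h3 : ‖v - v'‖ ≤ 0 := by linarith
  exact sub_eq_zero.1 (norm_le_zero_iff.1 h3)

/-- Multiplying by 1 + iH brings the step back to its midpoint form, the one required by the energy
identity. -/
theorem crank_nicolson_sub (hB : StabilityAssumption B) (hK : 1 ≤ K)
    (h : v = cayOp B δt K χ u - (Complex.I * (δt : ℂ)) • resOp B δt K χ G) :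
    v - u = -(Complex.I • (halfOp B δt K χ (u + v) + (δt : ℂ) • G)) := by
  have h1 := cayOp_sub hB hK δt χ u
  have h2 := resOp_spec hB hK δt χ G
  set H := halfOp B δt K χ
  set a := cayOp B δt K χ u
  set b := resOp B δt K χ G
  have h3 : v - u = (a - u) - (Complex.I * (δt : ℂ)) • b := by rw [h]; abel
  rw [h3, h1, h, ← h2]
  simp only [map_add, map_sub, map_smul, smul_add, smul_sub, smul_smul, neg_add]
  have e : Complex.I * ((δt : ℂ) * Complex.I) = Complex.I * (Complex.I * δt) := by ring
  rw [e]
  abel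

/-- With a and b the norms before and after the step, b ≤ √2 a + max(a, b)/2. As √2 ≤ 3/2, this
gives b ≤ 2a or b ≤ 3a according to which is larger. -/
theorem norm_Lam_step_le [NeZero d] (hC : AdmissibleThreshold B j C₀)
    (hB : StabilityAssumption B) (hK : 1 ≤ K) (h0 : 0 < δt) (h1 : δt < 1)
    (hχ : Real.sqrt δt * |χ| < C₀) (hs : δt * (Real.sqrt 2 * Cg) ≤ 1 / 2) (hu : u ∈ SigmaK d K)
    (hG : G ∈ SigmaK d K) (hGn : ‖Lam K j G‖ ≤ Cg * max ‖Lam K j u‖ ‖Lam K j v‖)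
    (h : v = cayOp B δt K χ u - (Complex.I * (δt : ℂ)) • resOp B δt K χ G) :
    ‖Lam K j v‖ ≤ 3 * ‖Lam K j u‖ := by
  have e : Lam K j v = Lam K j (cayOp B δt K χ u) -
      (Complex.I * (δt : ℂ)) • Lam K j (resOp B δt K χ G) := by
    conv_lhs => rw [h, map_sub, map_smul]
  have h2 := hC.norm_cayOp_le hB hK h0 h1 hχ hu
  have h3 := hC.norm_resOp_le hB hK h0 h1 hχ hG
  have h4 : ‖Lam K j v‖ ≤ ‖Lam K j (cayOp B δt K χ u)‖ + δt * ‖Lam K j (resOp B δt K χ G)‖ := by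
    rw [e]
    refine (norm_sub_le _ _).trans (le_of_eq ?_)
    rw [norm_smul, norm_I_mul_ofReal h0.le]
  have h5 : Real.sqrt 2 ≤ 3 / 2 := by
    rw [Real.sqrt_le_left (by norm_num)]; norm_num
  have ha := norm_nonneg (Lam K j u)
  have hb := norm_nonneg (Lam K j v)
  generalize ‖Lam K j v‖ = b at *
  generalize ‖Lam K j u‖ = a at *
  generalize ‖Lam K j (cayOp B δt K χ u)‖ = c at *
  generalize ‖Lam K j (resOp B δt K χ G)‖ = g at *
  have h6 : δt * g ≤ 1 / 2 * max a b := by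
    calc δt * g ≤ δt * (Real.sqrt 2 * (Cg * max a b)) :=
          mul_le_mul_of_nonneg_left (h3.trans (mul_le_mul_of_nonneg_left hGn (Real.sqrt_nonneg 2)))
            h0.le
      _ = δt * (Real.sqrt 2 * Cg) * max a b := by ring
      _ ≤ _ := mul_le_mul_of_nonneg_right hs (le_max_of_le_left ha)
  have h7 : Real.sqrt 2 * a ≤ 3 / 2 * a := mul_le_mul_of_nonneg_right h5 ha
  rcases max_cases a b with ⟨hm, _⟩ | ⟨hm, _⟩ <;> rw [hm] at h6 <;> linarith

end Step

end GP

namespace GP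

/-! ### The noise and the stopping time -/

section Noise

variable {Ω : Type*} {W : ℝ≥0 → Ω → ℝ} {δt C₀ : ℝ} {N : ℕ}

theorem grid_mono (h0 : 0 ≤ δt) : Monotone (grid δt) := fun m n h =>
  Real.toNNReal_le_toNNReal (by gcongr)

theorem grid_succ (h0 : 0 ≤ δt) (n : ℕ) : grid δt (n + 1) = grid δt n + Real.toNNReal δt := by
  rw [grid, grid, ← Real.toNNReal_add (by positivity) h0]
  push_cast
  ring_nf

theorem pastSigma_mono (h0 : 0 ≤ δt) : Monotone (pastSigma W δt) := fun _ _ h =>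
  iSup_mono fun _ => iSup_mono' fun hs => ⟨hs.trans (grid_mono h0 h), le_rfl⟩

theorem measurable_pastSigma {s : ℝ≥0} {n : ℕ} (h : s ≤ grid δt n) :
    Measurable[pastSigma W δt n] (W s) :=
  measurable_iff_comap_le.2
    (le_iSup₂ (f := fun (s : ℝ≥0) (_ : s ≤ grid δt n) => MeasurableSpace.comap (W s) _) s h)

theorem measurable_noise (h0 : 0 ≤ δt) (n : ℕ) : Measurable[pastSigma W δt (n + 1)] (noise W δt n) :=
  ((measurable_pastSigma le_rfl).sub (measurable_pastSigma (grid_mono h0 n.le_succ))).const_mul _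

theorem sqrt_mul_abs_noise (h0 : 0 < δt) (n : ℕ) (ω : Ω) :
    Real.sqrt δt * |noise W δt n ω| = |W (grid δt (n + 1)) ω - W (grid δt n) ω| := by
  have h := Real.sqrt_pos.2 h0
  rw [noise, abs_mul, abs_of_pos (inv_pos.2 h), mul_inv_cancel_left₀ h.ne']

/-- The step is active exactly when no increment up to the current one has reached the threshold.
The event thus depends on the current increment and is not F_n-measurable, which is why
`SchemeRegime.energyBalance` has to split it. -/
theorem lt_stopTime_iff (h0 : 0 < δt) {n : ℕ} {ω : Ω} (hn : n < N) :
    n + 1 < stopTime W δt N C₀ ω ↔ ∀ m ≤ n, Real.sqrt δt * |noise W δt m ω| < C₀ := by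
  simp only [sqrt_mul_abs_noise h0]
  constructor
  · intro h m hm
    by_contra! hc
    have : stopTime W δt N C₀ ω ≤ m + 1 := Nat.sInf_le (Or.inl ⟨by omega, by omega, hc⟩)
    omega
  · intro h
    have hne : ({n : ℕ | 1 ≤ n ∧ n ≤ N ∧ C₀ ≤ |W (grid δt n) ω - W (grid δt (n - 1)) ω|} ∪
        {N + 1}).Nonempty := ⟨N + 1, Or.inr rfl⟩
    rcases Nat.sInf_mem hne with ⟨h1, _, h3⟩ | h1
    · by_contra! hc
      change stopTime W δt N C₀ ω ≤ n + 1 at hc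
      change 1 ≤ stopTime W δt N C₀ ω at h1
      change C₀ ≤ |W (grid δt (stopTime W δt N C₀ ω)) ω -
        W (grid δt (stopTime W δt N C₀ ω - 1)) ω| at h3
      obtain ⟨m, hm⟩ := Nat.exists_eq_add_of_le' h1
      rw [hm, Nat.add_sub_cancel] at h3
      exact absurd (h m (by omega)) (not_lt.2 h3)
    · change stopTime W δt N C₀ ω = N + 1 at h1
      omega

theorem not_lt_stopTime {n : ℕ} {ω : Ω} (hn : N ≤ n) : ¬ n + 1 < stopTime W δt N C₀ ω := by
  have : stopTime W δt N C₀ ω ≤ N + 1 := Nat.sInf_le (Or.inr rfl)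
  omega

variable [mΩ : MeasurableSpace Ω] {P : Measure Ω}

theorem isGaussianNoise_noise (hW : IsPreBrownianReal W P) (hm : ∀ t, Measurable (W t))
    (h0 : 0 < δt) : IsGaussianNoise (pastSigma W δt) (noise W δt) P where
  le n := iSup₂_le fun s _ => (hm s).comap_le
  mono := pastSigma_mono h0.le
  measurable := measurable_noise h0.le
  indep n Y hY := by
    -- The noise is a function of the path shifted to start at t_n and Y is a function of the path
    -- up to t_n; these are independent for a Brownian motion.
    have h := (hW.indepFun_shift (grid δt n)).symm
    rw [IndepFun_iff_Indep] at h ⊢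
    refine indep_of_indep_of_le_left (indep_of_indep_of_le_right h ?_) ?_
    · rw [← measurable_iff_comap_le]
      have hp := (measurable_pi_apply (X := fun _ : ℝ≥0 => ℝ) (Real.toNNReal δt)).comp
        (comap_measurable (fun ω (t : ℝ≥0) => W (grid δt n + t) ω - W (grid δt n) ω))
      have := hp.const_mul (Real.sqrt δt)⁻¹
      convert this using 2 with ω
      simp only [noise, grid_succ h0.le, Function.comp_apply]
    · refine hY.comap_le.trans (iSup₂_le fun s hs => ?_)
      rw [← measurable_iff_comap_le]
      exact (measurable_pi_apply (X := fun _ : Set.Iic (grid δt n) => ℝ) ⟨s, hs⟩).comp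
        (comap_measurable (fun ω (t : Set.Iic (grid δt n)) => W t ω))
  law n := by
    have h := hW.hasLaw_sub (grid δt (n + 1)) (grid δt n)
    have hd : nndist (grid δt (n + 1) : ℝ) (grid δt n) = Real.toNNReal δt := by
      rw [grid_succ h0.le]
      ext
      rw [coe_nndist, Real.dist_eq]
      push_cast
      rw [add_sub_cancel_left, abs_of_nonneg (by positivity)]
    have h' : HasLaw (W (grid δt (n + 1)) - W (grid δt n)) (gaussianReal 0 (Real.toNNReal δt)) P := by
      rw [← hd]; exact h
    have h2 : HasLaw (fun x : ℝ => (Real.sqrt δt)⁻¹ * x) (gaussianReal 0 1)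
        (gaussianReal 0 (Real.toNNReal δt)) := by
      refine ⟨by fun_prop, ?_⟩
      rw [gaussianReal_map_const_mul, mul_zero]
      congr 1
      ext
      simp only [NNReal.coe_mul, NNReal.coe_mk, NNReal.coe_one, inv_pow, Real.sq_sqrt h0.le,
        Real.coe_toNNReal _ h0.le]
      exact inv_mul_cancel₀ h0.ne'
    exact h2.comp h'

end Noise

end GP

namespace GP

variable {d : ℕ}

/-! ### The solution of the scheme -/

/-- The parameters are such that each step of the scheme is uniquely solvable. -/
structure SchemeRegime (B : ℕ → L2 d →L[ℂ] L2 d) (θ : ℝ → ℝ) (k j L K : ℕ) (C₀ δt Cl Cg : ℝ) :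
    Prop where
  assumption : StabilityAssumption B
  admissible : AdmissibleThreshold B j C₀
  one_le : 1 ≤ K
  pos : 0 < δt
  lt_one : δt < 1
  le : k ≤ j
  lipschitz : LipschitzNonK d θ k L Cl
  lipschitz_small : δt * (Real.sqrt 2 * Cl) ≤ 1 / 2
  growth : ∀ (K : ℕ) (u v : L2 d), u ∈ SigmaK d K → v ∈ SigmaK d K →
    ‖Lam K j (nonK θ k L K u v)‖ ≤ Cg * max ‖Lam K j u‖ ‖Lam K j v‖
  growth_nonneg : 0 ≤ Cg
  growth_small : δt * (Real.sqrt 2 * Cg) ≤ 1 / 2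

/-- The solution of the scheme. -/
noncomputable def schemeSol {Ω : Type*} (W : ℝ≥0 → Ω → ℝ) (B : ℕ → L2 d →L[ℂ] L2 d) (θ : ℝ → ℝ)
    (k L K N : ℕ) (C₀ δt : ℝ) (φ₀ : L2 d) : ℕ → Ω → L2 d
  | 0, _ => projK K φ₀
  | n + 1, ω => if n + 1 < stopTime W δt N C₀ ω then
      stepSol B θ k L δt K (noise W δt n ω) (schemeSol W B θ k L K N C₀ δt φ₀ n ω)
    else schemeSol W B θ k L K N C₀ δt φ₀ n ω

section Solution

variable {Ω : Type*} {W : ℝ≥0 → Ω → ℝ} {B : ℕ → L2 d →L[ℂ] L2 d} {θ : ℝ → ℝ} {k j L K N : ℕ}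
  {C₀ δt Cl Cg : ℝ} {φ₀ : L2 d}

theorem schemeSol_mem (n : ℕ) (ω : Ω) : schemeSol W B θ k L K N C₀ δt φ₀ n ω ∈ SigmaK d K := by
  induction n with
  | zero => exact projK_mem K φ₀
  | succ n ih =>
    rw [schemeSol]
    split_ifs
    · exact stepSol_mem _ _ _ _ _ _ _ _
    · exact ih

theorem schemeSol_succ_of_not {n : ℕ} {ω : Ω} (h : ¬ n + 1 < stopTime W δt N C₀ ω) :
    schemeSol W B θ k L K N C₀ δt φ₀ (n + 1) ω = schemeSol W B θ k L K N C₀ δt φ₀ n ω := by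
  rw [schemeSol, if_neg h]

theorem SchemeRegime.noise_lt (hR : SchemeRegime B θ k j L K C₀ δt Cl Cg) {n : ℕ} {ω : Ω}
    (h : n + 1 < stopTime W δt N C₀ ω) : Real.sqrt δt * |noise W δt n ω| < C₀ := by
  have hn : n < N := by
    by_contra! hc
    exact not_lt_stopTime hc h
  exact (lt_stopTime_iff hR.pos hn).1 h n le_rfl

theorem picard_of_mem {χ : ℝ} {u v : L2 d} (hu : u ∈ SigmaK d K) (hv : v ∈ SigmaK d K) :
    picard B θ k L δt K χ u v =
      cayOp B δt K χ u - (Complex.I * (δt : ℂ)) • resOp B δt K χ (nonK θ k L K u v) := by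
  rw [picard, Lam_zero_of_mem hu, Lam_zero_of_mem hv]

theorem SchemeRegime.schemeSol_succ [NeZero d] (hR : SchemeRegime B θ k j L K C₀ δt Cl Cg)
    {n : ℕ} {ω : Ω} (h : n + 1 < stopTime W δt N C₀ ω) :
    schemeSol W B θ k L K N C₀ δt φ₀ (n + 1) ω = picard B θ k L δt K (noise W δt n ω)
      (schemeSol W B θ k L K N C₀ δt φ₀ n ω) (schemeSol W B θ k L K N C₀ δt φ₀ (n + 1) ω) := by
  have hs := stepSol_eq hR.admissible hR.assumption hR.one_le hR.pos hR.lt_one (hR.noise_lt h)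
    hR.le hR.lipschitz hR.lipschitz_small (schemeSol W B θ k L K N C₀ δt φ₀ n ω)
  have e : schemeSol W B θ k L K N C₀ δt φ₀ (n + 1) ω =
      stepSol B θ k L δt K (noise W δt n ω) (schemeSol W B θ k L K N C₀ δt φ₀ n ω) := by
    rw [schemeSol, if_pos h]
  rw [e]
  exact hs

/-- The truncated noise: large increments are replaced by zero. -/
noncomputable def cutNoise (δt C₀ : ℝ) (x : ℝ) : ℝ := if Real.sqrt δt * |x| < C₀ then x else 0

theorem measurable_cutNoise (δt C₀ : ℝ) : Measurable (cutNoise δt C₀) :=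
  Measurable.ite (measurableSet_lt (by fun_prop) measurable_const) measurable_id measurable_const

/-- The truncation is symmetric, so the truncated increments remain centred under the Gaussian law.
-/
theorem cutNoise_neg (δt C₀ x : ℝ) : cutNoise δt C₀ (-x) = -cutNoise δt C₀ x := by
  unfold cutNoise
  rw [abs_neg]
  split_ifs <;> simp

theorem abs_cutNoise_le (δt C₀ x : ℝ) : |cutNoise δt C₀ x| ≤ |x| := by
  unfold cutNoise
  split_ifs <;> simp

theorem sqrt_mul_abs_cutNoise_lt (hC : 0 < C₀) (x : ℝ) :
    Real.sqrt δt * |cutNoise δt C₀ x| < C₀ := by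
  unfold cutNoise
  split_ifs with h
  · exact h
  · simpa using hC

theorem measurableSet_lt_stopTime (h0 : 0 < δt) {n : ℕ} (hn : n < N) :
    MeasurableSet[pastSigma W δt (n + 1)] {ω | n + 1 < stopTime W δt N C₀ ω} := by
  have : {ω | n + 1 < stopTime W δt N C₀ ω} =
      ⋂ m : ℕ, ⋂ _ : m ≤ n, {ω | Real.sqrt δt * |noise W δt m ω| < C₀} := by
    ext ω
    simp only [mem_ofPred_eq, mem_iInter, lt_stopTime_iff h0 hn]
  rw [this]
  refine MeasurableSet.iInter fun m => MeasurableSet.iInter fun hm => ?_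
  have hx : Measurable[pastSigma W δt (n + 1)] (noise W δt m) :=
    (measurable_noise h0.le m).mono (pastSigma_mono h0.le (by omega)) le_rfl
  have hg : Measurable fun x : ℝ => Real.sqrt δt * |x| := by fun_prop
  exact (hg.comp hx) measurableSet_Iio

theorem stronglyMeasurable_iterate {X Y E : Type*} [TopologicalSpace X] [TopologicalSpace Y]
    [TopologicalSpace E] {m : MeasurableSpace Ω} {Φ : X → Y → E → E}
    (hΦ : Continuous fun p : X × Y × E => Φ p.1 p.2.1 p.2.2) {x : Ω → X} {y : Ω → Y}
    (hx : StronglyMeasurable x) (hy : StronglyMeasurable y) (z : E) (n : ℕ) :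
    StronglyMeasurable fun ω => (Φ (x ω) (y ω))^[n] z := by
  induction n with
  | zero => exact stronglyMeasurable_const
  | succ n ih =>
    simp only [Function.iterate_succ_apply']
    exact hΦ.comp_stronglyMeasurable (hx.prodMk (hy.prodMk ih))

/-- With the truncated noise, which agrees with the true one on active steps, the Picard iteration
converges for every ω. Measurability is thus obtained before restricting to the event where the step
is active. -/
theorem SchemeRegime.stronglyMeasurable_stepSol [NeZero d]
    (hR : SchemeRegime B θ k j L K C₀ δt Cl Cg) {m : MeasurableSpace Ω} {x : Ω → ℝ} {y : Ω → L2 d}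
    (hx : StronglyMeasurable fun ω => cutNoise δt C₀ (x ω)) (hy : StronglyMeasurable y) :
    StronglyMeasurable fun ω => stepSol B θ k L δt K (cutNoise δt C₀ (x ω)) (y ω) := by
  have hit := fun n : ℕ => (Lam K (-k) : L2 d →L[ℂ] L2 d).continuous.comp_stronglyMeasurable
    (stronglyMeasurable_iterate (continuous_picardConj hR.assumption hR.one_le hR.lipschitz δt)
      hx hy 0 n)
  refine stronglyMeasurable_of_tendsto Filter.atTop hit (tendsto_pi_nhds.2 fun ω => ?_)
  exact tendsto_picardConj_iterate hR.admissible hR.assumption hR.one_le hR.pos hR.lt_one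
    (sqrt_mul_abs_cutNoise_lt hR.admissible.1 _) hR.le hR.lipschitz hR.lipschitz_small _

theorem SchemeRegime.stronglyMeasurable [NeZero d] (hR : SchemeRegime B θ k j L K C₀ δt Cl Cg)
    {n : ℕ} (hn : n ≤ N) :
    StronglyMeasurable[pastSigma W δt n] (schemeSol W B θ k L K N C₀ δt φ₀ n) := by
  induction n with
  | zero => exact stronglyMeasurable_const
  | succ n ih =>
    have hu : StronglyMeasurable[pastSigma W δt (n + 1)] (schemeSol W B θ k L K N C₀ δt φ₀ n) :=
      (ih (by omega)).mono (pastSigma_mono hR.pos.le n.le_succ)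
    have hχ : StronglyMeasurable[pastSigma W δt (n + 1)]
        (fun ω => cutNoise δt C₀ (noise W δt n ω)) :=
      ((measurable_cutNoise δt C₀).comp (measurable_noise hR.pos.le n)).stronglyMeasurable
    have hlim := hR.stronglyMeasurable_stepSol hχ hu
    have e : schemeSol W B θ k L K N C₀ δt φ₀ (n + 1) = fun ω =>
        if n + 1 < stopTime W δt N C₀ ω then
          stepSol B θ k L δt K (cutNoise δt C₀ (noise W δt n ω))
            (schemeSol W B θ k L K N C₀ δt φ₀ n ω)
        else schemeSol W B θ k L K N C₀ δt φ₀ n ω := by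
      funext ω
      rw [schemeSol]
      split_ifs with h
      · rw [cutNoise, if_pos (hR.noise_lt h)]
      · rfl
    rw [e]
    exact StronglyMeasurable.ite (measurableSet_lt_stopTime hR.pos (by omega)) hlim hu

theorem continuous_comForm (B : ℕ → L2 d →L[ℂ] L2 d) (K j : ℕ) : Continuous (comForm B K j) :=
  Complex.continuous_im.comp
    (continuous_id.inner (StabilityAssumption.comm B K j).continuous)

/-- The step of the scheme is not stopped before the step from `t_n` to `t_{n+1}`. -/
theorem measurableSet_forall_noise_lt (h0 : 0 < δt) (n : ℕ) :
    MeasurableSet[pastSigma W δt n] {ω | ∀ m < n, Real.sqrt δt * |noise W δt m ω| < C₀} := by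
  rcases n with _ | n
  · simp
  · have := measurableSet_lt_stopTime (W := W) (C₀ := C₀) h0 (Nat.lt_succ_self n)
    simpa only [lt_stopTime_iff h0 (Nat.lt_succ_self n), Nat.lt_succ_iff] using this

-- The indicator of an active step is split in two. The part about earlier increments is
-- F_n-measurable and goes into the coefficient x; the part about the current one is put in
-- `cutNoise`, which is odd. The first order term therefore stays centred despite the stopping, and
-- on inactive steps both sides vanish.
open Classical in
theorem SchemeRegime.energyBalance [NeZero d] {r : ℝ}
    (hR : SchemeRegime B θ k j L K C₀ (r ^ 4) Cl Cg) (hr : 0 < r) {C C' : ℝ} (hC : 0 < C)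
    (hC' : 0 < C') (hq : ∀ u : L2 d, |comForm B K j u| ≤ C' * ‖Lam K j u‖ ^ 2)
    (hE : ∀ χ m : ℝ, ∀ u v G : L2 d, ‖Lam K j u‖ ≤ m → ‖Lam K j v‖ ≤ m → ‖Lam K j G‖ ≤ Cg * m →
      v - u = -(Complex.I • (halfOp B (r ^ 4) K χ (u + v) + ((r ^ 4 : ℝ) : ℂ) • G)) →
      |‖Lam K j v‖ ^ 2 - ‖Lam K j u‖ ^ 2 - r ^ 2 * χ * comForm B K j u| ≤
        C * r ^ 4 * (1 + |χ| ^ 3) * m ^ 2) :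
    EnergyBalance (pastSigma W (r ^ 4)) (noise W (r ^ 4)) (cutNoise (r ^ 4) C₀) (C' + 9 * C)
      (r ^ 2) (‖Lam K j φ₀‖ ^ 2) N
      (fun n ω => ‖Lam K j (schemeSol W B θ k L K N C₀ (r ^ 4) φ₀ n ω)‖ ^ 2)
      (fun n ω => if ∀ m < n, Real.sqrt (r ^ 4) * |noise W (r ^ 4) m ω| < C₀ then
        comForm B K j (schemeSol W B θ k L K N C₀ (r ^ 4) φ₀ n ω) else 0) where
  measurable_e n hn :=
    (((Lam K j : L2 d →L[ℂ] L2 d).continuous.norm.pow 2).comp_stronglyMeasurable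
      (hR.stronglyMeasurable hn)).measurable
  measurable_x n hn := Measurable.ite (measurableSet_forall_noise_lt hR.pos n)
    ((continuous_comForm B K j).comp_stronglyMeasurable (hR.stronglyMeasurable hn.le)).measurable
    measurable_const
  nonneg n ω := by positivity
  init ω := by
    change ‖Lam K j (projK K φ₀)‖ ^ 2 = _
    rw [Lam_projK]
  abs_x_le n hn ω := by
    split_ifs
    · refine (hq _).trans (mul_le_mul_of_nonneg_right (by linarith) (by positivity))
    · rw [abs_zero]; positivity
  bound n hn ω := by
    by_cases h : n + 1 < stopTime W (r ^ 4) N C₀ ω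
    · have hs := hR.schemeSol_succ (φ₀ := φ₀) h
      have hu := schemeSol_mem (W := W) (B := B) (θ := θ) (k := k) (L := L) (K := K) (N := N)
        (C₀ := C₀) (δt := r ^ 4) (φ₀ := φ₀) n ω
      have hv := schemeSol_mem (W := W) (B := B) (θ := θ) (k := k) (L := L) (K := K) (N := N)
        (C₀ := C₀) (δt := r ^ 4) (φ₀ := φ₀) (n + 1) ω
      generalize schemeSol W B θ k L K N C₀ (r ^ 4) φ₀ n ω = u at *
      generalize schemeSol W B θ k L K N C₀ (r ^ 4) φ₀ (n + 1) ω = v at *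
      rw [picard_of_mem hu hv] at hs
      have h3 := norm_Lam_step_le hR.admissible hR.assumption hR.one_le hR.pos hR.lt_one
        (hR.noise_lt h) hR.growth_small hu (nonK_mem θ k L K u v) (hR.growth K u v hu hv) hs
      calc ‖Lam K j v‖ ^ 2 ≤ (3 * ‖Lam K j u‖) ^ 2 := pow_le_pow_left₀ (norm_nonneg _) h3 2
        _ = _ := by ring
    · rw [schemeSol_succ_of_not h]
      exact le_mul_of_one_le_left (by positivity) (by norm_num)
  step n hn ω := by
    have hw := one_le_cubeWeight (noise W (r ^ 4) n ω)
    by_cases h : n + 1 < stopTime W (r ^ 4) N C₀ ω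
    · have hs := hR.schemeSol_succ (φ₀ := φ₀) h
      have hu := schemeSol_mem (W := W) (B := B) (θ := θ) (k := k) (L := L) (K := K) (N := N)
        (C₀ := C₀) (δt := r ^ 4) (φ₀ := φ₀) n ω
      have hv := schemeSol_mem (W := W) (B := B) (θ := θ) (k := k) (L := L) (K := K) (N := N)
        (C₀ := C₀) (δt := r ^ 4) (φ₀ := φ₀) (n + 1) ω
      have hal : ∀ m < n, Real.sqrt (r ^ 4) * |noise W (r ^ 4) m ω| < C₀ := fun m hm =>
        (lt_stopTime_iff hR.pos hn).1 h m hm.le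
      rw [if_pos hal, cutNoise, if_pos (hR.noise_lt h)]
      generalize schemeSol W B θ k L K N C₀ (r ^ 4) φ₀ n ω = u at *
      generalize schemeSol W B θ k L K N C₀ (r ^ 4) φ₀ (n + 1) ω = v at *
      rw [picard_of_mem hu hv] at hs
      have hg := hR.growth K u v hu hv
      have h3 := norm_Lam_step_le hR.admissible hR.assumption hR.one_le hR.pos hR.lt_one
        (hR.noise_lt h) hR.growth_small hu (nonK_mem θ k L K u v) hg hs
      -- The common bound m = 3‖u‖ holds at both ends of the step; its square is the origin of the 9
      -- in the constant.
      have h1 : ‖Lam K j u‖ ≤ 3 * ‖Lam K j u‖ := le_mul_of_one_le_left (norm_nonneg _) (by norm_num)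
      have := hE (noise W (r ^ 4) n ω) (3 * ‖Lam K j u‖) u v (nonK θ k L K u v) h1 h3
        (hg.trans (mul_le_mul_of_nonneg_left (max_le h1 h3) hR.growth_nonneg))
        (crank_nicolson_sub hR.assumption hR.one_le hs)
      rw [show r ^ 2 * (comForm B K j u * noise W (r ^ 4) n ω) =
        r ^ 2 * noise W (r ^ 4) n ω * comForm B K j u by ring]
      refine this.trans ?_
      rw [cubeWeight] at hw ⊢
      calc C * r ^ 4 * (1 + |noise W (r ^ 4) n ω| ^ 3) * (3 * ‖Lam K j u‖) ^ 2 =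
          9 * C * ((r ^ 2) ^ 2 * (1 + |noise W (r ^ 4) n ω| ^ 3) * ‖Lam K j u‖ ^ 2) := by ring
        _ ≤ (C' + 9 * C) * ((r ^ 2) ^ 2 * (1 + |noise W (r ^ 4) n ω| ^ 3) * ‖Lam K j u‖ ^ 2) :=
          mul_le_mul_of_nonneg_right (by linarith) (by positivity)
        _ = _ := by ring
    · have hz : (if ∀ m < n, Real.sqrt (r ^ 4) * |noise W (r ^ 4) m ω| < C₀ then
          comForm B K j (schemeSol W B θ k L K N C₀ (r ^ 4) φ₀ n ω) else 0) *
            cutNoise (r ^ 4) C₀ (noise W (r ^ 4) n ω) = 0 := by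
        rw [lt_stopTime_iff hR.pos hn] at h
        by_cases hal : ∀ m < n, Real.sqrt (r ^ 4) * |noise W (r ^ 4) m ω| < C₀
        · have : ¬ Real.sqrt (r ^ 4) * |noise W (r ^ 4) n ω| < C₀ := fun hc =>
            h fun m hm => (Nat.lt_or_eq_of_le hm).elim (hal m) fun e => e ▸ hc
          rw [cutNoise, if_neg this, mul_zero]
        · rw [if_neg hal, zero_mul]
      rw [hz, schemeSol_succ_of_not h, sub_self, mul_zero, sub_zero, abs_zero]
      positivity

end Solution

end GP

namespace GP

variable {d : ℕ}

/-! ### Existence, uniqueness and moments -/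

section Existence

variable {Ω : Type*} {W : ℝ≥0 → Ω → ℝ} {B : ℕ → L2 d →L[ℂ] L2 d} {θ : ℝ → ℝ} {k j L K N : ℕ}
  {C₀ δt Cl Cg : ℝ} {φ₀ : L2 d}

theorem SchemeRegime.schemeSol_step [NeZero d] (hR : SchemeRegime B θ k j L K C₀ δt Cl Cg)
    (n : ℕ) (ω : Ω) :
    schemeSol W B θ k L K N C₀ δt φ₀ (n + 1) ω =
      opS W B δt N K C₀ n ω (schemeSol W B θ k L K N C₀ δt φ₀ n ω) -
        (Complex.I * (δt : ℂ)) • opTinv W B δt N K C₀ n ω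
          (projK K (nonlin θ k L (schemeSol W B θ k L K N C₀ δt φ₀ n ω)
            (schemeSol W B θ k L K N C₀ δt φ₀ (n + 1) ω))) := by
  by_cases h : n + 1 < stopTime W δt N C₀ ω
  · have hs := hR.schemeSol_succ (φ₀ := φ₀) h
    have hu := schemeSol_mem (W := W) (B := B) (θ := θ) (k := k) (L := L) (K := K) (N := N)
      (C₀ := C₀) (δt := δt) (φ₀ := φ₀) n ω
    have hv := schemeSol_mem (W := W) (B := B) (θ := θ) (k := k) (L := L) (K := K) (N := N)
      (C₀ := C₀) (δt := δt) (φ₀ := φ₀) (n + 1) ω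
    generalize schemeSol W B θ k L K N C₀ δt φ₀ n ω = u at *
    generalize schemeSol W B θ k L K N C₀ δt φ₀ (n + 1) ω = v at *
    rw [picard_of_mem hu hv] at hs
    rw [opS, if_pos h, opTinv, if_pos h, projK_nonlin hu hv, cayley_eq hR.assumption hR.one_le _ _ hu,
      resolvent_eq hR.assumption hR.one_le _ _ (nonK_mem θ k L K u v)]
    exact hs
  · rw [opS, if_neg h, opTinv, if_neg h, smul_zero, sub_zero, schemeSol_succ_of_not h]

theorem SchemeRegime.eq_schemeSol_succ [NeZero d] (hR : SchemeRegime B θ k j L K C₀ δt Cl Cg)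
    {n : ℕ} {ω : Ω} {v : L2 d}
    (hv : v = opS W B δt N K C₀ n ω (schemeSol W B θ k L K N C₀ δt φ₀ n ω) -
      (Complex.I * (δt : ℂ)) • opTinv W B δt N K C₀ n ω
        (projK K (nonlin θ k L (schemeSol W B θ k L K N C₀ δt φ₀ n ω) v))) :
    v = schemeSol W B θ k L K N C₀ δt φ₀ (n + 1) ω := by
  by_cases h : n + 1 < stopTime W δt N C₀ ω
  · have hs := hR.schemeSol_succ (φ₀ := φ₀) h
    have hu := schemeSol_mem (W := W) (B := B) (θ := θ) (k := k) (L := L) (K := K) (N := N)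
      (C₀ := C₀) (δt := δt) (φ₀ := φ₀) n ω
    generalize schemeSol W B θ k L K N C₀ δt φ₀ n ω = u at *
    generalize schemeSol W B θ k L K N C₀ δt φ₀ (n + 1) ω = v' at *
    rw [opS, if_pos h, opTinv, if_pos h, cayley_eq hR.assumption hR.one_le _ _ hu,
      resolvent_eq hR.assumption hR.one_le _ _ (projK_mem K _)] at hv
    -- A competing solution is not assumed to take values in Σ_K, but the right side of the scheme
    -- does. Only then can the nonlinearity be rewritten as `nonK`.
    have hvm : v ∈ SigmaK d K := by
      rw [hv]
      exact Submodule.sub_mem _ (cayOp_mem hR.assumption hR.one_le _ _ hu)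
        (Submodule.smul_mem _ _ (resOp_mem hR.assumption hR.one_le _ _ (projK_mem K _)))
    rw [projK_nonlin hu hvm, ← picard_of_mem hu hvm] at hv
    exact eq_of_eq_picard hR.admissible hR.assumption hR.one_le hR.pos hR.lt_one (hR.noise_lt h)
      hR.le hR.lipschitz hR.lipschitz_small hv hs
  · rw [opS, if_neg h, opTinv, if_neg h, smul_zero, sub_zero] at hv
    rw [hv, schemeSol_succ_of_not h]

variable [MeasurableSpace Ω] {P : Measure Ω}

theorem SchemeRegime.isSchemeSolution [NeZero d] (hR : SchemeRegime B θ k j L K C₀ δt Cl Cg)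
    (h : expSup P j N (schemeSol W B θ k L K N C₀ δt φ₀) < ∞) :
    IsSchemeSolution W P B θ k j L K N C₀ δt φ₀ (schemeSol W B θ k L K N C₀ δt φ₀) where
  adapted _ hn := hR.stronglyMeasurable hn
  mem := Filter.Eventually.of_forall fun ω n _ => memSigma_of_mem (schemeSol_mem n ω) j
  moment := h
  init := Filter.Eventually.of_forall fun _ => rfl
  step := Filter.Eventually.of_forall fun ω n _ => hR.schemeSol_step n ω

theorem SchemeRegime.ae_eq_schemeSol [NeZero d] (hR : SchemeRegime B θ k j L K C₀ δt Cl Cg)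
    {ψ : ℕ → Ω → L2 d} (h : IsSchemeSolution W P B θ k j L K N C₀ δt φ₀ ψ) :
    ∀ᵐ ω ∂P, ∀ n ≤ N, ψ n ω = schemeSol W B θ k L K N C₀ δt φ₀ n ω := by
  filter_upwards [h.init, h.step] with ω h0 hs n hn
  induction n with
  | zero => exact h0
  | succ n ih =>
    have := hs n hn
    rw [ih (by omega)] at this
    exact hR.eq_schemeSol_succ this

theorem expSup_le_of_sigmaNorm_le {φ : ℕ → Ω → L2 d} {e : ℕ → Ω → ℝ} {C D : ℝ} (hC : 0 ≤ C)
    (h : ∀ n ≤ N, ∀ ω, sigmaNorm j (φ n ω) ^ 2 ≤ C * e n ω)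
    (hD : ∫⁻ ω, ENNReal.ofReal (runMax (fun i => e i ω) N) ∂P ≤ ENNReal.ofReal D) :
    expSup P j N φ ≤ ENNReal.ofReal (C * D) := by
  calc expSup P j N φ
      ≤ ∫⁻ ω, ENNReal.ofReal C * ENNReal.ofReal (runMax (fun i => e i ω) N) ∂P := by
        refine lintegral_mono fun ω => iSup_le fun n => ?_
        rw [← ENNReal.ofReal_mul hC]
        refine ENNReal.ofReal_le_ofReal ((h n (by omega) ω).trans ?_)
        exact mul_le_mul_of_nonneg_left (le_runMax (fun i => e i ω) (by omega)) hC
    _ = ENNReal.ofReal C * ∫⁻ ω, ENNReal.ofReal (runMax (fun i => e i ω) N) ∂P :=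
        lintegral_const_mul' _ _ ENNReal.ofReal_ne_top
    _ ≤ ENNReal.ofReal C * ENNReal.ofReal D := by gcongr
    _ = _ := (ENNReal.ofReal_mul hC).symm

end Existence

theorem LipschitzNonK.mono {θ : ℝ → ℝ} {k L : ℕ} {C C' : ℝ} (h : LipschitzNonK d θ k L C)
    (hC : C ≤ C') : LipschitzNonK d θ k L C' := fun K u u' v v' hu hu' hv hv' =>
  (h K u u' v v' hu hu' hv hv').trans (mul_le_mul_of_nonneg_right hC (by positivity))

theorem sobolevOrder_le (hd : d ≤ 3) (hd1 : 1 ≤ d) {k : ℕ} (h : (d : ℝ) / 2 < k) :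
    sobolevOrder d ≤ k := by
  have h' : d < 2 * k := by
    have : (d : ℝ) < 2 * k := by linarith
    exact_mod_cast this
  unfold sobolevOrder
  split_ifs <;> omega

/-- The bounds on the nonlinearity are uniform in the index of the cutoff. -/
theorem exists_nonK_bounds [NeZero d] (hd : d ≤ 3) {θ : ℝ → ℝ} (hθ : IsCutoff θ) (j : ℕ) {L : ℕ}
    (hL : 1 ≤ L) : ∃ C : ℝ, 0 < C ∧ ∀ k : ℕ, sobolevOrder d ≤ k → k ≤ j →
      LipschitzNonK d θ k L C ∧ ∀ (K : ℕ) (u v : L2 d), u ∈ SigmaK d K → v ∈ SigmaK d K →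
        ‖Lam K j (nonK θ k L K u v)‖ ≤ C * max ‖Lam K j u‖ ‖Lam K j v‖ := by
  have h : ∀ k : ℕ, ∃ C : ℝ, 0 < C ∧ (sobolevOrder d ≤ k → k ≤ j →
      LipschitzNonK d θ k L C ∧ ∀ (K : ℕ) (u v : L2 d), u ∈ SigmaK d K → v ∈ SigmaK d K →
        ‖Lam K j (nonK θ k L K u v)‖ ≤ C * max ‖Lam K j u‖ ‖Lam K j v‖) := by
    intro k
    by_cases hk : sobolevOrder d ≤ k ∧ k ≤ j
    · obtain ⟨C₁, hC₁, h₁⟩ := exists_norm_Lam_nonK_sub_le hd hθ hL hk.1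
      obtain ⟨C₂, hC₂, h₂⟩ := exists_norm_Lam_nonK_le hd hθ hL hk.1 hk.2
      refine ⟨C₁ + C₂, by positivity, fun _ _ =>
        ⟨LipschitzNonK.mono h₁ (by linarith), fun K u v hu hv => (h₂ K u v hu hv).trans ?_⟩⟩
      exact mul_le_mul_of_nonneg_right (by linarith) (le_max_of_le_left (norm_nonneg _))
    · exact ⟨1, one_pos, fun h1 h2 => absurd ⟨h1, h2⟩ hk⟩
  choose C hC h using h
  refine ⟨∑ k ∈ Finset.range (j + 1), C k,
    Finset.sum_pos (fun k _ => hC k) ⟨0, by simp⟩, fun k hk hkj => ?_⟩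
  have hle : C k ≤ ∑ k ∈ Finset.range (j + 1), C k :=
    Finset.single_le_sum (fun i _ => (hC i).le) (Finset.mem_range.2 (by omega))
  obtain ⟨h1, h2⟩ := h k hk hkj
  exact ⟨h1.mono hle, fun K u v hu hv => (h2 K u v hu hv).trans
    (mul_le_mul_of_nonneg_right hle (le_max_of_le_left (norm_nonneg _)))⟩

/-- With r = δt^{1/4} all powers of the time step become integer powers of r, and the condition on K
reads K r ≤ K₀. -/
theorem exists_pow_four_eq {δt : ℝ} (h : 0 < δt) :
    ∃ r : ℝ, 0 < r ∧ r ^ 4 = δt ∧ δt ^ (-(1 / 4) : ℝ) = r⁻¹ := by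
  refine ⟨δt ^ (1 / 4 : ℝ), by positivity, ?_, Real.rpow_neg h.le _⟩
  rw [← Real.rpow_natCast, ← Real.rpow_mul h.le]
  norm_num

end GP

/-! ### Choice of the constants and proof of the proposition. -/

theorem mainTheorem3 (d : ℕ) (hd : 1 ≤ d) (hd' : d ≤ 3)
    (B : ℕ → GP.L2 d →L[ℂ] GP.L2 d) (hB : GP.StabilityAssumption B)
    (θ : ℝ → ℝ) (hθ : GP.IsCutoff θ) (j : ℕ) :
    (∃ C₀ : ℝ, GP.AdmissibleThreshold B j C₀) ∧
    ∀ C₀ : ℝ, GP.AdmissibleThreshold B j C₀ →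
    ∀ L : ℕ, 1 ≤ L → ∀ K₀ : ℝ, 0 < K₀ →
    ∃ δt₀ : ℝ, 0 < δt₀ ∧ ∀ T : ℝ, 0 < T → ∃ C : ℝ, 0 < C ∧
    ∀ k : ℕ, (d : ℝ) / 2 < k → k ≤ j →
    ∀ (Ω : Type*) [MeasurableSpace Ω] (P : Measure Ω) [IsProbabilityMeasure P]
      (W : ℝ≥0 → Ω → ℝ), (∀ t, Measurable (W t)) → IsBrownianReal W P →
    ∀ φ₀ : GP.L2 d, GP.MemSigma j φ₀ →
    ∀ N : ℕ, 1 ≤ N → T / N ≤ δt₀ →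
    ∀ K : ℕ, 1 ≤ K → (K : ℝ) ≤ K₀ * (T / N) ^ (-(1 / 4) : ℝ) →
    ∃ φ : ℕ → Ω → GP.L2 d,
      GP.IsSchemeSolution W P B θ k j L K N C₀ (T / N) φ₀ φ ∧
      GP.expSup P j N φ ≤ ENNReal.ofReal (C * GP.sigmaNorm j φ₀ ^ 2) ∧
      ∀ ψ : ℕ → Ω → GP.L2 d, GP.IsSchemeSolution W P B θ k j L K N C₀ (T / N) φ₀ ψ →
        ∀ᵐ ω ∂P, ∀ n ≤ N, ψ n ω = φ n ω := by
  have : NeZero d := ⟨by omega⟩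
  refine ⟨GP.exists_admissibleThreshold hB j, fun C₀ hC₀ L hL K₀ hK₀ => ?_⟩
  obtain ⟨Cn, hCn, hn⟩ := GP.exists_nonK_bounds hd' hθ j hL
  obtain ⟨Ce, hCe, he⟩ := GP.exists_energy_step_le hB j hK₀ hCn.le
  obtain ⟨Cq, hCq, hq⟩ := GP.exists_abs_comForm_le hB j
  obtain ⟨Cs, hCs, hs⟩ := GP.exists_sigmaNorm_le (d := d) j
  obtain ⟨Cl, hCl, hl⟩ := GP.exists_norm_Lam_le_sigmaNorm (d := d) j
  have hM : 0 < Real.sqrt 2 * Cn + 1 := by positivity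
  -- This choice gives δt √2 Cn + δt ≤ 1/2, hence both the smallness needed for the contraction and
  -- δt < 1.
  refine ⟨1 / (2 * (Real.sqrt 2 * Cn + 1)), by positivity, fun T hT => ?_⟩
  have hm0 := GP.cubeMoment_nonneg
  set D : ℝ := 4 * Real.exp ((2 * (Cq + 9 * Ce) + 4 * (Cq + 9 * Ce) ^ 2) * GP.cubeMoment * T) *
    Real.exp (4 * (Cq + 9 * Ce) * GP.cubeMoment * T) + 1 with hD
  have hD0 : 0 < D := by positivity
  -- D is the constant of the maximal inequality, while Cs and Cl convert between the spectral and
  -- the Σ^j norms at both ends. None depends on k, as the bounds on the nonlinearity are uniform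
  -- for k ≤ j.
  refine ⟨Cs ^ 2 * (D * Cl ^ 2), by positivity, ?_⟩
  intro k hdk hkj Ω _ P _ W hWm hW φ₀ hφ₀ N hN hδ K hK hKδ
  have hN0 : (0 : ℝ) < N := by exact_mod_cast hN
  obtain ⟨r, hr, hr4, hr1⟩ := GP.exists_pow_four_eq (div_pos hT hN0)
  rw [hr1] at hKδ
  rw [← hr4] at hδ ⊢
  have hr4' : (N : ℝ) * (r ^ 2) ^ 2 ≤ T := by
    rw [← pow_mul, hr4, mul_div_cancel₀ _ hN0.ne']
  have hKr : K * r ≤ K₀ := by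
    calc K * r ≤ K₀ * r⁻¹ * r := mul_le_mul_of_nonneg_right hKδ hr.le
      _ = K₀ := inv_mul_cancel_right₀ hr.ne' K₀
  rw [le_div_iff₀ (by positivity)] at hδ
  have hr40 : 0 < r ^ 4 := by positivity
  have hsmall : r ^ 4 * (Real.sqrt 2 * Cn) ≤ 1 / 2 := by linarith
  have hlt : r ^ 4 < 1 := by
    have : 0 ≤ r ^ 4 * (Real.sqrt 2 * Cn) := by positivity
    linarith
  have hr1' : r < 1 := (pow_lt_one_iff_of_nonneg hr.le (by norm_num)).1 hlt
  have hk := GP.sobolevOrder_le hd' hd hdk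
  have hR : GP.SchemeRegime B θ k j L K C₀ (r ^ 4) Cn Cn :=
    ⟨hB, hC₀, hK, hr40, hlt, hkj, (hn k hk hkj).1, hsmall, (hn k hk hkj).2, hCn.le, hsmall⟩
  have hbal := hR.energyBalance (W := W) (N := N) (φ₀ := φ₀) hr hCe hCq (hq K hK)
    (fun χ m u v G => he K hK r χ m hr hr1'.le hKr u v G)
  have hint := hbal.lintegral_runMax_le (GP.isGaussianNoise_noise hW.toIsPreBrownianReal hWm hr40)
    (by positivity) (by positivity) (pow_le_one₀ hr.le hr1'.le)
    (GP.measurable_cutNoise _ _) (GP.cutNoise_neg _ _) (GP.abs_cutNoise_le _ _) hr4'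
  rw [← hD] at hint
  have hexp := GP.expSup_le_of_sigmaNorm_le (j := j)
    (φ := GP.schemeSol W B θ k L K N C₀ (r ^ 4) φ₀) (sq_nonneg Cs)
    (fun n _ ω => by
      rw [← mul_pow]
      exact pow_le_pow_left₀ (GP.sigmaNorm_nonneg _ _) (hs K _ (GP.schemeSol_mem n ω)) 2) hint
  have hle : GP.expSup P j N (GP.schemeSol W B θ k L K N C₀ (r ^ 4) φ₀) ≤
      ENNReal.ofReal (Cs ^ 2 * (D * Cl ^ 2) * GP.sigmaNorm j φ₀ ^ 2) := by
    refine hexp.trans (ENNReal.ofReal_le_ofReal ?_)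
    calc Cs ^ 2 * (D * ‖GP.Lam K j φ₀‖ ^ 2) ≤ Cs ^ 2 * (D * (Cl * GP.sigmaNorm j φ₀) ^ 2) :=
          mul_le_mul_of_nonneg_left (mul_le_mul_of_nonneg_left
            (pow_le_pow_left₀ (norm_nonneg _) (hl K φ₀ hφ₀) 2) hD0.le) (sq_nonneg Cs)
      _ = _ := by ring
  exact ⟨_, hR.isSchemeSolution (hle.trans_lt ENNReal.ofReal_lt_top), hle,
    fun ψ hψ => hR.ae_eq_schemeSol hψ⟩
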